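/- **Setting.** Let $A\subset\mathbb R$ be a finite alphabet, $\|A\|_\infty=\max_{a\in A}|a|$, $\mathrm{Diam}(A)=\max_{a,b\in A}|a-b|$, and $d_{TV}(\mu,\nu)=\frac12\sum_{a\in A}|\mu(a)-\nu(a)|$. Let $(X_t)_{t\in\mathbb Z}$ be a stationary $A$-valued Markov chain of order $d$ following a mixture transition distribution (MTD) model, i.e. with transition probabilities $$p(a|x_{-d:-1})=\lambda_0p_0(a)+\sum_{j=-d}^{-1}\lambda_jp_j(a|x_j),$$ where $\lambda_0,\lambda_{-1},\dots,\lambda_{-d}\ge 0$ sum to $1$ and $p_0$, $p_j(\cdot|b)$ are probability measures on $A$. Put $\delta_j=\lambda_j\max_{b,c\in A}d_{TV}(p_j(\cdot|b),p_j(\cdot|c))$, let $\Lambda=\{j\in\{-d,\dots,-1\}:\delta_j>0\}$ be the set of relevant lags, $\delta_{\min}=\min_{j\in\Lambda}\delta_j$, and $m_j(b)=\sum_{a\in A}a\,p_j(a|b)$. For finite $S\subset\mathbb Z$ and $x\in A^S$ write $\mathbf P(x)=\mathbb P(X_S=x)$. Assume 1. (full support) $\mathbf P(x)>0$ for all finite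 $S\subset\mathbb Z$ and all $x\in A^S$; 2. $\Delta:=1-\sum_{j\in\Lambda}\delta_j>0$; 3. for every $j\in\Lambda$ there are $b,c\in A$ with $m_j(b)\ne m_j(c)$. Let $\kappa>0$ be a constant such that for every $S\subseteq\{-d,\dots,-1\}$ with $\Lambda\not\subseteq S$ there is $k\in\Lambda\setminus S$ with $\mathbb E\,|\mathrm{Cov}_{X_S}(X_0,X_k)|\ge\kappa$ ($\mathrm{Cov}_{x_S}$ is the covariance conditionally on $X_S=x_S$). Put $$\xi_*=\frac{\kappa}{4\|A\|_\infty\mathrm{Diam}(A)},\qquad \ell_*=\Big\lfloor\frac{\log_2|A|}{8\xi_*^2}\Big\rfloor$$ (with $\ell_*=0$ if $|A|=1$). For $\Lambda\subseteq S\subseteq\{-d,\dots,-1\}$ let $$\mathbf P_S=\min_{j\in\Lambda}\ \min_{b\ne c}\ \max_{(x,y)\in\mathcal C_j(b,c)}\min\{\mathbf P(x),\mathbf P(y)\},$$ where $\mathcal C_j(b,c)$ is the set of pairs $x,y\in A^S$ that agree off $j$ and have $x_j=b$, $y_j=c$; let $\mathbf P_{S_{d,\ell}}$ be the minimum of $\mathbf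 P_S$ over the sets $S\subseteq\{-d,\dots,-1\}$ with $\Lambda\subseteq S$ and $|S|\le\ell$. **Estimator.** For $S\subseteq\{-d,\dots,-1\}$, $x\in A^S$, $a\in A$ let $N_{m,n}(x,a)=\#\{t\in\{m+d+1,\dots,n\}:X_{t+j}=x_j\ \forall j\in S,\ X_t=a\}$, $\bar N_{m,n}(x)=\sum_aN_{m,n}(x,a)$, and $\hat p_{m,n}(a|x)=N_{m,n}(x,a)/\bar N_{m,n}(x)$ if $\bar N_{m,n}(x)>0$, $\hat p_{m,n}(a|x)=1/|A|$ otherwise. Let $\hat{\mathbf P}_m(x)=\bar N_{0,m}(x)/(m-d)$ and $\hat{\mathbf P}_m(x,a)=N_{0,m}(x,a)/(m-d)$; for $k\in\{-d,\dots,-1\}\setminus S$ and $x\in A^S$ let $xb$ be the string on $S\cup\{k\}$ equal to $x$ on $S$ and to $b$ at $k$, and put $$\hat\nu_{m,k,S}=\sum_{x\in A^S}\hat{\mathbf P}_m(x)\sum_{b,c\in A}\frac{\hat{\mathbf P}_m(xb)\hat{\mathbf P}_m(xc)}{\hat{\mathbf P}_m(x)^2}\cdot\frac12\sum_{a\in A}\Big|\frac{\hat{\mathbf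 P}_m(xb,a)}{\hat{\mathbf P}_m(xb)}-\frac{\hat{\mathbf P}_m(xc,a)}{\hat{\mathbf P}_m(xc)}\Big|$$ (terms with a vanishing denominator are $0$). Forward step with $\ell$ steps: start with $S=\emptyset$ and, $\ell$ times, add to $S$ a lag maximising $\hat\nu_{m,k,S}$ over $k\in\{-d,\dots,-1\}\setminus S$, ties being broken by any rule depending on $X_1,\dots,X_m$ only; call the result $\hat S_m$. Cut step, with parameters $\varepsilon>0$, $\alpha>0$ and $\mu\in(0,3)$ such that $\mu>\psi(\mu):=e^\mu-\mu-1$: the Forward Stepwise and Cut estimator $\hat\Lambda_{2,n}$ consists of those $j\in\hat S_m$ for which there are $x,y\in A^{\hat S_m}$ agreeing off $j$ with $d_{TV}(\hat p_{m,n}(\cdot|x),\hat p_{m,n}(\cdot|y))\ge s_{m,n}(x)+s_{m,n}(y)$, where $$s_{m,n}(x)=\sqrt{\frac{\alpha(1+\varepsilon)}{2\bar N_{m,n}(x)}}\sum_{a\in A}\sqrt{\frac{\mu}{\mu-\psi(\mu)}\hat p_{m,n}(a|x)+\frac{\alpha}{(\mu-\psi(\mu))\bar N_{m,n}(x)}}+\frac{\alpha|A|}{6\bar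 N_{m,n}(x)},$$ and $s_{m,n}(x)=+\infty$ if $\bar N_{m,n}(x)=0$. **Theorem.** For all $\varepsilon>0$ and $\mu\in(0,3)$ with $\mu>\psi(\mu)$ there is a constant $C=C(\varepsilon,\mu)>0$ such that the following holds for every chain as above, every $\kappa$ as above and every $\alpha>0$. Let $\hat\Lambda_{2,n}$ be the Forward Stepwise and Cut estimator with $\ell=\ell_*$, and suppose $m>d\ge2\ell_*$. If $$n\ge m+d+\frac{C|A|\alpha}{\delta_{\min}^2\,\mathbf P_{S_{d,\ell_*}}}$$ (to be read as $n\ge m+d$ if $\Lambda=\emptyset$), then $$\begin{aligned}\mathbb P(\hat\Lambda_{2,n}\ne\Lambda)\le{}&2|A|(\ell_*+1)\binom d{\ell_*}\Big[d|A|^{\ell_*+1}\exp\Big\{-\frac{(\xi_*\Delta)^2(m-d)^2}{18m|A|^{2(\ell_*+2)}(\ell_*+2)^2}\Big\}\\&\qquad+3(|A|-1)|\Lambda|\exp\Big\{-\frac{\Delta^2(n-m-d)^2\mathbf P_{S_{d,\ell_*}}^2}{8(n-m)(\ell_*+1)^2}\Big\}\Big]\\&+8|A|\big((\ell_*-|\Lambda|)(n-m-d)+|\Lambda|\big)\Big\lceil\frac{\log(\mu(n-m-d)/\alpha+2)}{\log(1+\varepsilon)}\Big\rceil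 e^{-\alpha}.\end{aligned}$$ -/

import Mathlib

open MeasureTheory ProbabilityTheory

noncomputable section

namespace LagSelection

/-- The lags `-d, …, -1`. -/
def lags (d : ℕ) : Finset ℤ := Finset.Icc (-(d : ℤ)) (-1)

/-- Total variation distance of two functions (probability vectors) on the alphabet `A`. -/
def dTV {A : Finset ℝ} (p q : A → ℝ) : ℝ := (1 / 2) * ∑ a, |p a - q a|

/-- `‖A‖_∞ = max_{a ∈ A} |a|`. -/
def supAbs (A : Finset ℝ) : ℝ := ⨆ a : A, |(a : ℝ)|

/-- `Diam(A) = max_{a, b ∈ A} |a - b|`. -/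
def diamA (A : Finset ℝ) : ℝ := Metric.diam (A : Set ℝ)

/-! ### Mixture transition distribution (MTD) models -/

/-- The parameters of an MTD model of order `d` on the alphabet `A`: weights
`lam0, lam j` (`j = -d, …, -1`) forming a probability vector, a probability vector `p0` on `A`
and, for each lag `j` and each symbol `b`, a probability vector `p j b` on `A`;
`p j b a` is `p_j(a | b)`. -/
structure MTD (A : Finset ℝ) (d : ℕ) where
  lam0 : ℝ
  lam : ℤ → ℝ
  p0 : A → ℝ
  p : ℤ → A → A → ℝ
  lam0_nonneg : 0 ≤ lam0
  lam_nonneg : ∀ j ∈ lags d, 0 ≤ lam j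
  lam_sum : lam0 + ∑ j ∈ lags d, lam j = 1
  p0_nonneg : ∀ a, 0 ≤ p0 a
  p0_sum : ∑ a, p0 a = 1
  p_nonneg : ∀ j ∈ lags d, ∀ b a, 0 ≤ p j b a
  p_sum : ∀ j ∈ lags d, ∀ b, ∑ a, p j b a = 1

namespace MTD

variable {A : Finset ℝ} {d : ℕ} (M : MTD A d)

/-- `p(a | x_{-d:-1}) = λ_0 p_0(a) + ∑_j λ_j p_j(a | x_j)`. -/
def trans (x : ℤ → A) (a : A) : ℝ :=
  M.lam0 * M.p0 a + ∑ j ∈ lags d, M.lam j * M.p j (x j) a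

/-- The oscillation `δ_j = λ_j max_{b, c} d_TV(p_j(· | b), p_j(· | c))` of the lag `j`. -/
def osc (j : ℤ) : ℝ := M.lam j * ⨆ bc : A × A, dTV (M.p j bc.1) (M.p j bc.2)

open Classical in
/-- The set `Λ` of relevant lags. -/
def relevant : Finset ℤ := (lags d).filter fun j => 0 < M.osc j

/-- `δ_min = min_{j ∈ Λ} δ_j`. -/
def oscMin : ℝ := ⨅ j : M.relevant, M.osc j

/-- `Δ = 1 - ∑_{j ∈ Λ} δ_j`. -/
def Delta : ℝ := 1 - ∑ j ∈ M.relevant, M.osc j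

/-- The conditional average `m_j(b) = ∑_a a p_j(a | b)`. -/
def condAvg (j : ℤ) (b : A) : ℝ := ∑ a : A, (a : ℝ) * M.p j b a

/-- The conditional averages of the relevant lags are not constant. -/
def NondegenerateAverages : Prop :=
  ∀ j ∈ M.relevant, ∃ b c : A, M.condAvg j b ≠ M.condAvg j c

end MTD

section Chain

variable {Ω : Type*} [MeasurableSpace Ω] {A : Finset ℝ} {d : ℕ}

/-- The event `X_i = x_i` for all `i` in `{s, …, t}`. -/
def windowEvent (X : ℤ → Ω → A) (x : ℤ → A) (s t : ℤ) : Set Ω :=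
  {ω | ∀ i ∈ Finset.Icc s t, X i ω = x i}

/-- `X` is a stationary Markov chain of order `d` whose transition probabilities are those of the
MTD model `M`. -/
structure IsMTDChain (P : Measure Ω) (X : ℤ → Ω → A) (M : MTD A d) : Prop where
  measurable : ∀ t, Measurable (X t)
  stationary : ∀ (s t h : ℤ) (x : ℤ → A),
    P {ω | ∀ i ∈ Finset.Icc s t, X (i + h) ω = x i} = P (windowEvent X x s t)
  markov : ∀ (k : ℕ) (t : ℤ) (x : ℤ → A), d < k →
    0 < P (windowEvent X x (t - k) (t - 1)) →
    P[|windowEvent X x (t - k) (t - 1)] {ω | X t ω = x t} =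
      P[|windowEvent X x (t - d) (t - 1)] {ω | X t ω = x t}
  transition : ∀ (x : ℤ → A) (a : A), 0 < P (windowEvent X x (-d) (-1)) →
    (P[|windowEvent X x (-d) (-1)]).real {ω | X 0 ω = a} = M.trans x a

/-- The event `X_S = x`, for a string `x ∈ A^S`. -/
def stringEvent (X : ℤ → Ω → A) {S : Finset ℤ} (x : S → A) : Set Ω :=
  {ω | ∀ j : S, X j ω = x j}

/-- Full support: every finite string has positive probability. -/
def FullSupport (P : Measure Ω) (X : ℤ → Ω → A) : Prop :=
  ∀ (S : Finset ℤ) (x : S → A), 0 < P (stringEvent X x)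

/-- `E |Cov_{X_S}(X_0, X_k)|`, the mean absolute conditional covariance of `X_0` and `X_k`
given `X_S`. -/
def meanAbsCondCov (P : Measure Ω) (X : ℤ → Ω → A) (k : ℤ) (S : Finset ℤ) : ℝ :=
  ∑ x : S → A, P.real (stringEvent X x) *
    |cov[fun ω => (X 0 ω : ℝ), fun ω => (X k ω : ℝ); P[|stringEvent X x]]|

/-- `κ` is a lower bound for the covariances: every set `S` of lags which misses a relevant lag
leaves out a relevant lag `k` with `E |Cov_{X_S}(X_0, X_k)| ≥ κ`. -/
def IsCovLowerBound (P : Measure Ω) (X : ℤ → Ω → A) (M : MTD A d) (κ : ℝ) : Prop :=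
  ∀ S ⊆ lags d, ¬ M.relevant ⊆ S → ∃ k ∈ M.relevant \ S, κ ≤ meanAbsCondCov P X k S

/-- The set `C_j(b, c)` of pairs of strings in `A^S` which agree off `j` and have the symbols
`b` and `c` at `j` (for `j ∈ S`). -/
def compatiblePairs (S : Finset ℤ) (j : ℤ) (b c : A) : Set ((S → A) × (S → A)) :=
  {xy | ∀ i : S, ((i : ℤ) = j → xy.1 i = b ∧ xy.2 i = c) ∧ ((i : ℤ) ≠ j → xy.1 i = xy.2 i)}

/-- `P_S = min_{j ∈ Λ} min_{b ≠ c} max_{(x, y) ∈ C_j(b, c)} P(x) ∧ P(y)`, for `Λ ⊆ S`. -/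
def minMaxProb (P : Measure Ω) (X : ℤ → Ω → A) (M : MTD A d) (S : Finset ℤ) : ℝ :=
  ⨅ j : M.relevant, ⨅ bc : {bc : A × A // bc.1 ≠ bc.2},
    ⨆ xy : compatiblePairs S (j : ℤ) bc.1.1 bc.1.2,
      min (P.real (stringEvent X xy.1.1)) (P.real (stringEvent X xy.1.2))

/-- `P_{S_{d,ℓ}}`, the minimum of `P_S` over the sets `S` of at most `ℓ` lags for which `P_S` is
meaningful, that is `Λ ⊆ S`. -/
def minMaxProbSize (P : Measure Ω) (X : ℤ → Ω → A) (M : MTD A d) (ℓ : ℕ) : ℝ :=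
  ⨅ S : {S : Finset ℤ // M.relevant ⊆ S ∧ S ⊆ lags d ∧ S.card ≤ ℓ}, minMaxProb P X M S.1

end Chain

/-- `ξ_* = κ / (4 ‖A‖_∞ Diam(A))`. -/
def xiStar (A : Finset ℝ) (κ : ℝ) : ℝ := κ / (4 * supAbs A * diamA A)

/-- `ℓ_* = ⌊log_2 |A| / (8 ξ_*^2)⌋`. -/
def ellStar (A : Finset ℝ) (κ : ℝ) : ℕ := ⌊Real.logb 2 A.card / (8 * xiStar A κ ^ 2)⌋₊

/-! ### Empirical quantities and the estimator

A realisation of the chain is a path `z : ℤ → A`; the quantities with indices `m`, `n` below depend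
on `z (m+1), …, z n` only. -/

section Empirical

variable {A : Finset ℝ}

open Classical in
/-- `N_{m,n}(x_S, a)`: the number of `t ∈ {m+d+1, …, n}` with `z_{t+j} = x_j` for `j ∈ S` and
`z_t = a`. -/
def count (d m n : ℕ) (z : ℤ → A) {S : Finset ℤ} (x : S → A) (a : A) : ℕ :=
  ((Finset.Icc ((m : ℤ) + d + 1) n).filter
    fun t => (∀ j : S, z (t + j) = x j) ∧ z t = a).card

/-- `N̄_{m,n}(x_S) = ∑_a N_{m,n}(x_S, a)`. -/
def countBar (d m n : ℕ) (z : ℤ → A) {S : Finset ℤ} (x : S → A) : ℕ :=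
  ∑ a, count d m n z x a

/-- The empirical transition probability `p̂_{m,n}(a | x_S)`. -/
def pHat (d m n : ℕ) (z : ℤ → A) {S : Finset ℤ} (x : S → A) (a : A) : ℝ :=
  if 0 < countBar d m n z x then (count d m n z x a : ℝ) / countBar d m n z x
  else 1 / (A.card : ℝ)

/-- The string on `S ∪ {k}` which is `x` on `S` and `b` at `k` (for `k ∉ S`). -/
def addSymbol {S : Finset ℤ} (x : S → A) (k : ℤ) (b : A) :
    ((insert k S : Finset ℤ) : Type) → A :=
  fun j => if h : (j : ℤ) ∈ S then x ⟨j, h⟩ else b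

/-- `P̂_m(x_S)`, the empirical probability of `x_S` in the first `m` symbols. -/
def probHat (d m : ℕ) (z : ℤ → A) {S : Finset ℤ} (x : S → A) : ℝ :=
  (countBar d 0 m z x : ℝ) / ((m : ℝ) - d)

/-- `P̂_m(x a)`, the empirical probability of `x_S` followed by `a` at time `0`. -/
def probHat₀ (d m : ℕ) (z : ℤ → A) {S : Finset ℤ} (x : S → A) (a : A) : ℝ :=
  (count d 0 m z x a : ℝ) / ((m : ℝ) - d)

/-- The empirical weight `ŵ_{m,k,S}(b, c, x_S)`. -/
def wHat (d m : ℕ) (z : ℤ → A) (k : ℤ) {S : Finset ℤ} (x : S → A) (b c : A) : ℝ :=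
  (probHat d m z (addSymbol x k b) / probHat d m z x) *
    (probHat d m z (addSymbol x k c) / probHat d m z x)

/-- The empirical distance `d̂_{m,k,S}(b, c, x_S)`. -/
def dHat (d m : ℕ) (z : ℤ → A) (k : ℤ) {S : Finset ℤ} (x : S → A) (b c : A) : ℝ :=
  dTV (fun a => probHat₀ d m z (addSymbol x k b) a / probHat d m z (addSymbol x k b))
    (fun a => probHat₀ d m z (addSymbol x k c) a / probHat d m z (addSymbol x k c))

/-- The empirical average influence `ν̂_{m,k,S}` of the lag `k`, given the lags in `S`, computed
from the first `m` symbols. Terms in which a string does not occur are zero, because the quotients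
above then vanish. -/
def nuHat (d m : ℕ) (z : ℤ → A) (k : ℤ) (S : Finset ℤ) : ℝ :=
  ∑ x : S → A, probHat d m z x * ∑ b, ∑ c, wHat d m z k x b c * dHat d m z k x b c

/-- The sets which the forward stepwise iteration can reach: start at `∅` and repeatedly add a lag
which maximises `ν̂_{m,k,S}` over the lags `k ∉ S`. -/
inductive FSReach (d m : ℕ) (z : ℤ → A) : Finset ℤ → Prop
  | empty : FSReach d m z ∅
  | step (S : Finset ℤ) (j : ℤ) : FSReach d m z S → j ∈ lags d \ S →
      (∀ k ∈ lags d \ S, nuHat d m z k S ≤ nuHat d m z j S) → FSReach d m z (insert j S)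

/-- `S` is an outcome of the forward stepwise iteration with `ℓ` steps. -/
def FSOutput (d m ℓ : ℕ) (z : ℤ → A) (S : Finset ℤ) : Prop := FSReach d m z S ∧ S.card = ℓ

/-- A forward stepwise candidate set `Ŝ_m` with `ℓ` steps: a function of the first `m` symbols
which, whatever rule it uses to break ties, is an outcome of the iteration. -/
def IsFSCandidate (d m ℓ : ℕ) (Shat : (Finset.Icc (1 : ℤ) m → A) → Finset ℤ) : Prop :=
  ∀ z : ℤ → A, FSOutput d m ℓ z (Shat fun t => z t)

/-- `ψ(μ) = e^μ - μ - 1`. -/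
def psi (mu : ℝ) : ℝ := Real.exp mu - mu - 1

/-- The variance proxy `V̂_{m,n}(a, x_S) = μ/(μ-ψ(μ)) p̂(a|x_S) + α/((μ-ψ(μ)) N̄(x_S))`. -/
def VHat (d m n : ℕ) (α mu : ℝ) (z : ℤ → A) {S : Finset ℤ} (x : S → A) (a : A) : ℝ :=
  mu / (mu - psi mu) * pHat d m n z x a + α / ((mu - psi mu) * countBar d m n z x)

/-- The threshold `s_{m,n}(x_S)`, for a string `x_S` with `N̄_{m,n}(x_S) > 0`. -/
def threshold (d m n : ℕ) (ε α mu : ℝ) (z : ℤ → A) {S : Finset ℤ} (x : S → A) : ℝ :=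
  Real.sqrt (α * (1 + ε) / (2 * countBar d m n z x)) *
      ∑ a, Real.sqrt (VHat d m n α mu z x a)
    + α * A.card / (6 * countBar d m n z x)

open Classical in
/-- The `CUT` step: keep the lags `j ∈ S` for which
`d_TV(p̂_{m,n}(· | x), p̂_{m,n}(· | y)) ≥ s_{m,n}(x) + s_{m,n}(y)` for some strings `x, y ∈ A^S`
which agree off `j`. The threshold of a string which does not occur is `+∞`. -/
def cut (d m n : ℕ) (ε α mu : ℝ) (z : ℤ → A) (S : Finset ℤ) : Finset ℤ :=
  S.filter fun j => ∃ x y : S → A, (∀ i : S, (i : ℤ) ≠ j → x i = y i) ∧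
    0 < countBar d m n z x ∧ 0 < countBar d m n z y ∧
    threshold d m n ε α mu z x + threshold d m n ε α mu z y ≤
      dTV (pHat d m n z x) (pHat d m n z y)

/-- The Forward Stepwise and Cut estimator computed from `z_1, …, z_n`, with candidate set
`Shat (z_1, …, z_m)`. -/
def fsc (d m n : ℕ) (ε α mu : ℝ) (Shat : (Finset.Icc (1 : ℤ) m → A) → Finset ℤ) (z : ℤ → A) :
    Finset ℤ :=
  cut d m n ε α mu z (Shat fun t => z t)

end Empirical

end LagSelection

end

open LagSelection

noncomputable section

namespace LagSelection

section PathMeans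

variable {Ω : Type*} [MeasurableSpace Ω] {A : Finset ℝ} {d : ℕ}

/-- Extension of a string on a finite window to a path, by a fixed symbol. -/
def extendBy {W : Finset ℤ} (a₀ : A) (w : W → A) : ℤ → A :=
  fun i => if h : i ∈ W then w ⟨i, h⟩ else a₀

lemma extendBy_of_mem {W : Finset ℤ} (a₀ : A) (w : W → A) {i : ℤ} (h : i ∈ W) :
    extendBy a₀ w i = w ⟨i, h⟩ := by simp [extendBy, h]

lemma extendBy_restrict_eq_iff {W : Finset ℤ} (a₀ : A) (w : W → A) (z : ℤ → A) :
    (∀ i ∈ W, z i = extendBy a₀ w i) ↔ w = fun i : W => z i := by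
  constructor
  · intro h
    funext i
    rw [h i i.2, extendBy_of_mem _ _ i.2]
  · rintro rfl i hi
    rw [extendBy_of_mem _ _ hi]

open Classical in
lemma DependsOn.eq_sum {W : Finset ℤ} {F : (ℤ → A) → ℝ} (hF : DependsOn F (W : Set ℤ)) (a₀ : A)
    (z : ℤ → A) :
    F z = ∑ w : W → A, F (extendBy a₀ w) * if ∀ i ∈ W, z i = extendBy a₀ w i then 1 else 0 := by
  simp_rw [extendBy_restrict_eq_iff]
  simp only [mul_ite, mul_one, mul_zero, Finset.sum_ite_eq', Finset.mem_univ, if_true]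
  apply hF
  intro i hi
  rw [extendBy_of_mem _ _ hi]

lemma measurable_of_dependsOn {W : Finset ℤ} {F : (ℤ → A) → ℝ} (hF : DependsOn F (W : Set ℤ)) :
    Measurable F := by
  obtain ⟨g, rfl⟩ := dependsOn_iff_exists_comp.1 hF
  refine (Measurable.of_discrete (f := g)).comp ?_
  exact measurable_pi_lambda _ fun i => measurable_pi_apply _

lemma measurableSet_window {X : ℤ → Ω → A} (hX : ∀ t, Measurable (X t)) (W : Finset ℤ)
    (x : ℤ → A) : MeasurableSet {ω | ∀ i ∈ W, X i ω = x i} := by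
  have : {ω | ∀ i ∈ W, X i ω = x i} = ⋂ i ∈ W, X i ⁻¹' {x i} := by
    ext ω; simp
  rw [this]
  exact Finset.measurableSet_biInter _ fun i _ => hX i (measurableSet_singleton _)

lemma measurable_path {X : ℤ → Ω → A} (hX : ∀ t, Measurable (X t)) :
    Measurable fun ω t => X t ω := measurable_pi_lambda _ hX

lemma integrable_path {μ : Measure Ω} [IsFiniteMeasure μ] {X : ℤ → Ω → A}
    (hX : ∀ t, Measurable (X t)) {W : Finset ℤ} {F : (ℤ → A) → ℝ}
    (hF : DependsOn F (W : Set ℤ)) : Integrable (fun ω => F fun t => X t ω) μ := by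
  obtain ⟨g, rfl⟩ := dependsOn_iff_exists_comp.1 hF
  have h1 : Integrable g (μ.map fun ω (i : W) => X i ω) := Integrable.of_finite
  exact h1.comp_measurable (measurable_pi_lambda _ fun i => hX i)

lemma integral_path_eq_sum {μ : Measure Ω} [IsFiniteMeasure μ] {X : ℤ → Ω → A}
    (hX : ∀ t, Measurable (X t)) {W : Finset ℤ} {F : (ℤ → A) → ℝ}
    (hF : DependsOn F (W : Set ℤ)) (a₀ : A) :
    ∫ ω, F (fun t => X t ω) ∂μ =
      ∑ w : W → A, F (extendBy a₀ w) * μ.real {ω | ∀ i ∈ W, X i ω = extendBy a₀ w i} := by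
  classical
  rw [integral_congr_ae (ae_of_all _ fun ω => hF.eq_sum a₀ fun t => X t ω)]
  have hind : ∀ w : W → A, (fun ω => if ∀ i ∈ W, X i ω = extendBy a₀ w i then (1 : ℝ) else 0) =
      {ω | ∀ i ∈ W, X i ω = extendBy a₀ w i}.indicator 1 := by
    intro w; ext ω; simp [Set.indicator_apply]
  rw [integral_finsetSum]
  · refine Finset.sum_congr rfl fun w _ => ?_
    rw [integral_const_mul, hind, integral_indicator_one (measurableSet_window hX W _)]
  · intro w _
    refine Integrable.const_mul ?_ _
    rw [hind]
    exact (integrable_const (1 : ℝ)).indicator (measurableSet_window hX W _)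

variable {P : Measure Ω} {X : ℤ → Ω → A} {M : MTD A d}

lemma IsMTDChain.real_shift (h : IsMTDChain P X M) (s t k : ℤ) (x : ℤ → A) :
    P.real {ω | ∀ i ∈ Finset.Icc s t, X (i + k) ω = x i} = P.real (windowEvent X x s t) := by
  rw [Measure.real, h.stationary, Measure.real]

lemma IsMTDChain.integral_shift [IsFiniteMeasure P] (h : IsMTDChain P X M) [Nonempty A] {s t : ℤ}
    {F : (ℤ → A) → ℝ} (hF : DependsOn F (Finset.Icc s t : Set ℤ)) (k : ℤ) :
    ∫ ω, F (fun i => X (i + k) ω) ∂P = ∫ ω, F (fun i => X i ω) ∂P := by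
  have hF' : DependsOn F ((Finset.Icc s t : Finset ℤ) : Set ℤ) := by simpa using hF
  have a₀ : A := Classical.arbitrary _
  rw [integral_path_eq_sum h.measurable hF' a₀,
    integral_path_eq_sum (X := fun i => X (i + k)) (fun i => h.measurable _) hF' a₀]
  refine Finset.sum_congr rfl fun w _ => ?_
  rw [h.real_shift]; rfl

lemma MTD.trans_congr (M : MTD A d) {x y : ℤ → A} (h : ∀ j ∈ lags d, x j = y j) :
    M.trans x = M.trans y := by
  funext a
  unfold MTD.trans
  congr 1
  exact Finset.sum_congr rfl fun j hj => by rw [h j hj]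

/-- One step of the chain: the probability of a window followed by a symbol. -/
lemma IsMTDChain.real_window_inter [IsProbabilityMeasure P] (h : IsMTDChain P X M) {s t : ℤ}
    (hst : s + d ≤ t) (x : ℤ → A) (a : A) :
    P.real ({ω | X t ω = a} ∩ windowEvent X x s (t - 1)) =
      M.trans (fun j => x (t + j)) a * P.real (windowEvent X x s (t - 1)) := by
  have hmeas : ∀ y u v, MeasurableSet (windowEvent X y u v) := fun y u v =>
    measurableSet_window h.measurable _ _
  rcases eq_or_ne (P (windowEvent X x s (t - 1))) 0 with h0 | h0
  · have : P ({ω | X t ω = a} ∩ windowEvent X x s (t - 1)) = 0 :=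
      measure_mono_null Set.inter_subset_right h0
    simp [Measure.real, h0, this]
  have hpos : 0 < P (windowEvent X x s (t - 1)) := pos_iff_ne_zero.2 h0
  -- the symbol at time `t` is free in `x`
  set x' : ℤ → A := Function.update x t a with hx'
  have hw : ∀ u, windowEvent X x' u (t - 1) = windowEvent X x u (t - 1) := by
    intro u
    ext ω
    simp only [windowEvent, Set.mem_ofPred_eq, Finset.mem_Icc]
    refine forall₂_congr fun i hi => ?_
    rw [hx', Function.update_of_ne (by omega)]
  have hxt : x' t = a := by simp [hx']
  have hsub : windowEvent X x s (t - 1) ⊆ windowEvent X x (t - d) (t - 1) := by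
    intro ω hω i hi
    simp only [Finset.mem_Icc] at hi
    exact hω i (by simp only [Finset.mem_Icc]; omega)
  have hdpos : 0 < P (windowEvent X x (t - d) (t - 1)) := hpos.trans_le (measure_mono hsub)
  have hred : P[|windowEvent X x s (t - 1)] {ω | X t ω = a} =
      P[|windowEvent X x (t - d) (t - 1)] {ω | X t ω = a} := by
    rcases eq_or_lt_of_le hst with he | hlt
    · have : s = t - d := by omega
      rw [this]
    · obtain ⟨k, hk⟩ : ∃ k : ℕ, t - s = k := ⟨(t - s).toNat, by omega⟩
      have hs : s = t - k := by omega
      have := h.markov k t x' (by omega) (by rw [hw, ← hs]; exact hpos)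
      rw [hw, hw, hxt, ← hs] at this
      exact this
  have hshift : ∀ c : A, P.real ({ω | X t ω = c} ∩ windowEvent X x (t - d) (t - 1)) =
      P.real ({ω | X 0 ω = c} ∩ windowEvent X (fun j => x (t + j)) (-d) (-1)) := by
    intro c
    have e1 := h.real_shift (-d) 0 t (Function.update (fun j => x (t + j)) 0 c)
    have e2 : {ω | ∀ i ∈ Finset.Icc (-(d : ℤ)) 0, X (i + t) ω =
        Function.update (fun j => x (t + j)) 0 c i} =
        {ω | X t ω = c} ∩ windowEvent X x (t - d) (t - 1) := by
      ext ω
      simp only [windowEvent, Set.mem_inter_iff, Set.mem_ofPred_eq, Finset.mem_Icc]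
      constructor
      · intro hω
        refine ⟨by simpa using hω 0 (by omega), fun i hi => ?_⟩
        have := hω (i - t) (by omega)
        rw [Function.update_of_ne (by omega)] at this
        simpa using this
      · rintro ⟨h1, h2⟩ i hi
        rcases eq_or_ne i 0 with rfl | hi0
        · simpa using h1
        · rw [Function.update_of_ne hi0, add_comm]
          exact h2 (t + i) (by omega)
    have e3 : windowEvent X (Function.update (fun j => x (t + j)) 0 c) (-d) 0 =
        {ω | X 0 ω = c} ∩ windowEvent X (fun j => x (t + j)) (-d) (-1) := by
      ext ω
      simp only [windowEvent, Set.mem_inter_iff, Set.mem_ofPred_eq, Finset.mem_Icc]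
      constructor
      · intro hω
        refine ⟨by simpa using hω 0 (by omega), fun i hi => ?_⟩
        have := hω i (by omega)
        rwa [Function.update_of_ne (by omega)] at this
      · rintro ⟨h1, h2⟩ i hi
        rcases eq_or_ne i 0 with rfl | hi0
        · simpa using h1
        · rw [Function.update_of_ne hi0]
          exact h2 i (by omega)
    rw [← e2, e1, e3]
  have hshift' : P.real (windowEvent X x (t - d) (t - 1)) =
      P.real (windowEvent X (fun j => x (t + j)) (-d) (-1)) := by
    rw [← h.real_shift (-d) (-1) t]
    congr 1
    ext ω
    simp only [windowEvent, Set.mem_ofPred_eq, Finset.mem_Icc]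
    constructor
    · intro hω i hi
      rw [add_comm]; exact hω (t + i) (by omega)
    · intro hω i hi
      have := hω (i - t) (by omega)
      simpa using this
  have hpos0 : 0 < P (windowEvent X (fun j => x (t + j)) (-d) (-1)) := by
    have h1 : 0 < P.real (windowEvent X x (t - d) (t - 1)) :=
      ENNReal.toReal_pos hdpos.ne' (measure_ne_top _ _)
    rw [hshift'] at h1
    exact (ENNReal.toReal_pos_iff.1 h1).1
  have htr := h.transition (fun j => x (t + j)) a hpos0
  have key : ∀ {E F : Set Ω}, MeasurableSet E → P.real (F ∩ E) = (P[|E]).real F * P.real E := by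
    intro E F hE
    rw [Measure.real, Measure.real, Measure.real, ← ENNReal.toReal_mul, cond_mul_eq_inter hE,
      Set.inter_comm]
  rw [key (hmeas _ _ _), Measure.real, hred, ← Measure.real]
  congr 1
  have hr : 0 < P.real (windowEvent X x (t - d) (t - 1)) :=
    ENNReal.toReal_pos hdpos.ne' (measure_ne_top _ _)
  have e := hshift a
  rw [key (hmeas _ _ _), key (hmeas _ _ _), htr, ← hshift'] at e
  exact mul_right_cancel₀ hr.ne' e

/-- The one-step transition operator at time `t`, acting on functions of a path. -/
def MTD.step (M : MTD A d) (t : ℤ) (F : (ℤ → A) → ℝ) (z : ℤ → A) : ℝ :=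
  ∑ a, M.trans (fun j => z (t + j)) a * F (Function.update z t a)

lemma MTD.dependsOn_step (M : MTD A d) {s t : ℤ} (hst : s + d ≤ t) {F : (ℤ → A) → ℝ}
    (hF : DependsOn F (Finset.Icc s t : Set ℤ)) :
    DependsOn (M.step t F) (Finset.Icc s (t - 1) : Set ℤ) := by
  intro y z h
  simp only [Finset.coe_Icc, Set.mem_Icc] at h
  unfold MTD.step
  refine Finset.sum_congr rfl fun a _ => ?_
  congr 1
  · rw [M.trans_congr]
    intro j hj
    simp only [lags, Finset.mem_Icc] at hj
    exact h _ (by omega)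
  · apply hF
    intro i hi
    simp only [Finset.coe_Icc, Set.mem_Icc] at hi
    rcases eq_or_ne i t with rfl | hne
    · simp
    · simp only [Function.update_of_ne hne]
      exact h i (by omega)

/-- The tower property along the chain. -/
lemma IsMTDChain.integral_step [IsProbabilityMeasure P] (h : IsMTDChain P X M) [Nonempty A]
    {s t : ℤ} (hst : s + d ≤ t) {F : (ℤ → A) → ℝ}
    (hF : DependsOn F (Finset.Icc s t : Set ℤ)) :
    ∫ ω, F (fun i => X i ω) ∂P = ∫ ω, M.step t F (fun i => X i ω) ∂P := by
  classical
  have a₀ : A := Classical.arbitrary _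
  have hFu : ∀ a, DependsOn (fun z => F (Function.update z t a))
      ((Finset.Icc s (t - 1) : Finset ℤ) : Set ℤ) := by
    intro a y z hyz
    apply hF
    intro i hi
    simp only [Finset.coe_Icc, Set.mem_Icc] at hi hyz
    rcases eq_or_ne i t with rfl | hne
    · simp
    · simp only [Function.update_of_ne hne]
      exact hyz i (by omega)
  have hdec : ∀ ω, F (fun i => X i ω) = ∑ a, {ω | X t ω = a}.indicator
      (fun ω => F (Function.update (fun i => X i ω) t a)) ω := by
    intro ω
    simp only [Set.indicator_apply, Set.mem_ofPred_eq, Finset.sum_ite_eq, Finset.mem_univ, if_true]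
    congr 1
    exact (Function.update_eq_self t _).symm
  have hmt : ∀ a, MeasurableSet {ω | X t ω = a} := fun a =>
    h.measurable t (measurableSet_singleton a)
  have htr : ∀ a, DependsOn (fun z : ℤ → A => M.trans (fun j => z (t + j)) a *
      F (Function.update z t a)) ((Finset.Icc s (t - 1) : Finset ℤ) : Set ℤ) := by
    intro a y z hyz
    have := hFu a hyz
    simp only at this ⊢
    rw [this]
    congr 1
    rw [M.trans_congr]
    intro j hj
    simp only [lags, Finset.mem_Icc] at hj
    simp only [Finset.coe_Icc, Set.mem_Icc] at hyz
    exact hyz _ (by omega)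
  simp_rw [hdec]
  unfold MTD.step
  rw [integral_finsetSum _ fun a _ => (integrable_path h.measurable (hFu a)).indicator (hmt a),
    integral_finsetSum _ fun a _ => integrable_path h.measurable (htr a)]
  refine Finset.sum_congr rfl fun a _ => ?_
  rw [integral_indicator (hmt a), integral_path_eq_sum h.measurable (hFu a) a₀,
    integral_path_eq_sum h.measurable (htr a) a₀]
  refine Finset.sum_congr rfl fun w _ => ?_
  rw [measureReal_restrict_apply (measurableSet_window h.measurable _ _), Set.inter_comm]
  have := h.real_window_inter hst (extendBy a₀ w) a
  simp only [windowEvent] at this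
  rw [this]
  ring

lemma MTD.trans_nonneg (M : MTD A d) (x : ℤ → A) (a : A) : 0 ≤ M.trans x a :=
  add_nonneg (mul_nonneg M.lam0_nonneg (M.p0_nonneg a))
    (Finset.sum_nonneg fun j hj => mul_nonneg (M.lam_nonneg j hj) (M.p_nonneg j hj _ _))

lemma MTD.trans_sum (M : MTD A d) (x : ℤ → A) : ∑ a, M.trans x a = 1 := by
  unfold MTD.trans
  rw [Finset.sum_add_distrib, ← Finset.mul_sum, M.p0_sum, Finset.sum_comm, mul_one,
    ← M.lam_sum]
  congr 1
  refine Finset.sum_congr rfl fun j hj => ?_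
  rw [← Finset.mul_sum, M.p_sum j hj, mul_one]

end PathMeans

section FiniteInequalities

variable {ι : Type*} [Fintype ι]

/-- **Hoeffding's lemma** for a probability vector. -/
lemma sum_mul_exp_le_exp (q : ι → ℝ) (hq : ∀ i, 0 ≤ q i) (hq1 : ∑ i, q i = 1) (f : ι → ℝ) (c : ℝ)
    (hf : ∀ i j, f i - f j ≤ c) :
    ∑ i, q i * Real.exp (f i) ≤ Real.exp (∑ i, q i * f i + c ^ 2 / 8) := by
  have hne : Nonempty ι := by
    by_contra h
    rw [not_nonempty_iff] at h
    simp at hq1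
  let _ : MeasurableSpace ι := ⊤
  have : MeasurableSingletonClass ι := ⟨fun _ => trivial⟩
  have hsum : ∑ i, ENNReal.ofReal (q i) = 1 := by
    rw [← ENNReal.ofReal_sum_of_nonneg fun i _ => hq i, hq1, ENNReal.ofReal_one]
  set p : PMF ι := PMF.ofFintype (fun i => ENNReal.ofReal (q i)) hsum with hp
  have hint : ∀ g : ι → ℝ, ∫ i, g i ∂p.toMeasure = ∑ i, q i * g i := by
    intro g
    rw [PMF.integral_eq_sum]
    refine Finset.sum_congr rfl fun i _ => ?_
    rw [hp, PMF.ofFintype_apply, ENNReal.toReal_ofReal (hq i), smul_eq_mul]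
  obtain ⟨i₀, hi₀⟩ := Finite.exists_min f
  have hsg := hasSubgaussianMGF_of_mem_Icc (μ := p.toMeasure) (X := f) (a := f i₀) (b := f i₀ + c)
    (Measurable.of_discrete).aemeasurable
    (ae_of_all _ fun i => ⟨hi₀ i, by have := hf i i₀; linarith⟩)
  have h1 := hsg.mgf_le 1
  rw [mgf, hint, hint] at h1
  have hc : ((((‖f i₀ + c - f i₀‖₊ / 2) ^ 2 : NNReal) : ℝ)) * 1 ^ 2 / 2 = c ^ 2 / 8 := by
    push_cast
    rw [add_sub_cancel_left, Real.norm_eq_abs, div_pow, sq_abs]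
    ring
  rw [hc] at h1
  have h2 : ∑ i, q i * Real.exp (f i) = Real.exp (∑ i, q i * f i) *
      ∑ i, q i * Real.exp (1 * (f i - ∑ i, q i * f i)) := by
    rw [Finset.mul_sum]
    refine Finset.sum_congr rfl fun i _ => ?_
    rw [one_mul, Real.exp_sub]
    field_simp
  rw [h2, Real.exp_add]
  exact mul_le_mul_of_nonneg_left h1 (Real.exp_pos _).le

lemma abs_sum_mul_le_of_sum_eq_zero (v f : ι → ℝ) (hv : ∑ i, v i = 0) (c : ℝ)
    (hf : ∀ i j, f i - f j ≤ c) : |∑ i, v i * f i| ≤ c * ((1 / 2) * ∑ i, |v i|) := by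
  cases isEmpty_or_nonempty ι
  · simp
  obtain ⟨i₀, hi₀⟩ := Finite.exists_min f
  have h1 : ∑ i, v i * f i = ∑ i, v i * (f i - f i₀ - c / 2) := by
    simp_rw [mul_sub, Finset.sum_sub_distrib, ← Finset.sum_mul, hv]
    ring
  rw [h1, ← mul_assoc, Finset.mul_sum]
  refine (Finset.abs_sum_le_sum_abs _ _).trans (Finset.sum_le_sum fun i _ => ?_)
  rw [abs_mul, mul_comm]
  refine mul_le_mul_of_nonneg_right ?_ (abs_nonneg _)
  rw [abs_le]
  constructor <;> linarith [hi₀ i, hf i i₀]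

end FiniteInequalities

section Oscillation

variable {A : Finset ℝ} {d : ℕ}

/-- `o r` bounds the change of `F` when the symbol at time `r` is changed. -/
def HasOsc (F : (ℤ → A) → ℝ) (o : ℤ → ℝ) : Prop :=
  ∀ z r a, |F (Function.update z r a) - F z| ≤ o r

lemma HasOsc.nonneg [Nonempty A] {F : (ℤ → A) → ℝ} {o : ℤ → ℝ} (h : HasOsc F o) (r : ℤ) : 0 ≤ o r :=
  (abs_nonneg _).trans (h (fun _ => Classical.arbitrary A) r (Classical.arbitrary A))

lemma HasOsc.update_sub_update_le {F : (ℤ → A) → ℝ} {o : ℤ → ℝ} (h : HasOsc F o) (z : ℤ → A)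
    (t : ℤ) (a b : A) : F (Function.update z t a) - F (Function.update z t b) ≤ o t := by
  have := h (Function.update z t b) t a
  rw [Function.update_idem] at this
  exact (le_abs_self _).trans this

lemma HasOsc.abs_sub_le_sum {F : (ℤ → A) → ℝ} {o : ℤ → ℝ} (h : HasOsc F o) {W : Finset ℤ}
    (hF : DependsOn F (W : Set ℤ)) (y z : ℤ → A) : |F y - F z| ≤ ∑ r ∈ W, o r := by
  classical
  have key : ∀ V : Finset ℤ, |F (fun i => if i ∈ V then y i else z i) - F z| ≤ ∑ r ∈ V, o r := by
    intro V
    induction V using Finset.induction_on with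
    | empty => simp
    | insert r V hr ih =>
      rw [Finset.sum_insert hr]
      have e : (fun i => if i ∈ insert r V then y i else z i) =
          Function.update (fun i => if i ∈ V then y i else z i) r (y r) := by
        funext i
        rcases eq_or_ne i r with rfl | hi
        · simp
        · simp [Finset.mem_insert, hi]
      rw [e]
      exact (abs_sub_le _ (F fun i => if i ∈ V then y i else z i) _).trans
        (add_le_add (h _ _ _) ih)
  have e : F y = F (fun i => if i ∈ W then y i else z i) := by
    apply hF
    intro i hi
    simp [Finset.mem_coe.1 hi]
  rw [e]
  exact key W

/-- The oscillation of the lag `j`, extended by zero to all integers. -/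
def MTD.lagOsc (M : MTD A d) (j : ℤ) : ℝ := if j ∈ lags d then M.osc j else 0

lemma dTV_nonneg (p q : A → ℝ) : 0 ≤ dTV p q :=
  mul_nonneg (by norm_num) (Finset.sum_nonneg fun _ _ => abs_nonneg _)

lemma MTD.osc_nonneg (M : MTD A d) {j : ℤ} (hj : j ∈ lags d) : 0 ≤ M.osc j :=
  mul_nonneg (M.lam_nonneg j hj) (Real.iSup_nonneg fun _ => dTV_nonneg _ _)

lemma MTD.lam_mul_dTV_le (M : MTD A d) {j : ℤ} (hj : j ∈ lags d) (b c : A) :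
    M.lam j * dTV (M.p j b) (M.p j c) ≤ M.osc j :=
  mul_le_mul_of_nonneg_left
    (le_ciSup (f := fun bc : A × A => dTV (M.p j bc.1) (M.p j bc.2))
      (Set.finite_range _).bddAbove (b, c)) (M.lam_nonneg j hj)

lemma MTD.lagOsc_nonneg (M : MTD A d) (j : ℤ) : 0 ≤ M.lagOsc j := by
  unfold MTD.lagOsc
  split_ifs with h
  · exact M.osc_nonneg h
  · exact le_rfl

lemma MTD.sum_lagOsc (M : MTD A d) : ∑ j ∈ lags d, M.lagOsc j = 1 - M.Delta := by
  unfold MTD.Delta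
  rw [sub_sub_cancel, MTD.relevant, Finset.sum_filter]
  refine Finset.sum_congr rfl fun j hj => ?_
  rw [MTD.lagOsc, if_pos hj]
  split_ifs with h
  · rfl
  · exact le_antisymm (not_lt.1 h) (M.osc_nonneg hj)

lemma MTD.sum_lagOsc_comp_le (M : MTD A d) {ι : Type*} (I : Finset ι) (g : ι → ℤ)
    (hg : Set.InjOn g I) : ∑ i ∈ I, M.lagOsc (g i) ≤ 1 - M.Delta := by
  classical
  rw [← M.sum_lagOsc, ← Finset.sum_image (f := M.lagOsc) hg]
  calc ∑ j ∈ I.image g, M.lagOsc j ≤ ∑ j ∈ I.image g ∪ lags d, M.lagOsc j :=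
        Finset.sum_le_sum_of_subset_of_nonneg Finset.subset_union_left
          fun j _ _ => M.lagOsc_nonneg j
    _ = ∑ j ∈ lags d, M.lagOsc j := by
        symm
        refine Finset.sum_subset Finset.subset_union_right fun j _ hj => ?_
        rw [MTD.lagOsc, if_neg hj]

lemma MTD.trans_update_sub (M : MTD A d) (x : ℤ → A) {j : ℤ} (hj : j ∈ lags d) (b a : A) :
    M.trans (Function.update x j b) a - M.trans x a = M.lam j * (M.p j b a - M.p j (x j) a) := by
  unfold MTD.trans
  rw [add_sub_add_left_eq_sub, ← Finset.sum_sub_distrib, Finset.sum_eq_single_of_mem j hj]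
  · rw [Function.update_self]; ring
  · intro i _ hij
    rw [Function.update_of_ne hij, sub_self]

lemma MTD.dTV_trans_update_le (M : MTD A d) (x : ℤ → A) (j : ℤ) (b : A) :
    dTV (M.trans (Function.update x j b)) (M.trans x) ≤ M.lagOsc j := by
  by_cases hj : j ∈ lags d
  · rw [MTD.lagOsc, if_pos hj]
    refine le_trans (le_of_eq ?_) (M.lam_mul_dTV_le hj b (x j))
    unfold dTV
    simp_rw [M.trans_update_sub x hj, abs_mul, abs_of_nonneg (M.lam_nonneg j hj),
      ← Finset.mul_sum]
    ring
  · rw [M.trans_congr (y := x), MTD.lagOsc, if_neg hj]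
    · simp [dTV]
    · intro i hi
      rw [Function.update_of_ne (by rintro rfl; exact hj hi)]

lemma HasOsc.step {F : (ℤ → A) → ℝ} {o : ℤ → ℝ} (M : MTD A d) (h : HasOsc F o) (t : ℤ) :
    HasOsc (M.step t F) fun r => if r = t then 0 else o r + M.lagOsc (r - t) * o t := by
  intro z r b
  rcases eq_or_ne r t with rfl | hrt
  · simp only [if_true]
    apply le_of_eq
    rw [abs_eq_zero, sub_eq_zero]
    unfold MTD.step
    refine Finset.sum_congr rfl fun a _ => ?_
    rw [Function.update_idem, M.trans_congr]
    intro j hj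
    simp only [lags, Finset.mem_Icc] at hj
    rw [Function.update_of_ne (by omega)]
  · simp only [if_neg hrt]
    have hx : (fun j => Function.update z r b (t + j)) =
        Function.update (fun j => z (t + j)) (r - t) b := by
      funext j
      rcases eq_or_ne j (r - t) with rfl | hj
      · simp
      · rw [Function.update_of_ne hj, Function.update_of_ne (by omega)]
    have e : M.step t F (Function.update z r b) - M.step t F z =
        ∑ a, M.trans (fun j => Function.update z r b (t + j)) a *
          (F (Function.update (Function.update z r b) t a) - F (Function.update z t a)) +
        ∑ a, (M.trans (fun j => Function.update z r b (t + j)) a - M.trans (fun j => z (t + j)) a) *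
          F (Function.update z t a) := by
      unfold MTD.step
      rw [← Finset.sum_add_distrib, ← Finset.sum_sub_distrib]
      exact Finset.sum_congr rfl fun a _ => by ring
    rw [e]
    refine (abs_add_le _ _).trans (add_le_add ?_ ?_)
    · refine (Finset.abs_sum_le_sum_abs _ _).trans ?_
      calc _ ≤ ∑ a, M.trans (fun j => Function.update z r b (t + j)) a * o r := by
            refine Finset.sum_le_sum fun a _ => ?_
            rw [abs_mul, abs_of_nonneg (M.trans_nonneg _ _)]
            refine mul_le_mul_of_nonneg_left ?_ (M.trans_nonneg _ _)
            rw [Function.update_comm hrt]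
            exact h _ _ _
        _ = o r := by rw [← Finset.sum_mul, M.trans_sum, one_mul]
    · refine (abs_sum_mul_le_of_sum_eq_zero _ _ ?_ (o t)
        fun a a' => h.update_sub_update_le z t a a').trans ?_
      · rw [Finset.sum_sub_distrib, M.trans_sum, M.trans_sum, sub_self]
      · rw [mul_comm]
        refine mul_le_mul_of_nonneg_right ?_ ?_
        · rw [hx]; exact M.dTV_trans_update_le _ _ _
        · exact (abs_nonneg _).trans (h z t b)

/-- Iteration of the transition operators at times `e, e - 1, …`. -/
def MTD.stepIter (M : MTD A d) (e : ℤ) (F : (ℤ → A) → ℝ) : ℕ → (ℤ → A) → ℝ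
  | 0 => F
  | i + 1 => M.step (e - i) (M.stepIter e F i)

/-- The oscillation bounds of the iterates `MTD.stepIter`. -/
def MTD.oscIter (M : MTD A d) (e : ℤ) (o : ℤ → ℝ) : ℕ → ℤ → ℝ
  | 0 => o
  | i + 1 => fun r => if r = e - i then 0
      else M.oscIter e o i r + M.lagOsc (r - (e - i)) * M.oscIter e o i (e - i)

variable (M : MTD A d) {e : ℤ} {o : ℤ → ℝ}

lemma HasOsc.stepIter {F : (ℤ → A) → ℝ} (h : HasOsc F o) (i : ℕ) :
    HasOsc (M.stepIter e F i) (M.oscIter e o i) := by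
  induction i with
  | zero => exact h
  | succ i ih => exact ih.step M (e - i)

lemma MTD.oscIter_nonneg (ho : ∀ r, 0 ≤ o r) (i : ℕ) (r : ℤ) : 0 ≤ M.oscIter e o i r := by
  induction i generalizing r with
  | zero => exact ho r
  | succ i ih =>
    simp only [MTD.oscIter]
    split_ifs
    · exact le_rfl
    · exact add_nonneg (ih _) (mul_nonneg (M.lagOsc_nonneg _) (ih _))

lemma MTD.oscIter_le (ho : ∀ r, 0 ≤ o r) (i : ℕ) (r : ℤ) :
    M.oscIter e o i r ≤
      o r + ∑ k ∈ Finset.range i, M.lagOsc (r - (e - k)) * M.oscIter e o k (e - k) := by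
  induction i generalizing r with
  | zero => simp [MTD.oscIter]
  | succ i ih =>
    rw [Finset.sum_range_succ, ← add_assoc]
    simp only [MTD.oscIter]
    have h1 := mul_nonneg (M.lagOsc_nonneg (r - (e - i)))
      (M.oscIter_nonneg (e := e) ho i (e - i))
    have h2 := M.oscIter_nonneg (e := e) ho i r
    split_ifs
    · linarith [ih r]
    · linarith [ih r]

lemma MTD.oscIter_diag_le (hΔ : 0 < M.Delta) (ho : ∀ r, 0 ≤ o r) {D : ℝ} (hoD : ∀ r, o r ≤ D) (i : ℕ) :
    M.oscIter e o i (e - i) ≤ D / M.Delta := by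
  have hD : 0 ≤ D := (ho 0).trans (hoD 0)
  induction i using Nat.strong_induction_on with
  | _ i ih =>
    refine (M.oscIter_le ho i _).trans ?_
    have h1 : ∑ k ∈ Finset.range i, M.lagOsc (e - i - (e - k)) * M.oscIter e o k (e - k) ≤
        ∑ k ∈ Finset.range i, M.lagOsc (e - i - (e - k)) * (D / M.Delta) :=
      Finset.sum_le_sum fun k hk =>
        mul_le_mul_of_nonneg_left (ih k (Finset.mem_range.1 hk)) (M.lagOsc_nonneg _)
    have h2 : ∑ k ∈ Finset.range i, M.lagOsc (e - i - (e - k)) ≤ 1 - M.Delta :=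
      M.sum_lagOsc_comp_le _ _ (fun a _ b _ hab => by simpa using hab)
    rw [← Finset.sum_mul] at h1
    have h3 := mul_le_mul_of_nonneg_right h2 (div_nonneg hD hΔ.le)
    have h4 : D + (1 - M.Delta) * (D / M.Delta) = D / M.Delta := by field_simp; ring
    linarith [hoD (e - i)]

lemma MTD.sum_oscIter_diag_le (hΔ : 0 < M.Delta) (ho : ∀ r, 0 ≤ o r) (T : ℕ) :
    ∑ i ∈ Finset.range T, M.oscIter e o i (e - i) ≤
      (∑ i ∈ Finset.range T, o (e - i)) / M.Delta := by
  rw [le_div_iff₀ hΔ]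
  have h1 : ∑ i ∈ Finset.range T, M.oscIter e o i (e - i) ≤ ∑ i ∈ Finset.range T, o (e - i) +
      ∑ i ∈ Finset.range T, ∑ k ∈ Finset.range i,
        M.lagOsc (e - i - (e - k)) * M.oscIter e o k (e - k) := by
    rw [← Finset.sum_add_distrib]
    exact Finset.sum_le_sum fun i _ => M.oscIter_le ho i _
  have h2 : ∑ i ∈ Finset.range T, ∑ k ∈ Finset.range i,
        M.lagOsc (e - i - (e - k)) * M.oscIter e o k (e - k) ≤
      ∑ k ∈ Finset.range T, (1 - M.Delta) * M.oscIter e o k (e - k) := by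
    calc _ ≤ ∑ i ∈ Finset.range T, ∑ k ∈ Finset.range T,
        M.lagOsc (e - i - (e - k)) * M.oscIter e o k (e - k) := by
          refine Finset.sum_le_sum fun i hi => Finset.sum_le_sum_of_subset_of_nonneg ?_ ?_
          · exact Finset.range_subset_range.2 (Finset.mem_range.1 hi).le
          · exact fun k _ _ => mul_nonneg (M.lagOsc_nonneg _) (M.oscIter_nonneg ho _ _)
      _ ≤ _ := by
          rw [Finset.sum_comm]
          refine Finset.sum_le_sum fun k _ => ?_
          rw [← Finset.sum_mul]
          refine mul_le_mul_of_nonneg_right ?_ (M.oscIter_nonneg ho _ _)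
          exact M.sum_lagOsc_comp_le _ _ (fun a _ b _ hab => by simpa using hab)
  rw [← Finset.mul_sum] at h2
  nlinarith

lemma MTD.sum_oscIter_le {s₀ lo : ℤ} (hΔ : 0 < M.Delta) (ho : ∀ r, 0 ≤ o r) (ho0 : ∀ r < s₀, o r = 0) (T : ℕ)
    (hT : e - (T + d : ℕ) < s₀) :
    ∑ r ∈ Finset.Icc lo (e - (T + d : ℕ)), M.oscIter e o (T + d) r ≤
      ∑ k ∈ Finset.range d, M.oscIter e o (T + k) (e - (T + k : ℕ)) := by
  set W := Finset.Icc lo (e - (T + d : ℕ))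
  have hc := fun k : ℕ => M.oscIter_nonneg (e := e) ho k (e - k)
  calc ∑ r ∈ W, M.oscIter e o (T + d) r
      ≤ ∑ r ∈ W, ∑ k ∈ Finset.range (T + d), M.lagOsc (r - (e - k)) * M.oscIter e o k (e - k) := by
        refine Finset.sum_le_sum fun r hr => (M.oscIter_le ho _ r).trans ?_
        rw [ho0 r (by have := (Finset.mem_Icc.1 hr).2; omega), zero_add]
    _ = ∑ k ∈ Finset.range (T + d),
          (∑ r ∈ W, M.lagOsc (r - (e - k))) * M.oscIter e o k (e - k) := by
        rw [Finset.sum_comm]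
        exact Finset.sum_congr rfl fun k _ => by rw [Finset.sum_mul]
    _ = ∑ k ∈ Finset.range d,
          (∑ r ∈ W, M.lagOsc (r - (e - (T + k : ℕ)))) *
            M.oscIter e o (T + k) (e - (T + k : ℕ)) := by
        rw [Finset.sum_range_add, Finset.sum_eq_zero, zero_add]
        intro k hk
        rw [Finset.sum_eq_zero, zero_mul]
        intro r hr
        have h1 := (Finset.mem_Icc.1 hr).2
        have h2 := Finset.mem_range.1 hk
        rw [MTD.lagOsc, if_neg]
        simp only [lags, Finset.mem_Icc]
        omega
    _ ≤ _ := by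
        refine Finset.sum_le_sum fun k _ => ?_
        have h1 : ∑ r ∈ W, M.lagOsc (r - (e - (T + k : ℕ))) ≤ 1 - M.Delta :=
          M.sum_lagOsc_comp_le _ _ (fun a _ b _ hab => by simpa using hab)
        calc _ ≤ 1 * M.oscIter e o (T + k) (e - (T + k : ℕ)) :=
              mul_le_mul_of_nonneg_right (by linarith) (hc _)
          _ = _ := one_mul _

end Oscillation

section Concentration

variable {Ω : Type*} [MeasurableSpace Ω] {A : Finset ℝ} {d : ℕ}
variable {P : Measure Ω} {X : ℤ → Ω → A} {M : MTD A d}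

lemma MTD.step_exp_le (M : MTD A d) (t : ℤ) {F : (ℤ → A) → ℝ} {o : ℤ → ℝ} (h : HasOsc F o)
    {l : ℝ} (hl : 0 ≤ l) (z : ℤ → A) :
    M.step t (fun z => Real.exp (l * F z)) z ≤
      Real.exp ((l * o t) ^ 2 / 8) * Real.exp (l * M.step t F z) := by
  rw [← Real.exp_add, add_comm]
  unfold MTD.step
  refine (sum_mul_exp_le_exp _ (fun a => M.trans_nonneg _ a) (M.trans_sum _)
    (fun a => l * F (Function.update z t a)) (l * o t) fun a b => ?_).trans_eq ?_
  · rw [← mul_sub]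
    exact mul_le_mul_of_nonneg_left (h.update_sub_update_le z t a b) hl
  · congr 2
    rw [Finset.mul_sum]
    exact Finset.sum_congr rfl fun a _ => by ring

lemma MTD.dependsOn_stepIter (M : MTD A d) {lo e : ℤ} {F : (ℤ → A) → ℝ}
    (hF : DependsOn F (Finset.Icc lo e : Set ℤ)) (i : ℕ) (hi : lo + d + i ≤ e + 1) :
    DependsOn (M.stepIter e F i) (Finset.Icc lo (e - i) : Set ℤ) := by
  induction i with
  | zero => simpa [MTD.stepIter] using hF
  | succ i ih =>
    have h1 := M.dependsOn_step (t := e - i) (by push_cast at hi; omega) (ih (by push_cast at hi; omega))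
    have e1 : e - i - 1 = e - (i + 1 : ℕ) := by push_cast; ring
    rw [e1] at h1
    exact h1

lemma IsMTDChain.integral_stepIter [IsProbabilityMeasure P] (h : IsMTDChain P X M) [Nonempty A]
    {lo e : ℤ} {F : (ℤ → A) → ℝ} (hF : DependsOn F (Finset.Icc lo e : Set ℤ)) (i : ℕ)
    (hi : lo + d + i ≤ e + 1) :
    ∫ ω, M.stepIter e F i (fun i => X i ω) ∂P = ∫ ω, F (fun i => X i ω) ∂P := by
  induction i with
  | zero => rfl
  | succ i ih =>
    push_cast at hi
    rw [← ih (by omega)]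
    exact (h.integral_step (by omega) (M.dependsOn_stepIter hF i (by omega))).symm

lemma DependsOn.exp_mul {W : Set ℤ} {F : (ℤ → A) → ℝ} (hF : DependsOn F W) (l : ℝ) :
    DependsOn (fun z => Real.exp (l * F z)) W := fun _ _ h => by
  simp only [hF h]

lemma IsMTDChain.integral_exp_stepIter_le [IsProbabilityMeasure P] (h : IsMTDChain P X M)
    [Nonempty A] {lo e : ℤ} {F : (ℤ → A) → ℝ} (hF : DependsOn F (Finset.Icc lo e : Set ℤ))
    {o : ℤ → ℝ} (ho : HasOsc F o) {l : ℝ} (hl : 0 ≤ l) (i : ℕ) (hi : lo + d + i ≤ e + 1) :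
    ∫ ω, Real.exp (l * F (fun i => X i ω)) ∂P ≤
      Real.exp (l ^ 2 / 8 * ∑ k ∈ Finset.range i, M.oscIter e o k (e - k) ^ 2) *
        ∫ ω, Real.exp (l * M.stepIter e F i (fun i => X i ω)) ∂P := by
  induction i with
  | zero => simp [MTD.stepIter]
  | succ i ih =>
    push_cast at hi
    refine (ih (by omega)).trans ?_
    rw [Finset.sum_range_succ, mul_add, Real.exp_add, mul_assoc]
    refine mul_le_mul_of_nonneg_left ?_ (Real.exp_pos _).le
    have hdep := M.dependsOn_stepIter hF i (by omega)
    have hdep' := M.dependsOn_step (t := e - i) (by omega) hdep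
    rw [← integral_const_mul, h.integral_step (t := e - i) (by omega) (hdep.exp_mul l)]
    refine integral_mono ?_ ?_ fun ω => ?_
    · exact integrable_path h.measurable (W := Finset.Icc lo (e - i - 1))
        (M.dependsOn_step (t := e - i) (by omega) (hdep.exp_mul l))
    · exact (integrable_path h.measurable (W := Finset.Icc lo (e - i - 1))
        (hdep'.exp_mul l)).const_mul _
    · refine (M.step_exp_le (e - i) (ho.stepIter M i) hl _).trans_eq ?_
      simp only [MTD.stepIter]
      congr 2
      ring

/-- Sub-Gaussian bound for functions of finitely many symbols of the chain. -/
theorem IsMTDChain.integral_exp_le [IsProbabilityMeasure P] (h : IsMTDChain P X M)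
    (hΔ : 0 < M.Delta) {s e : ℤ} {N : ℕ} (he : e = s + N - 1) {F : (ℤ → A) → ℝ}
    (hF : DependsOn F (Finset.Icc s e : Set ℤ)) {D : ℝ}
    (hD : HasOsc F fun _ => D) {l : ℝ} (hl : 0 ≤ l) :
    ∫ ω, Real.exp (l * F (fun i => X i ω)) ∂P ≤
      Real.exp (l * (∫ ω, F (fun i => X i ω) ∂P) + l ^ 2 * N * D ^ 2 / (8 * M.Delta ^ 2)) := by
  classical
  have : Nonempty A := by
    obtain ⟨ω⟩ : Nonempty Ω := by
      by_contra hne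
      rw [not_nonempty_iff] at hne
      have := measure_univ (μ := P)
      simp [Set.eq_empty_of_isEmpty] at this
    exact ⟨X 0 ω⟩
  have hD0 : 0 ≤ D := hD.nonneg 0
  set o : ℤ → ℝ := fun r => if r ∈ Finset.Icc s e then D else 0 with hodef
  have ho : HasOsc F o := by
    intro z r a
    simp only [hodef]
    split_ifs with hr
    · exact hD z r a
    · rw [hF (y := z) fun i hi => Function.update_of_ne (by rintro rfl; exact hr hi) _ _]
      simp
  have ho0 : ∀ r, 0 ≤ o r := ho.nonneg
  have hoD : ∀ r, o r ≤ D := fun r => by simp only [hodef]; split_ifs <;> simp [hD0]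
  set c : ℕ → ℝ := fun k => M.oscIter e o k (e - k) with hcdef
  have hc0 : ∀ k, 0 ≤ c k := fun k => M.oscIter_nonneg ho0 k _
  have hcD : ∀ k, c k ≤ D / M.Delta := fun k => M.oscIter_diag_le hΔ ho0 hoD k
  have hcsum : ∀ T, ∑ k ∈ Finset.range T, c k ≤ N * D / M.Delta := by
    intro T
    refine (M.sum_oscIter_diag_le hΔ ho0 T).trans ?_
    gcongr
    have e1 : ∑ i ∈ Finset.range T, o (e - i) ≤ ∑ i ∈ Finset.range T, if i < N then D else 0 := by
      refine Finset.sum_le_sum fun i _ => ?_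
      simp only [hodef, Finset.mem_Icc]
      by_cases hi : i < N
      · rw [if_pos hi]; split_ifs <;> simp [hD0]
      · rw [if_neg (by omega), if_neg hi]
    refine e1.trans ?_
    rw [← Finset.sum_filter, Finset.sum_const, nsmul_eq_mul]
    refine mul_le_mul_of_nonneg_right ?_ hD0
    have : (Finset.range T).filter (· < N) ⊆ Finset.range N := by
      intro i; simp
    exact_mod_cast (Finset.card_le_card this).trans_eq (Finset.card_range N)
  have hcsq : ∀ T, ∑ k ∈ Finset.range T, c k ^ 2 ≤ N * D ^ 2 / M.Delta ^ 2 := by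
    intro T
    calc ∑ k ∈ Finset.range T, c k ^ 2 ≤ ∑ k ∈ Finset.range T, D / M.Delta * c k :=
          Finset.sum_le_sum fun k _ => by
            rw [sq]; exact mul_le_mul_of_nonneg_right (hcD k) (hc0 k)
      _ ≤ D / M.Delta * (N * D / M.Delta) := by
          rw [← Finset.mul_sum]
          exact mul_le_mul_of_nonneg_left (hcsum T) (div_nonneg hD0 hΔ.le)
      _ = _ := by ring
  have hsummable : Summable c := summable_of_sum_range_le hc0 hcsum
  set R : ℕ → ℝ := fun T => ∑ k ∈ Finset.range d, c (T + k) with hR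
  have hRlim : Filter.Tendsto R Filter.atTop (nhds 0) := by
    have : Filter.Tendsto R Filter.atTop (nhds (∑ k ∈ Finset.range d, (0 : ℝ))) :=
      tendsto_finsetSum _ fun k _ =>
        (Filter.tendsto_add_atTop_iff_nat k).2 hsummable.tendsto_atTop_zero
    simpa using this
  -- the bound for every starting time
  have hbound : ∀ T ≥ N + 1, ∫ ω, Real.exp (l * F (fun i => X i ω)) ∂P ≤
      Real.exp (l * (∫ ω, F (fun i => X i ω) ∂P) + l ^ 2 * N * D ^ 2 / (8 * M.Delta ^ 2)
        + l * R T) := by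
    intro T hT
    set lo : ℤ := e - (T + d : ℕ) - d - 1 with hlo
    have hlos : lo ≤ s := by omega
    have hFlo : DependsOn F (Finset.Icc lo e : Set ℤ) := hF.mono (by
      intro i hi
      simp only [Finset.coe_Icc, Set.mem_Icc] at hi ⊢
      omega)
    have hi : lo + d + (T + d : ℕ) ≤ e + 1 := by omega
    refine (h.integral_exp_stepIter_le hFlo ho hl (T + d) hi).trans ?_
    have hdep := M.dependsOn_stepIter hFlo (T + d) hi
    set G := M.stepIter e F (T + d) with hG
    have hGint : Integrable (fun ω => G fun i => X i ω) P :=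
      integrable_path h.measurable (W := Finset.Icc lo (e - (T + d : ℕ))) hdep
    have hosc : ∀ y z, |G y - G z| ≤ R T := by
      intro y z
      refine ((ho.stepIter M (T + d)).abs_sub_le_sum (W := Finset.Icc lo (e - (T + d : ℕ)))
        hdep y z).trans ?_
      refine M.sum_oscIter_le hΔ (s₀ := s) ho0 ?_ T (by omega)
      intro r hr
      simp only [hodef, Finset.mem_Icc]
      rw [if_neg (by omega)]
    have hGle : ∀ z, G z ≤ (∫ ω, F (fun i => X i ω) ∂P) + R T := by
      intro z
      rw [← h.integral_stepIter hFlo (T + d) hi]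
      have : ∫ ω, (G z - R T) ∂P ≤ ∫ ω, G (fun i => X i ω) ∂P := by
        refine integral_mono (integrable_const _) hGint fun ω => ?_
        have := (abs_le.1 (hosc z fun i => X i ω)).2
        linarith
      rw [integral_const, probReal_univ, one_smul] at this
      linarith
    have h2 : ∫ ω, Real.exp (l * G (fun i => X i ω)) ∂P ≤
        Real.exp (l * ((∫ ω, F (fun i => X i ω) ∂P) + R T)) := by
      calc _ ≤ ∫ _ω, Real.exp (l * ((∫ ω, F (fun i => X i ω) ∂P) + R T)) ∂P := by
            refine integral_mono ?_ (integrable_const _) fun ω => ?_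
            · exact integrable_path h.measurable (W := Finset.Icc lo (e - (T + d : ℕ)))
                (hdep.exp_mul l)
            · exact Real.exp_le_exp.2 (mul_le_mul_of_nonneg_left (hGle _) hl)
        _ = _ := by simp
    have h3 : l ^ 2 / 8 * ∑ k ∈ Finset.range (T + d), c k ^ 2 ≤
        l ^ 2 * N * D ^ 2 / (8 * M.Delta ^ 2) := by
      calc _ ≤ l ^ 2 / 8 * (N * D ^ 2 / M.Delta ^ 2) :=
            mul_le_mul_of_nonneg_left (hcsq _) (by positivity)
        _ = _ := by field_simp
    calc _ ≤ Real.exp (l ^ 2 * N * D ^ 2 / (8 * M.Delta ^ 2)) *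
          Real.exp (l * ((∫ ω, F (fun i => X i ω) ∂P) + R T)) :=
          mul_le_mul (Real.exp_le_exp.2 h3) h2
            (integral_nonneg fun ω => (Real.exp_pos _).le) (Real.exp_pos _).le
      _ = _ := by rw [← Real.exp_add]; congr 1; ring
  refine ge_of_tendsto' (f := fun T : ℕ => Real.exp (l * (∫ ω, F (fun i => X i ω) ∂P) +
    l ^ 2 * N * D ^ 2 / (8 * M.Delta ^ 2) + l * R (T + (N + 1)))) (x := Filter.atTop) ?_
    fun T => hbound _ (by omega)
  refine (Real.continuous_exp.tendsto _).comp ?_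
  have : Filter.Tendsto (fun T => R (T + (N + 1))) Filter.atTop (nhds 0) :=
    (Filter.tendsto_add_atTop_iff_nat (N + 1)).2 hRlim
  simpa using (this.const_mul l).const_add
    (l * (∫ ω, F (fun i => X i ω) ∂P) + l ^ 2 * N * D ^ 2 / (8 * M.Delta ^ 2))

/-- Bounded-differences inequality for functions of finitely many symbols of the chain. -/
theorem IsMTDChain.real_ge_le [IsProbabilityMeasure P] (h : IsMTDChain P X M)
    (hΔ : 0 < M.Delta) {s e : ℤ} {N : ℕ} (he : e = s + N - 1) (hN : 0 < N) {F : (ℤ → A) → ℝ}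
    (hF : DependsOn F (Finset.Icc s e : Set ℤ)) {D : ℝ} (hD0 : 0 < D)
    (hD : HasOsc F fun _ => D) {u : ℝ} (hu : 0 ≤ u) :
    P.real {ω | (∫ ω, F (fun i => X i ω) ∂P) + u ≤ F (fun i => X i ω)} ≤
      Real.exp (-(2 * u ^ 2 * M.Delta ^ 2 / (N * D ^ 2))) := by
  set l : ℝ := 4 * u * M.Delta ^ 2 / (N * D ^ 2) with hl
  have hNr : (0 : ℝ) < N := by exact_mod_cast hN
  have hl0 : 0 ≤ l := by positivity
  have hexpint : Integrable (fun ω => Real.exp (l * F fun i => X i ω)) P :=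
    integrable_path h.measurable (W := Finset.Icc s e) (hF.exp_mul l)
  have h1 := measure_ge_le_exp_mul_mgf (μ := P) (X := fun ω => F fun i => X i ω)
    ((∫ ω, F (fun i => X i ω) ∂P) + u) hl0 hexpint
  refine h1.trans ?_
  have h2 := h.integral_exp_le hΔ he hF hD hl0
  rw [mgf]
  refine (mul_le_mul_of_nonneg_left h2 (Real.exp_pos _).le).trans_eq ?_
  rw [← Real.exp_add]
  congr 1
  rw [hl]
  field_simp
  ring

end Concentration

section PatternCounts

variable {A : Finset ℝ}

open Classical in
/-- The number of times `t ∈ I` at which the path `z` shows the pattern `y` at the offsets `J`. -/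
def patternCount (J I : Finset ℤ) (y z : ℤ → A) : ℕ :=
  (I.filter fun t => ∀ j ∈ J, z (t + j) = y j).card

lemma patternCount_le (J I : Finset ℤ) (y z : ℤ → A) : patternCount J I y z ≤ I.card :=
  Finset.card_filter_le _ _

lemma dependsOn_patternCount {d : ℕ} {J : Finset ℤ} (hJ : J ⊆ Finset.Icc (-(d : ℤ)) 0) (s e : ℤ)
    (y : ℤ → A) :
    DependsOn (fun z => (patternCount J (Finset.Icc (s + d) e) y z : ℝ))
      (Finset.Icc s e : Set ℤ) := by
  classical
  intro z z' h
  simp only [patternCount]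
  congr 2
  refine Finset.filter_congr fun t ht => ?_
  refine forall₂_congr fun j hj => ?_
  have h1 := Finset.mem_Icc.1 (hJ hj)
  have h2 := Finset.mem_Icc.1 ht
  rw [h (t + j) (by simp only [Finset.coe_Icc, Set.mem_Icc]; omega)]

lemma patternCount_update_le (J I : Finset ℤ) (y z : ℤ → A) (r : ℤ) (a : A) :
    patternCount J I y z ≤ patternCount J I y (Function.update z r a) + J.card := by
  classical
  unfold patternCount
  have hsub : (I.filter fun t => ∀ j ∈ J, z (t + j) = y j) ⊆
      (I.filter fun t => ∀ j ∈ J, Function.update z r a (t + j) = y j) ∪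
        J.image fun j => r - j := by
    intro t ht
    simp only [Finset.mem_union, Finset.mem_filter, Finset.mem_image] at ht ⊢
    by_cases hr : ∃ j ∈ J, r - j = t
    · exact Or.inr hr
    · refine Or.inl ⟨ht.1, fun j hj => ?_⟩
      rw [Function.update_of_ne, ht.2 j hj]
      intro h
      exact hr ⟨j, hj, by omega⟩
  exact (Finset.card_le_card hsub).trans ((Finset.card_union_le _ _).trans
    (Nat.add_le_add_left Finset.card_image_le _))

lemma hasOsc_patternCount (J I : Finset ℤ) (y : ℤ → A) :
    HasOsc (fun z => (patternCount J I y z : ℝ)) fun _ => (J.card : ℝ) := by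
  intro z r a
  have h1 := patternCount_update_le J I y z r a
  have h2 := patternCount_update_le J I y (Function.update z r a) r (z r)
  rw [Function.update_idem, Function.update_eq_self] at h2
  have h1' : (patternCount J I y z : ℝ) ≤ patternCount J I y (Function.update z r a) + J.card := by
    exact_mod_cast h1
  have h2' : (patternCount J I y (Function.update z r a) : ℝ) ≤ patternCount J I y z + J.card := by
    exact_mod_cast h2
  rw [abs_le]
  constructor <;> linarith

lemma HasOsc.neg {F : (ℤ → A) → ℝ} {o : ℤ → ℝ} (h : HasOsc F o) : HasOsc (fun z => -F z) o := by
  intro z r a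
  rw [← neg_sub', abs_neg]
  exact h z r a

variable {Ω : Type*} [MeasurableSpace Ω] {d : ℕ}
variable {P : Measure Ω} {X : ℤ → Ω → A} {M : MTD A d}

/-- The probability of the pattern `y` at the offsets `J`. -/
def patternProb (P : Measure Ω) (X : ℤ → Ω → A) (J : Finset ℤ) (y : ℤ → A) : ℝ :=
  P.real {ω | ∀ j ∈ J, X j ω = y j}

lemma IsMTDChain.integral_patternCount [IsProbabilityMeasure P] (h : IsMTDChain P X M)
    {J : Finset ℤ} (hJ : J ⊆ Finset.Icc (-(d : ℤ)) 0) (I : Finset ℤ) (y : ℤ → A) :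
    ∫ ω, (patternCount J I y (fun i => X i ω) : ℝ) ∂P = I.card * patternProb P X J y := by
  classical
  have : Nonempty A := ⟨y 0⟩
  set G : (ℤ → A) → ℝ := fun z => if ∀ j ∈ J, z j = y j then 1 else 0 with hG
  have hGdep : DependsOn G (Finset.Icc (-(d : ℤ)) 0 : Set ℤ) := by
    intro z z' hz
    simp only [hG]
    refine if_congr (forall₂_congr fun j hj => ?_) rfl rfl
    rw [hz j (Finset.mem_coe.2 (hJ hj))]
  have hGint : ∫ ω, G (fun i => X i ω) ∂P = patternProb P X J y := by
    have : (fun ω => G fun i => X i ω) = {ω | ∀ j ∈ J, X j ω = y j}.indicator 1 := by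
      ext ω; simp [hG, Set.indicator_apply]
    rw [this, integral_indicator_one (measurableSet_window h.measurable _ _), patternProb]
  have hsum : ∀ ω, (patternCount J I y (fun i => X i ω) : ℝ) =
      ∑ t ∈ I, G fun i => X (i + t) ω := by
    intro ω
    simp only [patternCount, hG, Finset.sum_boole]
    simp only [add_comm]
  simp_rw [hsum]
  rw [integral_finsetSum]
  · rw [Finset.sum_congr rfl fun t _ => (h.integral_shift hGdep t).trans hGint, Finset.sum_const,
      nsmul_eq_mul]
  · intro t _
    exact integrable_path (X := fun i => X (i + t)) (fun i => h.measurable _) (W := Finset.Icc (-(d : ℤ)) 0)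
      hGdep

variable [IsProbabilityMeasure P] {J : Finset ℤ} {m n : ℕ}

lemma card_Icc_times (hmn : m + d ≤ n) :
    ((Finset.Icc ((m : ℤ) + d + 1) n).card : ℝ) = (n : ℝ) - m - d := by
  rw [Int.card_Icc]
  have : ((n : ℤ) + 1 - (m + d + 1)).toNat = n - m - d := by omega
  rw [this, Nat.cast_sub (by omega), Nat.cast_sub (by omega)]

lemma IsMTDChain.real_patternCount_ge_le (h : IsMTDChain P X M) (hΔ : 0 < M.Delta)
    (hJ : J ⊆ Finset.Icc (-(d : ℤ)) 0) (hJn : J.Nonempty) (hmn : m + d ≤ n) (hmn' : m < n)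
    (y : ℤ → A) {u : ℝ} (hu : 0 ≤ u) :
    P.real {ω | ((n : ℝ) - m - d) * patternProb P X J y + u ≤
        patternCount J (Finset.Icc ((m : ℤ) + d + 1) n) y (fun i => X i ω)} ≤
      Real.exp (-(2 * u ^ 2 * M.Delta ^ 2 / (((n : ℝ) - m) * J.card ^ 2))) := by
  have hdep := dependsOn_patternCount hJ ((m : ℤ) + 1) n y
  rw [show (m : ℤ) + 1 + d = m + d + 1 by ring] at hdep
  have := h.real_ge_le hΔ (s := (m : ℤ) + 1) (e := n) (N := n - m) (by omega) (by omega) hdep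
    (by exact_mod_cast hJn.card_pos) (hasOsc_patternCount _ _ _) hu
  rw [h.integral_patternCount hJ, card_Icc_times hmn, Nat.cast_sub hmn'.le] at this
  exact this

lemma IsMTDChain.real_patternCount_le_le (h : IsMTDChain P X M) (hΔ : 0 < M.Delta)
    (hJ : J ⊆ Finset.Icc (-(d : ℤ)) 0) (hJn : J.Nonempty) (hmn : m + d ≤ n) (hmn' : m < n)
    (y : ℤ → A) {u : ℝ} (hu : 0 ≤ u) :
    P.real {ω | (patternCount J (Finset.Icc ((m : ℤ) + d + 1) n) y (fun i => X i ω) : ℝ) ≤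
        ((n : ℝ) - m - d) * patternProb P X J y - u} ≤
      Real.exp (-(2 * u ^ 2 * M.Delta ^ 2 / (((n : ℝ) - m) * J.card ^ 2))) := by
  have hdep := dependsOn_patternCount hJ ((m : ℤ) + 1) n y
  rw [show (m : ℤ) + 1 + d = m + d + 1 by ring] at hdep
  have hdep' : DependsOn (fun z => -(patternCount J (Finset.Icc ((m : ℤ) + d + 1) n) y z : ℝ))
      (Finset.Icc ((m : ℤ) + 1) n : Set ℤ) := fun z z' hz => by
    have := hdep hz
    simp only at this ⊢
    rw [this]
  have := h.real_ge_le hΔ (s := (m : ℤ) + 1) (e := n) (N := n - m) (by omega) (by omega) hdep'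
    (by exact_mod_cast hJn.card_pos) (hasOsc_patternCount _ _ _).neg hu
  rw [integral_neg, h.integral_patternCount hJ, card_Icc_times hmn, Nat.cast_sub hmn'.le] at this
  refine le_trans (le_of_eq ?_) this
  congr 1
  ext ω
  simp only [Set.mem_ofPred_eq]
  constructor <;> intro h <;> linarith

lemma IsMTDChain.real_abs_patternCount_gt_le (h : IsMTDChain P X M) (hΔ : 0 < M.Delta)
    (hJ : J ⊆ Finset.Icc (-(d : ℤ)) 0) (hJn : J.Nonempty) (hmn : m + d ≤ n) (hmn' : m < n)
    (y : ℤ → A) {u : ℝ} (hu : 0 ≤ u) :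
    P.real {ω | u < |(patternCount J (Finset.Icc ((m : ℤ) + d + 1) n) y (fun i => X i ω) : ℝ) -
        ((n : ℝ) - m - d) * patternProb P X J y|} ≤
      2 * Real.exp (-(2 * u ^ 2 * M.Delta ^ 2 / (((n : ℝ) - m) * J.card ^ 2))) := by
  rw [two_mul]
  refine le_trans ?_ (add_le_add (h.real_patternCount_ge_le hΔ hJ hJn hmn hmn' y hu)
    (h.real_patternCount_le_le hΔ hJ hJn hmn hmn' y hu))
  refine le_trans (measureReal_mono ?_) (measureReal_union_le _ _)
  intro ω hω
  simp only [Set.mem_union, Set.mem_ofPred_eq] at hω ⊢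
  rcases lt_abs.1 hω with h1 | h1
  · left; linarith
  · right; linarith

end PatternCounts

section Strings

variable {A : Finset ℝ} {d m n : ℕ} {S : Finset ℤ}

lemma count_eq_patternCount (hS : (0 : ℤ) ∉ S) (z y : ℤ → A) (a : A) :
    count d m n z (fun j : S => y j) a =
      patternCount (insert 0 S) (Finset.Icc ((m : ℤ) + d + 1) n) (Function.update y 0 a) z := by
  classical
  unfold count patternCount
  congr 1
  refine Finset.filter_congr fun t _ => ?_
  rw [Finset.forall_mem_insert, Function.update_self, add_zero, and_comm]
  refine and_congr Iff.rfl ⟨fun h j hj => ?_, fun h j => ?_⟩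
  · rw [Function.update_of_ne (by rintro rfl; exact hS hj)]
    exact h ⟨j, hj⟩
  · have := h j j.2
    rwa [Function.update_of_ne (by intro h0; exact hS (h0 ▸ j.2))] at this

lemma countBar_eq_patternCount (z y : ℤ → A) :
    countBar d m n z (fun j : S => y j) =
      patternCount S (Finset.Icc ((m : ℤ) + d + 1) n) y z := by
  classical
  unfold countBar count patternCount
  simp_rw [← Finset.filter_filter]
  rw [← Finset.card_eq_sum_card_fiberwise (f := z) (t := Finset.univ) (fun _ _ => by simp)]
  congr 1
  refine Finset.filter_congr fun t _ => ?_
  simp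

lemma string_eq_restrict (a₀ : A) (x : S → A) : x = fun j : S => extendBy a₀ x j := by
  funext j
  rw [extendBy_of_mem _ _ j.2]

/-- A sum over the strings on `S ∪ {k}` is a double sum over strings on `S` and symbols at `k`. -/
lemma sum_insert_strings {k : ℤ} (hk : k ∉ S) (f : (((insert k S : Finset ℤ) : Type) → A) → ℝ) :
    ∑ w, f w = ∑ x : S → A, ∑ b, f (addSymbol x k b) := by
  classical
  rw [← Fintype.sum_prod_type']
  let e : (S → A) × A ≃ (((insert k S : Finset ℤ) : Type) → A) :=
    { toFun := fun xb => addSymbol xb.1 k xb.2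
      invFun := fun w => (fun j => w ⟨j, Finset.mem_insert_of_mem j.2⟩,
        w ⟨k, Finset.mem_insert_self k S⟩)
      left_inv := by
        rintro ⟨x, b⟩
        simp [addSymbol, hk]
      right_inv := by
        intro w
        funext j
        simp only [addSymbol]
        split_ifs with hj
        · rfl
        · have : (j : ℤ) = k := (Finset.mem_insert.1 j.2).resolve_right hj
          congr 1
          exact Subtype.ext this.symm }
  exact (Fintype.sum_equiv e _ _ fun _ => rfl).symm

lemma addSymbol_forall {k : ℤ} (hk : k ∉ S) (x : S → A) (b : A) (z : ℤ → A) :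
    (∀ j : ((insert k S : Finset ℤ) : Type), z j = addSymbol x k b j) ↔
      (∀ j : S, z j = x j) ∧ z k = b := by
  constructor
  · intro h
    refine ⟨fun j => ?_, ?_⟩
    · have := h ⟨j, Finset.mem_insert_of_mem j.2⟩
      simpa [addSymbol] using this
    · have := h ⟨k, Finset.mem_insert_self k S⟩
      simpa [addSymbol, hk] using this
  · rintro ⟨h1, h2⟩ ⟨j, hj⟩
    simp only [addSymbol]
    split_ifs with h
    · exact h1 ⟨j, h⟩
    · rw [(Finset.mem_insert.1 hj).resolve_right h]
      exact h2

lemma count_eq_sum_addSymbol {k : ℤ} (hk : k ∉ S) (z : ℤ → A) (x : S → A) (a : A) :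
    count d m n z x a = ∑ b, count d m n z (addSymbol x k b) a := by
  classical
  have e : ∀ b, count d m n z (addSymbol x k b) a =
      (((Finset.Icc ((m : ℤ) + d + 1) n).filter fun t => (∀ j : S, z (t + j) = x j) ∧
        z t = a).filter fun t => z (t + k) = b).card := by
    intro b
    unfold count
    rw [Finset.filter_filter]
    congr 1
    refine Finset.filter_congr fun t _ => ?_
    rw [addSymbol_forall hk x b (fun j => z (t + j))]
    tauto
  simp_rw [e]
  rw [← Finset.card_eq_sum_card_fiberwise (f := fun t => z (t + k)) (t := Finset.univ)
    (fun _ _ => by simp)]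
  unfold count
  congr 1

end Strings

section Influence

variable {ι β γ : Type*} [Fintype γ]

/-- Sum of a mass function over its last argument. -/
def margB (q : ι → β → γ → ℝ) (x : ι) (b : β) : ℝ := ∑ a, q x b a

variable {p q : ι → β → γ → ℝ}

lemma margB_nonneg (hq : ∀ x b a, 0 ≤ q x b a) (x : ι) (b : β) : 0 ≤ margB q x b :=
  Finset.sum_nonneg fun a _ => hq x b a

variable [Fintype β]

/-- Sum of a mass function over its middle argument. -/
def margC (q : ι → β → γ → ℝ) (x : ι) (a : γ) : ℝ := ∑ b, q x b a

/-- Sum of a mass function over its last two arguments. -/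
def margX (q : ι → β → γ → ℝ) (x : ι) : ℝ := ∑ b, margB q x b

lemma margX_nonneg (hq : ∀ x b a, 0 ≤ q x b a) (x : ι) : 0 ≤ margX q x :=
  Finset.sum_nonneg fun b _ => margB_nonneg hq x b

lemma margX_eq_sum_margC (q : ι → β → γ → ℝ) (x : ι) : margX q x = ∑ a, margC q x a :=
  Finset.sum_comm

lemma margX_mul_weight (hq : ∀ x b a, 0 ≤ q x b a) (x : ι) (b : β) :
    margX q x * (margB q x b / margX q x) = margB q x b := by
  rcases eq_or_ne (margX q x) 0 with h | h
  · have := (Finset.sum_eq_zero_iff_of_nonneg fun b _ => margB_nonneg hq x b).1 h b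
      (Finset.mem_univ b)
    rw [h, this]; simp
  · field_simp

lemma sum_weight_le (q : ι → β → γ → ℝ) (x : ι) :
    ∑ b, margB q x b / margX q x ≤ 1 := by
  rw [← Finset.sum_div]
  exact div_self_le_one (margX q x)

lemma weight_nonneg (hq : ∀ x b a, 0 ≤ q x b a) (x : ι) (b : β) :
    0 ≤ margB q x b / margX q x :=
  div_nonneg (margB_nonneg hq x b) (margX_nonneg hq x)

variable [Fintype ι]

/-- The average influence of the middle argument on the last one, given the first one. -/
def influence (q : ι → β → γ → ℝ) : ℝ :=
  (1 / 2) * ∑ x, ∑ b, ∑ c, ∑ a,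
    |q x b a * (margB q x c / margX q x) - q x c a * (margB q x b / margX q x)|

lemma abs_influence_sub_le (hp : ∀ x b a, 0 ≤ p x b a) (hq : ∀ x b a, 0 ≤ q x b a) :
    |influence q - influence p| ≤ 3 * ∑ x, ∑ b, ∑ a, |q x b a - p x b a| := by
  set v : (ι → β → γ → ℝ) → ι → β → ℝ := fun q x b => margB q x b / margX q x with hv
  set U : ι → β → β → γ → ℝ := fun x b c a => |q x b a * v q x c - p x b a * v p x c| with hU
  have hterm : ∀ x b c a, |(|q x b a * v q x c - q x c a * v q x b| -
      |p x b a * v p x c - p x c a * v p x b|)| ≤ U x b c a + U x c b a := by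
    intro x b c a
    refine (abs_abs_sub_abs_le_abs_sub _ _).trans ?_
    rw [hU]
    have : q x b a * v q x c - q x c a * v q x b - (p x b a * v p x c - p x c a * v p x b) =
      (q x b a * v q x c - p x b a * v p x c) - (q x c a * v q x b - p x c a * v p x b) := by ring
    rw [this]
    exact abs_sub _ _
  have hx : ∀ x, ∑ b, ∑ c, ∑ a, U x b c a ≤ 3 * ∑ b, ∑ a, |q x b a - p x b a| := by
    intro x
    set E := ∑ b, ∑ a, |q x b a - p x b a| with hE
    have hB : ∀ b, |margB q x b - margB p x b| ≤ ∑ a, |q x b a - p x b a| := by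
      intro b
      rw [margB, margB, ← Finset.sum_sub_distrib]
      exact Finset.abs_sum_le_sum_abs _ _
    have hX : |margX q x - margX p x| ≤ E := by
      rw [margX, margX, ← Finset.sum_sub_distrib]
      exact (Finset.abs_sum_le_sum_abs _ _).trans (Finset.sum_le_sum fun b _ => hB b)
    have h1 : ∀ b c a, U x b c a ≤
        |q x b a - p x b a| * v q x c + p x b a * |v q x c - v p x c| := by
      intro b c a
      have : q x b a * v q x c - p x b a * v p x c =
        (q x b a - p x b a) * v q x c + p x b a * (v q x c - v p x c) := by ring
      rw [hU]
      simp only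
      rw [this]
      refine (abs_add_le _ _).trans_eq ?_
      rw [abs_mul, abs_mul, abs_of_nonneg (weight_nonneg hq x c), abs_of_nonneg (hp x b a)]
    have h2 : ∀ c, margX p x * |v q x c - v p x c| ≤
        |margX q x - margX p x| * v q x c + |margB q x c - margB p x c| := by
      intro c
      rw [← abs_of_nonneg (margX_nonneg hp x), ← abs_mul, abs_of_nonneg (margX_nonneg hp x)]
      have : margX p x * (v q x c - v p x c) =
          -((margX q x - margX p x) * v q x c) + (margB q x c - margB p x c) := by
        rw [← margX_mul_weight hq x c, ← margX_mul_weight hp x c]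
        ring
      rw [this]
      refine (abs_add_le _ _).trans_eq ?_
      rw [abs_neg, abs_mul, abs_of_nonneg (weight_nonneg hq x c)]
    calc ∑ b, ∑ c, ∑ a, U x b c a
        ≤ ∑ b, ∑ c, ∑ a, (|q x b a - p x b a| * v q x c + p x b a * |v q x c - v p x c|) :=
          Finset.sum_le_sum fun b _ => Finset.sum_le_sum fun c _ =>
            Finset.sum_le_sum fun a _ => h1 b c a
      _ = E * ∑ c, v q x c + ∑ c, margX p x * |v q x c - v p x c| := by
          simp_rw [Finset.sum_add_distrib, ← Finset.sum_mul]
          congr 1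
          · rw [hE, Finset.sum_mul_sum]
          · rw [Finset.sum_comm]
            refine Finset.sum_congr rfl fun c _ => ?_
            rw [← Finset.sum_mul]
            rfl
      _ ≤ E * 1 + ∑ c, (|margX q x - margX p x| * v q x c + |margB q x c - margB p x c|) := by
          refine add_le_add (mul_le_mul_of_nonneg_left (sum_weight_le q x) ?_)
            (Finset.sum_le_sum fun c _ => h2 c)
          exact Finset.sum_nonneg fun _ _ => Finset.sum_nonneg fun _ _ => abs_nonneg _
      _ ≤ E * 1 + (E * 1 + E) := by
          rw [Finset.sum_add_distrib, ← Finset.mul_sum]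
          refine add_le_add le_rfl (add_le_add ?_ (Finset.sum_le_sum fun c _ => hB c))
          exact mul_le_mul hX (sum_weight_le q x)
            (Finset.sum_nonneg fun c _ => weight_nonneg hq x c) ((abs_nonneg _).trans hX)
      _ = 3 * E := by ring
  unfold influence
  rw [← mul_sub, abs_mul, abs_of_pos (by norm_num : (0 : ℝ) < 1 / 2)]
  simp_rw [← Finset.sum_sub_distrib]
  calc _ ≤ 1 / 2 * ∑ x, ∑ b, ∑ c, ∑ a, (U x b c a + U x c b a) := by
        refine mul_le_mul_of_nonneg_left ?_ (by norm_num)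
        refine (Finset.abs_sum_le_sum_abs _ _).trans (Finset.sum_le_sum fun x _ => ?_)
        refine (Finset.abs_sum_le_sum_abs _ _).trans (Finset.sum_le_sum fun b _ => ?_)
        refine (Finset.abs_sum_le_sum_abs _ _).trans (Finset.sum_le_sum fun c _ => ?_)
        refine (Finset.abs_sum_le_sum_abs _ _).trans (Finset.sum_le_sum fun a _ => ?_)
        exact hterm x b c a
    _ = ∑ x, ∑ b, ∑ c, ∑ a, U x b c a := by
        simp_rw [Finset.sum_add_distrib]
        have : ∑ x, ∑ b, ∑ c, ∑ a, U x c b a = ∑ x, ∑ b, ∑ c, ∑ a, U x b c a :=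
          Finset.sum_congr rfl fun x _ => Finset.sum_comm
        rw [this]; ring
    _ ≤ _ := by
        rw [Finset.mul_sum]
        exact Finset.sum_le_sum fun x _ => hx x

/-- The law under which the last two arguments are independent given the first one. -/
def condProduct (q : ι → β → γ → ℝ) (x : ι) (b : β) (a : γ) : ℝ :=
  margB q x b / margX q x * margC q x a

lemma influence_le (hq : ∀ x b a, 0 ≤ q x b a) :
    influence q ≤ ∑ x, ∑ b, ∑ a, |q x b a - condProduct q x b a| := by
  set v : ι → β → ℝ := fun x b => margB q x b / margX q x with hv
  set U : ι → β → γ → ℝ := fun x b a => |q x b a - condProduct q x b a| with hU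
  have h1 : ∀ x b c a, |q x b a * v x c - q x c a * v x b| ≤ U x b a * v x c + U x c a * v x b := by
    intro x b c a
    have : q x b a * v x c - q x c a * v x b = (q x b a - condProduct q x b a) * v x c -
        (q x c a - condProduct q x c a) * v x b := by
      simp only [condProduct, hv]; ring
    rw [this]
    refine (abs_sub _ _).trans_eq ?_
    rw [abs_mul, abs_mul, abs_of_nonneg (weight_nonneg hq x c), abs_of_nonneg (weight_nonneg hq x b)]
  unfold influence
  rw [Finset.mul_sum]
  refine Finset.sum_le_sum fun x _ => ?_
  have hU0 : 0 ≤ ∑ b, ∑ a, U x b a :=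
    Finset.sum_nonneg fun _ _ => Finset.sum_nonneg fun _ _ => abs_nonneg _
  have h2 : ∑ b, ∑ c, ∑ a, U x b a * v x c ≤ ∑ b, ∑ a, U x b a := by
    simp_rw [← Finset.sum_mul]
    rw [← Finset.sum_mul_sum]
    exact mul_le_of_le_one_right hU0 (sum_weight_le q x)
  calc _ ≤ 1 / 2 * ∑ b, ∑ c, ∑ a, (U x b a * v x c + U x c a * v x b) :=
        mul_le_mul_of_nonneg_left (Finset.sum_le_sum fun b _ => Finset.sum_le_sum fun c _ =>
          Finset.sum_le_sum fun a _ => h1 x b c a) (by norm_num)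
    _ = ∑ b, ∑ c, ∑ a, U x b a * v x c := by
        simp_rw [Finset.sum_add_distrib]
        rw [Finset.sum_comm (f := fun b c => ∑ a, U x c a * v x b)]
        ring
    _ ≤ _ := h2

/-- **Pinsker's inequality** for positive probability vectors. -/
lemma pinsker_finite (f g : ι → ℝ) (hf : ∀ i, 0 < f i) (hg : ∀ i, 0 < g i) (hf1 : ∑ i, f i = 1)
    (hg1 : ∑ i, g i = 1) :
    (∑ i, |f i - g i|) ^ 2 / 2 ≤ ∑ i, f i * Real.log (f i / g i) := by
  classical
  set t : ℝ := ∑ i, |f i - g i| with ht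
  have ht0 : 0 ≤ t := Finset.sum_nonneg fun _ _ => abs_nonneg _
  set φ : ι → ℝ := fun i => if g i < f i then 2 * t else 0 with hφ
  set L : ℝ := ∑ i, g i * φ i + (2 * t) ^ 2 / 8 with hL
  have hoeff : ∑ i, g i * Real.exp (φ i) ≤ Real.exp L := by
    refine sum_mul_exp_le_exp g (fun i => (hg i).le) hg1 φ (2 * t) fun i j => ?_
    simp only [hφ]
    split_ifs <;> linarith
  have hpos : ∑ i, (f i - g i) * φ i = t ^ 2 := by
    have h1 : ∀ i, (f i - g i) * φ i = t * (f i - g i) + t * |f i - g i| := by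
      intro i
      simp only [hφ]
      split_ifs with h
      · rw [abs_of_pos (by linarith)]; ring
      · rw [abs_of_nonpos (by linarith)]; ring
    simp_rw [h1]
    rw [Finset.sum_add_distrib, ← Finset.mul_sum, ← Finset.mul_sum, Finset.sum_sub_distrib, hf1,
      hg1, ← ht]
    ring
  have hlog : ∀ i, f i * (φ i - L - Real.log (f i / g i)) ≤ g i * Real.exp (φ i) * Real.exp (-L) -
      f i := by
    intro i
    have h1 := Real.log_le_sub_one_of_pos
      (div_pos (mul_pos (mul_pos (hg i) (Real.exp_pos (φ i))) (Real.exp_pos (-L))) (hf i))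
    rw [Real.log_div (mul_pos (mul_pos (hg i) (Real.exp_pos _)) (Real.exp_pos _)).ne' (hf i).ne',
      Real.log_mul (mul_pos (hg i) (Real.exp_pos _)).ne' (Real.exp_pos _).ne',
      Real.log_mul (hg i).ne' (Real.exp_pos _).ne', Real.log_exp, Real.log_exp] at h1
    rw [Real.log_div (hf i).ne' (hg i).ne']
    have h2 := mul_le_mul_of_nonneg_left h1 (hf i).le
    have h3 : f i * (g i * Real.exp (φ i) * Real.exp (-L) / f i - 1) =
        g i * Real.exp (φ i) * Real.exp (-L) - f i := by
      have := (hf i).ne'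
      field_simp
    rw [h3] at h2
    linarith
  have hsum := Finset.sum_le_sum fun i (_ : i ∈ Finset.univ) => hlog i
  have h4 : ∑ i, (g i * Real.exp (φ i) * Real.exp (-L) - f i) ≤ 0 := by
    rw [Finset.sum_sub_distrib, ← Finset.sum_mul, hf1]
    have := mul_le_mul_of_nonneg_right hoeff (Real.exp_pos (-L)).le
    rw [← Real.exp_add, add_neg_cancel, Real.exp_zero] at this
    linarith
  have h5 : ∑ i, f i * (φ i - L - Real.log (f i / g i)) =
      ∑ i, f i * φ i - L - ∑ i, f i * Real.log (f i / g i) := by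
    simp_rw [mul_sub, Finset.sum_sub_distrib, ← Finset.sum_mul, hf1, one_mul]
  have h6 : ∑ i, (f i - g i) * φ i = ∑ i, f i * φ i - ∑ i, g i * φ i := by
    simp_rw [sub_mul, Finset.sum_sub_distrib]
  rw [h5] at hsum
  nlinarith

/-- The conditional mutual information of the last two arguments given the first one bounds the
squared influence. -/
lemma influence_sq_le (hq : ∀ x b a, 0 < q x b a) (hq1 : ∑ x, margX q x = 1) [Nonempty β]
    [Nonempty γ] :
    influence q ^ 2 / 2 ≤
      ∑ x, ∑ b, ∑ a, q x b a *
        (Real.log (q x b a / margB q x b) - Real.log (margC q x a / margX q x)) := by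
  have hB : ∀ x b, 0 < margB q x b := fun x b =>
    Finset.sum_pos (fun a _ => hq x b a) Finset.univ_nonempty
  have hC : ∀ x a, 0 < margC q x a := fun x b =>
    Finset.sum_pos (fun a _ => hq x a b) Finset.univ_nonempty
  have hX : ∀ x, 0 < margX q x := fun x =>
    Finset.sum_pos (fun b _ => hB x b) Finset.univ_nonempty
  have h1 := pinsker_finite (fun i : ι × β × γ => q i.1 i.2.1 i.2.2)
    (fun i => condProduct q i.1 i.2.1 i.2.2) (fun i => hq _ _ _)
    (fun i => mul_pos (div_pos (hB _ _) (hX _)) (hC _ _))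
    (by
      rw [Fintype.sum_prod_type, ← hq1]
      refine Finset.sum_congr rfl fun x _ => ?_
      rw [Fintype.sum_prod_type]; rfl)
    (by
      rw [Fintype.sum_prod_type, ← hq1]
      refine Finset.sum_congr rfl fun x _ => ?_
      rw [Fintype.sum_prod_type]
      simp only [condProduct]
      simp_rw [← Finset.mul_sum]
      rw [← Finset.sum_mul, ← margX_eq_sum_margC, ← Finset.sum_div]
      exact div_mul_cancel₀ _ (hX x).ne')
  simp only [Fintype.sum_prod_type] at h1
  refine le_trans ?_ (h1.trans_eq ?_)
  · have h2 := influence_le fun x b a => (hq x b a).le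
    have h0 : 0 ≤ influence q := mul_nonneg (by norm_num) (Finset.sum_nonneg fun _ _ =>
      Finset.sum_nonneg fun _ _ => Finset.sum_nonneg fun _ _ => Finset.sum_nonneg fun _ _ =>
        abs_nonneg _)
    have := pow_le_pow_left₀ h0 h2 2
    linarith
  · refine Finset.sum_congr rfl fun x _ => Finset.sum_congr rfl fun b _ =>
      Finset.sum_congr rfl fun a _ => ?_
    congr 1
    have e1 := (hq x b a).ne'
    have e2 := (hB x b).ne'
    have e3 := (hC x a).ne'
    have e4 := (hX x).ne'
    rw [condProduct, Real.log_div e1 (mul_ne_zero (div_ne_zero e2 e4) e3),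
      Real.log_mul (div_ne_zero e2 e4) e3, Real.log_div e2 e4, Real.log_div e1 e2,
      Real.log_div e3 e4]
    ring

end Influence

section Entropy

variable {Ω : Type*} [MeasurableSpace Ω] {A : Finset ℝ} {P : Measure Ω} {X : ℤ → Ω → A}
variable {S : Finset ℤ} {k : ℤ}

/-- `P(X_S = x, X_0 = a)`. -/
def jointProb (P : Measure Ω) (X : ℤ → Ω → A) {S : Finset ℤ} (x : S → A) (a : A) : ℝ :=
  P.real {ω | (∀ j : S, X j ω = x j) ∧ X 0 ω = a}

/-- The entropy of `X_0` given `X_S`. -/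
def condEntropy (P : Measure Ω) (X : ℤ → Ω → A) (S : Finset ℤ) : ℝ :=
  -∑ x : S → A, ∑ a, jointProb P X x a * Real.log (jointProb P X x a / ∑ c, jointProb P X x c)

/-- The joint law of `X_S`, `X_k` and `X_0`. -/
def jointLaw (P : Measure Ω) (X : ℤ → Ω → A) (k : ℤ) (S : Finset ℤ) (x : S → A) (b a : A) : ℝ :=
  jointProb P X (addSymbol x k b) a

lemma jointProb_nonneg (x : S → A) (a : A) : 0 ≤ jointProb P X x a := measureReal_nonneg

lemma measurableSet_stringEvent (hX : ∀ t, Measurable (X t)) (x : S → A) :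
    MeasurableSet (stringEvent X x) := by
  have : stringEvent X x = ⋂ j : S, X j ⁻¹' {x j} := by ext ω; simp [stringEvent]
  rw [this]
  exact MeasurableSet.iInter fun j => hX j (measurableSet_singleton _)

lemma measurableSet_symbol (hX : ∀ t, Measurable (X t)) (t : ℤ) (a : A) :
    MeasurableSet {ω | X t ω = a} := hX t (measurableSet_singleton a)

lemma sum_real_inter_symbol [IsFiniteMeasure P] (hX : ∀ t, Measurable (X t)) (t : ℤ) {E : Set Ω}
    (hE : MeasurableSet E) : ∑ a, P.real (E ∩ {ω | X t ω = a}) = P.real E := by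
  rw [← measureReal_biUnion_finset]
  · congr 1; ext ω; simp
  · intro a _ b _ hab
    refine Set.disjoint_left.2 fun ω h1 h2 => hab ?_
    exact h1.2.symm.trans h2.2
  · exact fun a _ => hE.inter (measurableSet_symbol hX t a)

lemma sum_jointProb [IsFiniteMeasure P] (hX : ∀ t, Measurable (X t)) (x : S → A) :
    ∑ a, jointProb P X x a = P.real (stringEvent X x) :=
  sum_real_inter_symbol hX 0 (measurableSet_stringEvent hX x)

lemma jointLaw_eq (hk : k ∉ S) (x : S → A) (b a : A) :
    jointLaw P X k S x b a = P.real ((stringEvent X x ∩ {ω | X 0 ω = a}) ∩ {ω | X k ω = b}) := by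
  unfold jointLaw jointProb
  congr 1
  ext ω
  simp only [Set.mem_inter_iff, Set.mem_ofPred_eq, stringEvent]
  rw [addSymbol_forall hk x b (fun j => X j ω)]
  tauto

lemma margC_jointLaw [IsFiniteMeasure P] (hX : ∀ t, Measurable (X t)) (hk : k ∉ S) (x : S → A)
    (a : A) : margC (jointLaw P X k S) x a = jointProb P X x a := by
  unfold margC
  simp_rw [jointLaw_eq hk]
  exact sum_real_inter_symbol hX k ((measurableSet_stringEvent hX x).inter
    (measurableSet_symbol hX 0 a))

lemma margX_jointLaw [IsFiniteMeasure P] (hX : ∀ t, Measurable (X t)) (hk : k ∉ S) (x : S → A) :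
    margX (jointLaw P X k S) x = P.real (stringEvent X x) := by
  rw [margX_eq_sum_margC]
  simp_rw [margC_jointLaw hX hk]
  exact sum_jointProb hX x

lemma sum_stringEvent [IsProbabilityMeasure P] (hX : ∀ t, Measurable (X t)) :
    ∑ x : S → A, P.real (stringEvent X x) = 1 := by
  rw [← measureReal_biUnion_finset]
  · rw [← probReal_univ (μ := P)]
    congr 1
    ext ω
    simp only [Set.mem_iUnion, Set.mem_univ, iff_true]
    exact ⟨fun j => X j ω, Finset.mem_univ _, fun _ => rfl⟩
  · intro x _ y _ hxy
    refine Set.disjoint_left.2 fun ω h1 h2 => hxy ?_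
    funext j
    exact (h1 j).symm.trans (h2 j)
  · exact fun x _ => measurableSet_stringEvent hX x

lemma FullSupport.jointProb_pos [IsFiniteMeasure P] (h : FullSupport P X) (hS : (0 : ℤ) ∉ S)
    (x : S → A) (a : A) : 0 < jointProb P X x a := by
  have h1 := h (insert 0 S) (addSymbol x 0 a)
  refine ENNReal.toReal_pos (ne_of_gt (h1.trans_eq ?_)) (measure_ne_top _ _)
  congr 1
  ext ω
  exact addSymbol_forall hS x a (fun j => X j ω)

lemma condEntropy_nonneg : 0 ≤ condEntropy P X S := by
  unfold condEntropy
  rw [Left.nonneg_neg_iff]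
  refine Finset.sum_nonpos fun x _ => Finset.sum_nonpos fun a _ => ?_
  refine mul_nonpos_of_nonneg_of_nonpos (jointProb_nonneg x a) ?_
  have h0 : 0 ≤ ∑ c, jointProb P X x c := Finset.sum_nonneg fun c _ => jointProb_nonneg x c
  refine Real.log_nonpos (div_nonneg (jointProb_nonneg x a) h0) (div_le_one_of_le₀ ?_ h0)
  exact Finset.single_le_sum (f := fun c => jointProb P X x c)
    (fun c _ => jointProb_nonneg x c) (Finset.mem_univ a)

variable [IsProbabilityMeasure P] [Nonempty A]

lemma condEntropy_le_log_card (hX : ∀ t, Measurable (X t)) (h : FullSupport P X)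
    (hS : (0 : ℤ) ∉ S) : condEntropy P X S ≤ Real.log A.card := by
  have hcard : 0 < (A.card : ℝ) := by
    have := Fintype.card_pos (α := A)
    rw [Fintype.card_coe] at this
    exact_mod_cast this
  have hp := fun (x : S → A) a => h.jointProb_pos hS x a
  have hs : ∀ x : S → A, 0 < ∑ c, jointProb P X x c := fun x =>
    Finset.sum_pos (fun c _ => hp x c) Finset.univ_nonempty
  have hterm : ∀ (x : S → A) a, -(jointProb P X x a *
      Real.log (jointProb P X x a / ∑ c, jointProb P X x c)) - jointProb P X x a * Real.log A.card ≤
      (∑ c, jointProb P X x c) / A.card - jointProb P X x a := by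
    intro x a
    have h1 := Real.log_le_sub_one_of_pos (div_pos (div_pos (hs x) hcard) (hp x a))
    rw [Real.log_div (div_pos (hs x) hcard).ne' (hp x a).ne', Real.log_div (hs x).ne' hcard.ne'] at h1
    rw [Real.log_div (hp x a).ne' (hs x).ne']
    have h2 := mul_le_mul_of_nonneg_left h1 (hp x a).le
    have h3 : jointProb P X x a * ((∑ c, jointProb P X x c) / A.card / jointProb P X x a - 1) =
        (∑ c, jointProb P X x c) / A.card - jointProb P X x a := by
      have := (hp x a).ne'
      field_simp
    rw [h3] at h2
    linarith
  have hsum := Finset.sum_le_sum fun x (_ : x ∈ Finset.univ) =>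
    Finset.sum_le_sum fun a (_ : a ∈ Finset.univ) => hterm x a
  have htot : ∑ x : S → A, ∑ a, jointProb P X x a = 1 := by
    simp_rw [sum_jointProb hX]
    exact sum_stringEvent hX
  simp_rw [Finset.sum_sub_distrib, Finset.sum_neg_distrib, ← Finset.sum_mul] at hsum
  rw [htot] at hsum
  have hr : ∑ x : S → A, ∑ _a : A, (∑ c, jointProb P X x c) / A.card = 1 := by
    rw [← htot]
    refine Finset.sum_congr rfl fun x _ => ?_
    rw [Finset.sum_const, Finset.card_univ, Fintype.card_coe, nsmul_eq_mul]
    field_simp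
  rw [hr] at hsum
  unfold condEntropy
  linarith

lemma condEntropy_insert_add_le (hX : ∀ t, Measurable (X t)) (h : FullSupport P X)
    (hS : (0 : ℤ) ∉ S) (hk0 : k ≠ 0) (hk : k ∉ S) :
    condEntropy P X (insert k S) + influence (jointLaw P X k S) ^ 2 / 2 ≤ condEntropy P X S := by
  have hS' : (0 : ℤ) ∉ insert k S := by simp [hS, hk0.symm]
  have h1 := influence_sq_le (q := jointLaw P X k S) (fun x b a => h.jointProb_pos hS' _ _)
    (by simp_rw [margX_jointLaw hX hk]; exact sum_stringEvent hX)
  have h2 : condEntropy P X (insert k S) = -∑ x : S → A, ∑ b, ∑ a, jointLaw P X k S x b a *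
      Real.log (jointLaw P X k S x b a / margB (jointLaw P X k S) x b) := by
    unfold condEntropy
    rw [sum_insert_strings hk]
    rfl
  have h3 : condEntropy P X S = -∑ x : S → A, ∑ b, ∑ a, jointLaw P X k S x b a *
      Real.log (margC (jointLaw P X k S) x a / margX (jointLaw P X k S) x) := by
    unfold condEntropy
    congr 1
    refine Finset.sum_congr rfl fun x _ => ?_
    rw [Finset.sum_comm]
    refine Finset.sum_congr rfl fun a _ => ?_
    rw [← Finset.sum_mul, margX_eq_sum_margC]
    simp_rw [margC_jointLaw hX hk]
    congr 1
    exact (margC_jointLaw hX hk x a).symm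
  simp_rw [mul_sub, Finset.sum_sub_distrib] at h1
  linarith

end Entropy

section Covariance

variable {Ω : Type*} [MeasurableSpace Ω] {A : Finset ℝ} {P : Measure Ω} {X : ℤ → Ω → A}
variable {S : Finset ℤ} {k : ℤ}

lemma abs_le_supAbs (a : A) : |(a : ℝ)| ≤ supAbs A :=
  le_ciSup (f := fun a : A => |(a : ℝ)|) (Set.finite_range _).bddAbove a

lemma supAbs_nonneg (A : Finset ℝ) : 0 ≤ supAbs A := Real.iSup_nonneg fun _ => abs_nonneg _

lemma abs_sub_le_diamA (b c : A) : |(b : ℝ) - c| ≤ diamA A := by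
  rw [← Real.dist_eq]
  exact Metric.dist_le_diam_of_mem A.finite_toSet.isBounded b.2 c.2

lemma diamA_nonneg (A : Finset ℝ) : 0 ≤ diamA A := Metric.diam_nonneg

lemma integral_pair_eq_sum {μ : Measure Ω} [IsFiniteMeasure μ] {Y Z : Ω → A} (hY : Measurable Y)
    (hZ : Measurable Z) (g : A → A → ℝ) :
    ∫ ω, g (Y ω) (Z ω) ∂μ = ∑ b, ∑ a, g a b * μ.real {ω | Y ω = a ∧ Z ω = b} := by
  have h1 : ∫ ω, g (Y ω) (Z ω) ∂μ = ∫ w : A × A, g w.1 w.2 ∂(μ.map fun ω => (Y ω, Z ω)) := by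
    rw [integral_map (hY.prodMk hZ).aemeasurable]
    exact (Measurable.of_discrete).aestronglyMeasurable
  rw [h1, integral_fintype (Integrable.of_finite), Fintype.sum_prod_type, Finset.sum_comm]
  refine Finset.sum_congr rfl fun b _ => Finset.sum_congr rfl fun a _ => ?_
  rw [map_measureReal_apply (hY.prodMk hZ) (measurableSet_singleton _), smul_eq_mul, mul_comm]
  congr 2
  ext ω
  simp

lemma abs_covariance_le {μ : Measure Ω} [IsProbabilityMeasure μ] {Y Z : Ω → A} (hY : Measurable Y)
    (hZ : Measurable Z) (r : A → A → ℝ) (hr : ∀ b a, μ.real {ω | Y ω = a ∧ Z ω = b} = r b a) :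
    |cov[fun ω => (Y ω : ℝ), fun ω => (Z ω : ℝ); μ]| ≤
      diamA A * supAbs A * ((1 / 2) * ∑ b, ∑ c, ∑ a,
        |r b a * (∑ a', r c a') - r c a * ∑ a', r b a'|) := by
  have hbd : ∀ {Y : Ω → A}, Measurable Y → MemLp (fun ω => (Y ω : ℝ)) 2 μ := by
    intro Y hY
    refine MemLp.of_bound (measurable_subtype_coe.comp hY).aestronglyMeasurable (supAbs A)
      (ae_of_all _ fun ω => ?_)
    rw [Real.norm_eq_abs]
    exact abs_le_supAbs (Y ω)
  rw [covariance_eq_sub (hbd hY) (hbd hZ)]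
  have e1 : ∫ ω, ((fun ω => (Y ω : ℝ)) * fun ω => (Z ω : ℝ)) ω ∂μ = ∑ b : A, ∑ a : A,
      ((a : ℝ) * b) * r b a := by
    simp_rw [← hr]
    exact integral_pair_eq_sum hY hZ fun a b => (a : ℝ) * b
  have e2 : ∫ ω, (Y ω : ℝ) ∂μ = ∑ b : A, ∑ a : A, (a : ℝ) * r b a := by
    rw [integral_pair_eq_sum hY hZ fun a b => (a : ℝ)]
    simp_rw [hr]
  have e3 : ∫ ω, (Z ω : ℝ) ∂μ = ∑ b : A, ∑ a : A, (b : ℝ) * r b a := by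
    rw [integral_pair_eq_sum hY hZ fun a b => (b : ℝ)]
    simp_rw [hr]
  have e4 : ∑ b : A, ∑ a : A, r b a = 1 := by
    have := integral_pair_eq_sum (μ := μ) hY hZ fun a b => (1 : ℝ)
    simp only [integral_const, probReal_univ, one_mul, smul_eq_mul, mul_one] at this
    simp_rw [hr] at this
    exact this.symm
  rw [e1, e2, e3]
  have key : ∑ b : A, ∑ a : A, ((a : ℝ) * b) * r b a -
      (∑ b : A, ∑ a : A, (a : ℝ) * r b a) * ∑ b : A, ∑ a : A, (b : ℝ) * r b a =
      (1 / 2) * ∑ b : A, ∑ c : A, ∑ a : A, ((b : ℝ) - c) * a *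
        (r b a * (∑ a', r c a') - r c a * ∑ a', r b a') := by
    set R : A → ℝ := fun b => ∑ a, r b a with hR
    have hR1 : ∑ c, R c = 1 := e4
    have t1 : ∑ b : A, ∑ c : A, ∑ a : A, (b : ℝ) * a * (r b a * R c) =
        ∑ b : A, ∑ a : A, ((a : ℝ) * b) * r b a := by
      refine Finset.sum_congr rfl fun b _ => ?_
      rw [Finset.sum_comm]
      refine Finset.sum_congr rfl fun a _ => ?_
      simp_rw [← mul_assoc]
      rw [← Finset.mul_sum, hR1]; ring
    have t2 : ∑ b : A, ∑ c : A, ∑ a : A, (b : ℝ) * a * (r c a * R b) =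
        (∑ b : A, ∑ a : A, (a : ℝ) * r b a) * ∑ b : A, ∑ a : A, (b : ℝ) * r b a := by
      rw [mul_comm, Finset.sum_mul_sum]
      refine Finset.sum_congr rfl fun b _ => Finset.sum_congr rfl fun c _ => ?_
      rw [← Finset.mul_sum, Finset.mul_sum]
      exact Finset.sum_congr rfl fun a _ => by ring
    have t3 : ∑ b : A, ∑ c : A, ∑ a : A, (c : ℝ) * a * (r b a * R c) =
        ∑ b : A, ∑ c : A, ∑ a : A, (b : ℝ) * a * (r c a * R b) := Finset.sum_comm
    have t4 : ∑ b : A, ∑ c : A, ∑ a : A, (c : ℝ) * a * (r c a * R b) =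
        ∑ b : A, ∑ c : A, ∑ a : A, (b : ℝ) * a * (r b a * R c) := Finset.sum_comm
    have t5 : ∑ b : A, ∑ c : A, ∑ a : A, ((b : ℝ) - c) * a * (r b a * R c - r c a * R b) =
        ∑ b : A, ∑ c : A, ∑ a : A, (b : ℝ) * a * (r b a * R c) -
        ∑ b : A, ∑ c : A, ∑ a : A, (b : ℝ) * a * (r c a * R b) -
        ∑ b : A, ∑ c : A, ∑ a : A, (c : ℝ) * a * (r b a * R c) +
        ∑ b : A, ∑ c : A, ∑ a : A, (c : ℝ) * a * (r c a * R b) := by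
      simp_rw [← Finset.sum_sub_distrib, ← Finset.sum_add_distrib]
      refine Finset.sum_congr rfl fun b _ => Finset.sum_congr rfl fun c _ =>
        Finset.sum_congr rfl fun a _ => by ring
    rw [t5, t3, t4, t1, t2]
    ring
  rw [key, abs_mul, abs_of_pos (by norm_num : (0 : ℝ) < 1 / 2), ← mul_assoc, mul_comm _ (1 / 2 : ℝ),
    mul_assoc]
  refine mul_le_mul_of_nonneg_left ?_ (by norm_num)
  simp_rw [Finset.mul_sum]
  refine (Finset.abs_sum_le_sum_abs _ _).trans (Finset.sum_le_sum fun b _ => ?_)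
  refine (Finset.abs_sum_le_sum_abs _ _).trans (Finset.sum_le_sum fun c _ => ?_)
  refine (Finset.abs_sum_le_sum_abs _ _).trans (Finset.sum_le_sum fun a _ => ?_)
  rw [abs_mul, abs_mul]
  simp_rw [← Finset.mul_sum]
  exact mul_le_mul_of_nonneg_right (mul_le_mul (abs_sub_le_diamA b c) (abs_le_supAbs a)
    (abs_nonneg _) (diamA_nonneg A)) (abs_nonneg _)

lemma meanAbsCondCov_le [IsProbabilityMeasure P] (hX : ∀ t, Measurable (X t))
    (h : FullSupport P X) (hk : k ∉ S) :
    meanAbsCondCov P X k S ≤ diamA A * supAbs A * influence (jointLaw P X k S) := by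
  unfold meanAbsCondCov influence
  rw [Finset.mul_sum, Finset.mul_sum]
  refine Finset.sum_le_sum fun x _ => ?_
  set E := stringEvent X x with hE
  have hEm : MeasurableSet E := measurableSet_stringEvent hX x
  have hE0 : P E ≠ 0 := (h S x).ne'
  have : IsProbabilityMeasure P[|E] := cond_isProbabilityMeasure hE0
  have hEr : 0 < P.real E := ENNReal.toReal_pos hE0 (measure_ne_top _ _)
  have hr : ∀ b a, (P[|E]).real {ω | X 0 ω = a ∧ X k ω = b} =
      jointLaw P X k S x b a / P.real E := by
    intro b a
    rw [eq_div_iff hEr.ne', jointLaw_eq hk, Measure.real, Measure.real, ← ENNReal.toReal_mul,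
      cond_mul_eq_inter hEm, Measure.real, Set.inter_assoc]
    rfl
  have h1 := abs_covariance_le (hX 0) (hX k) _ hr
  refine (mul_le_mul_of_nonneg_left h1 hEr.le).trans_eq ?_
  have e1 : ∀ c, ∑ a', jointLaw P X k S x c a' / P.real E =
      margB (jointLaw P X k S) x c / margX (jointLaw P X k S) x := by
    intro c
    rw [margX_jointLaw hX hk, ← Finset.sum_div]
    rfl
  simp_rw [e1]
  rw [mul_left_comm, mul_left_comm (P.real E)]
  congr 2
  simp_rw [Finset.mul_sum]
  refine Finset.sum_congr rfl fun b _ => Finset.sum_congr rfl fun c _ =>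
    Finset.sum_congr rfl fun a _ => ?_
  nth_rw 1 [← abs_of_pos hEr]
  rw [← abs_mul]
  congr 1
  field_simp

end Covariance

section EmpiricalInfluence

variable {A : Finset ℝ} {d m : ℕ} {z : ℤ → A} {k : ℤ} {S : Finset ℤ}

/-- The empirical joint law of the symbols at the lags in `S`, at the lag `k` and at time `0`. -/
def empLaw (d m : ℕ) (z : ℤ → A) (k : ℤ) (S : Finset ℤ) (x : S → A) (b a : A) : ℝ :=
  probHat₀ d m z (addSymbol x k b) a

lemma empLaw_nonneg (hdm : d < m) (x : S → A) (b a : A) : 0 ≤ empLaw d m z k S x b a := by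
  have : (d : ℝ) < m := by exact_mod_cast hdm
  exact div_nonneg (Nat.cast_nonneg _) (by linarith)

lemma sum_probHat₀ (x : S → A) : ∑ a, probHat₀ d m z x a = probHat d m z x := by
  unfold probHat₀ probHat countBar
  rw [← Finset.sum_div, Nat.cast_sum]

lemma margB_empLaw (x : S → A) (b : A) :
    margB (empLaw d m z k S) x b = probHat d m z (addSymbol x k b) := sum_probHat₀ _

lemma margX_empLaw (hk : k ∉ S) (x : S → A) :
    margX (empLaw d m z k S) x = probHat d m z x := by
  rw [margX_eq_sum_margC, ← sum_probHat₀]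
  refine Finset.sum_congr rfl fun a _ => ?_
  unfold margC empLaw probHat₀
  rw [← Finset.sum_div, count_eq_sum_addSymbol hk, Nat.cast_sum]

lemma nuHat_eq_influence (hdm : d < m) (hk : k ∉ S) :
    nuHat d m z k S = influence (empLaw d m z k S) := by
  set q := empLaw d m z k S with hq
  have hq0 : ∀ x b a, 0 ≤ q x b a := fun x b a => empLaw_nonneg hdm x b a
  unfold nuHat influence
  rw [Finset.mul_sum]
  refine Finset.sum_congr rfl fun x _ => ?_
  rw [Finset.mul_sum, Finset.mul_sum]
  refine Finset.sum_congr rfl fun b _ => ?_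
  rw [Finset.mul_sum, Finset.mul_sum]
  refine Finset.sum_congr rfl fun c _ => ?_
  simp only [wHat, dHat, dTV]
  simp_rw [← margB_empLaw, ← margX_empLaw (d := d) (m := m) (z := z) hk]
  simp_rw [← hq]
  have hdiv : ∀ b a, q x b a = margB q x b * (q x b a / margB q x b) := by
    intro b a
    rcases eq_or_ne (margB q x b) 0 with h | h
    · rw [h, zero_mul]
      exact (Finset.sum_eq_zero_iff_of_nonneg fun a _ => hq0 x b a).1 h a (Finset.mem_univ a)
    · field_simp
  have hw : ∀ b, 0 ≤ margB q x b / margX q x := weight_nonneg hq0 x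
  have hterm : ∀ a, |q x b a * (margB q x c / margX q x) - q x c a * (margB q x b / margX q x)| =
      margX q x * (margB q x b / margX q x * (margB q x c / margX q x)) *
        |q x b a / margB q x b - q x c a / margB q x c| := by
    intro a
    have h0 : 0 ≤ margX q x * (margB q x b / margX q x * (margB q x c / margX q x)) :=
      mul_nonneg (margX_nonneg hq0 x) (mul_nonneg (hw b) (hw c))
    rw [← abs_of_nonneg h0, ← abs_mul]
    congr 1
    conv_lhs => rw [hdiv b a, hdiv c a, ← margX_mul_weight hq0 x b, ← margX_mul_weight hq0 x c]
    rw [margX_mul_weight hq0 x b, margX_mul_weight hq0 x c]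
    nth_rw 1 [← margX_mul_weight hq0 x b]
    nth_rw 2 [← margX_mul_weight hq0 x c]
    ring
  simp_rw [hterm]
  rw [← Finset.mul_sum]
  change margX q x * (margB q x b / margX q x * (margB q x c / margX q x) *
    (1 / 2 * ∑ a, |q x b a / margB q x b - q x c a / margB q x c|)) = _
  ring

variable {Ω : Type*} [MeasurableSpace Ω] {P : Measure Ω} {X : ℤ → Ω → A}

/-- The empirical probabilities of all strings on at most `ℓ` lags, followed by a symbol, are
within `u` of the true ones. -/
def EmpiricalClose (P : Measure Ω) (X : ℤ → Ω → A) (d m ℓ : ℕ) (u : ℝ) (z : ℤ → A) : Prop :=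
  ∀ T ⊆ lags d, T.card ≤ ℓ → ∀ (w : T → A) (a : A),
    |probHat₀ d m z w a - jointProb P X w a| ≤ u

lemma zero_notMem_lags : (0 : ℤ) ∉ lags d := by simp [lags]

lemma card_lags (d : ℕ) : (lags d).card = d := by
  rw [lags, Int.card_Icc]
  omega

lemma EmpiricalClose.abs_nuHat_sub_le [Nonempty A] {ℓ : ℕ} {u : ℝ} (h : EmpiricalClose P X d m ℓ u z)
    (hdm : d < m) (hS : S ⊆ lags d) (hk : k ∈ lags d \ S) (hcard : S.card + 1 ≤ ℓ) :
    |nuHat d m z k S - influence (jointLaw P X k S)| ≤ 3 * (A.card : ℝ) ^ (ℓ + 1) * u := by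
  obtain ⟨hkl, hkS⟩ := Finset.mem_sdiff.1 hk
  have hins : insert k S ⊆ lags d := Finset.insert_subset hkl hS
  have hc : (insert k S).card ≤ ℓ := (Finset.card_insert_le _ _).trans hcard
  have hu : 0 ≤ u := (abs_nonneg _).trans
    (h _ hins hc (fun _ => Classical.arbitrary A) (Classical.arbitrary A))
  rw [nuHat_eq_influence hdm hkS]
  refine (abs_influence_sub_le (fun x b a => jointProb_nonneg _ _)
    fun x b a => empLaw_nonneg hdm x b a).trans ?_
  rw [mul_assoc]
  refine mul_le_mul_of_nonneg_left ?_ (by norm_num)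
  calc _ ≤ ∑ _x : S → A, ∑ _b : A, ∑ _a : A, u :=
        Finset.sum_le_sum fun x _ => Finset.sum_le_sum fun b _ => Finset.sum_le_sum fun a _ =>
          h _ hins hc _ _
    _ = (A.card : ℝ) ^ (S.card + 2) * u := by
        simp only [Finset.sum_const, Finset.card_univ, Fintype.card_coe, nsmul_eq_mul,
          Fintype.card_fun]
        push_cast
        ring
    _ ≤ _ := by
        refine mul_le_mul_of_nonneg_right (pow_le_pow_right₀ ?_ (by omega)) hu
        have := Fintype.card_pos (α := A)
        rw [Fintype.card_coe] at this
        exact_mod_cast this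

end EmpiricalInfluence

section ForwardStep

variable {Ω : Type*} [MeasurableSpace Ω] {A : Finset ℝ} {d m : ℕ} {P : Measure Ω}
variable {X : ℤ → Ω → A} {M : MTD A d} {κ : ℝ} {S : Finset ℤ}
variable [IsProbabilityMeasure P]

lemma xiStar_nonneg (hκ : 0 < κ) : 0 ≤ xiStar A κ :=
  div_nonneg hκ.le (mul_nonneg (mul_nonneg (by norm_num) (supAbs_nonneg A)) (diamA_nonneg A))

lemma two_le_card_of_diamA_pos (h : 0 < diamA A) : 2 ≤ A.card := by
  by_contra hlt
  have h1 : A.card ≤ 1 := by omega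
  have h2 : (A : Set ℝ).Subsingleton := fun a ha b hb => Finset.card_le_one.1 h1 a ha b hb
  rw [diamA, Metric.diam_subsingleton h2] at h
  exact lt_irrefl _ h

lemma IsCovLowerBound.exists_influence (hX : ∀ t, Measurable (X t)) (hfull : FullSupport P X)
    (hκ : 0 < κ) (h : IsCovLowerBound P X M κ) (hS : S ⊆ lags d) (hmiss : ¬ M.relevant ⊆ S) :
    ∃ k ∈ M.relevant \ S, 4 * xiStar A κ ≤ influence (jointLaw P X k S) ∧ 0 < xiStar A κ ∧
      2 ≤ A.card := by
  obtain ⟨k, hk, hle⟩ := h S hS hmiss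
  refine ⟨k, hk, ?_⟩
  have h1 := hle.trans (meanAbsCondCov_le hX hfull (Finset.mem_sdiff.1 hk).2)
  have hds : 0 ≤ diamA A * supAbs A := mul_nonneg (diamA_nonneg A) (supAbs_nonneg A)
  have hds' : diamA A * supAbs A ≠ 0 := by
    intro h0
    rw [h0, zero_mul] at h1
    linarith
  have hd : 0 < diamA A := lt_of_le_of_ne (diamA_nonneg A) (left_ne_zero_of_mul hds').symm
  have hs : 0 < supAbs A := lt_of_le_of_ne (supAbs_nonneg A) (right_ne_zero_of_mul hds').symm
  refine ⟨?_, ?_, two_le_card_of_diamA_pos hd⟩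
  · unfold xiStar
    rw [mul_div_assoc', div_le_iff₀ (by positivity)]
    linarith
  · unfold xiStar
    positivity

lemma relevant_subset_lags (M : MTD A d) : M.relevant ⊆ lags d := Finset.filter_subset _ _

lemma log_card_lt (hξ : 0 < xiStar A κ) :
    Real.log A.card < ((ellStar A κ : ℝ) + 1) * (49 / 8 * xiStar A κ ^ 2) := by
  have h1 := Nat.lt_floor_add_one (Real.logb 2 A.card / (8 * xiStar A κ ^ 2))
  rw [div_lt_iff₀ (by positivity), Real.logb, div_lt_iff₀ (Real.log_pos (by norm_num))] at h1
  refine h1.trans_le ?_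
  have h2 := Real.log_two_lt_d9
  have h3 : (0 : ℝ) ≤ (ellStar A κ : ℝ) + 1 := by positivity
  unfold ellStar at *
  have h4 : 8 * xiStar A κ ^ 2 * Real.log 2 ≤ 49 / 8 * xiStar A κ ^ 2 := by
    nlinarith [sq_nonneg (xiStar A κ)]
  rw [mul_assoc]
  exact mul_le_mul_of_nonneg_left h4 h3

lemma FSReach.subset_lags {z : ℤ → A} (h : FSReach d m z S) : S ⊆ lags d := by
  induction h with
  | empty => exact Finset.empty_subset _
  | step S j _ hj _ ih => exact Finset.insert_subset (Finset.mem_sdiff.1 hj).1 ih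

variable [Nonempty A]

lemma card_relevant_le_ellStar (hX : ∀ t, Measurable (X t)) (hfull : FullSupport P X)
    (hκ : 0 < κ) (h : IsCovLowerBound P X M κ) : M.relevant.card ≤ ellStar A κ := by
  by_contra hlt
  push Not at hlt
  have key : ∀ s ≤ M.relevant.card, ∃ S ⊆ M.relevant, S.card = s ∧
      condEntropy P X S + s * (49 / 8 * xiStar A κ ^ 2) ≤ condEntropy P X ∅ := by
    intro s
    induction s with
    | zero => exact fun _ => ⟨∅, Finset.empty_subset _, rfl, by simp⟩
    | succ s ih =>
      intro hs
      obtain ⟨S, hSsub, hcard, hent⟩ := ih (by omega)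
      have hmiss : ¬ M.relevant ⊆ S := fun hsub => by
        have := Finset.card_le_card hsub
        omega
      obtain ⟨k, hk, hinf, hξ, _⟩ := h.exists_influence hX hfull hκ
        (hSsub.trans (relevant_subset_lags M)) hmiss
      obtain ⟨hkr, hkS⟩ := Finset.mem_sdiff.1 hk
      refine ⟨insert k S, Finset.insert_subset hkr hSsub, ?_, ?_⟩
      · rw [Finset.card_insert_of_notMem hkS, hcard]
      · have h0 : (0 : ℤ) ∉ S := fun h0 => zero_notMem_lags
          (relevant_subset_lags M (hSsub h0))
        have hk0 : k ≠ 0 := fun h0 => zero_notMem_lags (h0 ▸ relevant_subset_lags M hkr)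
        have h1 := condEntropy_insert_add_le hX hfull h0 hk0 hkS
        have h2 := pow_le_pow_left₀ (by positivity) hinf 2
        push_cast
        nlinarith [sq_nonneg (xiStar A κ)]
  have hmiss : ¬ M.relevant ⊆ ∅ := fun hsub => by
    have := Finset.card_le_card hsub
    rw [Finset.card_empty] at this
    omega
  obtain ⟨_, _, _, hξ, hA⟩ := h.exists_influence hX hfull hκ (Finset.empty_subset _) hmiss
  obtain ⟨S, _, _, hent⟩ := key (ellStar A κ + 1) (by omega)
  have h1 := condEntropy_nonneg (P := P) (X := X) (S := S)
  have h2 := condEntropy_le_log_card hX hfull (S := ∅) (by simp)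
  have h3 := log_card_lt hξ
  push_cast at hent
  linarith

lemma FSReach.entropy_le (hX : ∀ t, Measurable (X t)) (hfull : FullSupport P X)
    (hκ : 0 < κ) (h : IsCovLowerBound P X M κ) (hdm : d < m) {z : ℤ → A} {ℓ : ℕ}
    (hclose : EmpiricalClose P X d m ℓ (xiStar A κ / (6 * (A.card : ℝ) ^ (ℓ + 2))) z)
    (hS : FSReach d m z S) (hcard : S.card ≤ ℓ) :
    M.relevant ⊆ S ∨
      condEntropy P X S + S.card * (49 / 8 * xiStar A κ ^ 2) ≤ condEntropy P X ∅ := by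
  induction hS with
  | empty => right; simp
  | step S j hreach hj hmax ih =>
    obtain ⟨hjl, hjS⟩ := Finset.mem_sdiff.1 hj
    rw [Finset.card_insert_of_notMem hjS] at hcard ⊢
    rcases ih (by omega) with hsub | hent
    · exact Or.inl (hsub.trans (Finset.subset_insert _ _))
    by_cases hmiss : M.relevant ⊆ S
    · exact Or.inl (hmiss.trans (Finset.subset_insert _ _))
    right
    have hSl := hreach.subset_lags
    obtain ⟨k, hk, hinf, hξ, hA⟩ := h.exists_influence hX hfull hκ hSl hmiss
    obtain ⟨hkr, hkS⟩ := Finset.mem_sdiff.1 hk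
    have hkl : k ∈ lags d \ S := Finset.mem_sdiff.2 ⟨relevant_subset_lags M hkr, hkS⟩
    have e1 := abs_le.1 (hclose.abs_nuHat_sub_le hdm hSl hkl hcard)
    have e2 := abs_le.1 (hclose.abs_nuHat_sub_le hdm hSl hj hcard)
    have hAr : (2 : ℝ) ≤ A.card := by exact_mod_cast hA
    have herr : 3 * (A.card : ℝ) ^ (ℓ + 1) * (xiStar A κ / (6 * (A.card : ℝ) ^ (ℓ + 2))) ≤
        xiStar A κ / 4 := by
      have : 3 * (A.card : ℝ) ^ (ℓ + 1) * (xiStar A κ / (6 * (A.card : ℝ) ^ (ℓ + 2))) =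
          xiStar A κ / (2 * A.card) := by
        field_simp
        ring
      rw [this]
      exact div_le_div_of_nonneg_left hξ.le (by norm_num) (by linarith)
    have hj' : 7 / 2 * xiStar A κ ≤ influence (jointLaw P X j S) := by
      linarith [hmax k hkl, e1.1, e2.2]
    have h0 : (0 : ℤ) ∉ S := fun h0 => zero_notMem_lags (hSl h0)
    have hj0 : j ≠ 0 := fun h0 => zero_notMem_lags (h0 ▸ hjl)
    have h1 := condEntropy_insert_add_le hX hfull h0 hj0 hjS
    have h2 := pow_le_pow_left₀ (by positivity) hj' 2
    push_cast
    nlinarith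

/-- If the empirical probabilities are accurate, the forward step finds all relevant lags. -/
theorem FSOutput.relevant_subset (hX : ∀ t, Measurable (X t)) (hfull : FullSupport P X)
    (hκ : 0 < κ) (h : IsCovLowerBound P X M κ) (hdm : d < m) {z : ℤ → A}
    (hclose : EmpiricalClose P X d m (ellStar A κ)
      (xiStar A κ / (6 * (A.card : ℝ) ^ (ellStar A κ + 2))) z)
    (hS : FSOutput d m (ellStar A κ) z S) : M.relevant ⊆ S := by
  by_contra hmiss
  have hSl := hS.1.subset_lags
  have hent := (hS.1.entropy_le hX hfull hκ h hdm hclose hS.2.le).resolve_left hmiss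
  obtain ⟨k, hk, hinf, hξ, hA⟩ := h.exists_influence hX hfull hκ hSl hmiss
  obtain ⟨hkr, hkS⟩ := Finset.mem_sdiff.1 hk
  have h0 : (0 : ℤ) ∉ S := fun h0 => zero_notMem_lags (hSl h0)
  have hk0 : k ≠ 0 := fun h0 => zero_notMem_lags (h0 ▸ relevant_subset_lags M hkr)
  have h1 := condEntropy_insert_add_le hX hfull h0 hk0 hkS
  have h2 := pow_le_pow_left₀ (by positivity) hinf 2
  have h3 := condEntropy_nonneg (P := P) (X := X) (S := insert k S)
  have h4 := condEntropy_le_log_card hX hfull (S := ∅) (by simp)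
  have h5 := log_card_lt hξ
  rw [hS.2] at hent
  nlinarith [sq_nonneg (xiStar A κ)]

end ForwardStep

section ForwardProbability

variable {Ω : Type*} [MeasurableSpace Ω] {A : Finset ℝ} {d m : ℕ} {P : Measure Ω}
variable {X : ℤ → Ω → A} {M : MTD A d}

lemma choose_le_choose_of_two_mul_le {s ℓ : ℕ} (hs : s ≤ ℓ) (hℓ : 2 * ℓ ≤ d) :
    d.choose s ≤ d.choose ℓ := by
  induction ℓ, hs using Nat.le_induction with
  | base => exact le_rfl
  | succ k hk ih =>
    exact (ih (by omega)).trans (Nat.choose_le_succ_of_lt_half_left (by omega))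

lemma card_small_lagSets_le {ℓ : ℕ} (hℓ : 2 * ℓ ≤ d) :
    ((lags d).powerset.filter fun T => T.card ≤ ℓ).card ≤ (ℓ + 1) * d.choose ℓ := by
  classical
  have hsub : ((lags d).powerset.filter fun T => T.card ≤ ℓ) ⊆
      (Finset.range (ℓ + 1)).biUnion fun s => (lags d).powersetCard s := by
    intro T hT
    simp only [Finset.mem_filter, Finset.mem_powerset, Finset.mem_biUnion, Finset.mem_range,
      Finset.mem_powersetCard] at hT ⊢
    exact ⟨T.card, by omega, hT.1, rfl⟩
  refine (Finset.card_le_card hsub).trans (Finset.card_biUnion_le.trans ?_)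
  calc _ ≤ ∑ _s ∈ Finset.range (ℓ + 1), d.choose ℓ := by
        refine Finset.sum_le_sum fun s hs => ?_
        rw [Finset.card_powersetCard, card_lags]
        exact choose_le_choose_of_two_mul_le (by have := Finset.mem_range.1 hs; omega) hℓ
    _ = _ := by simp

variable [IsProbabilityMeasure P]

lemma lags_insert_subset {T : Finset ℤ} (hT : T ⊆ lags d) :
    insert 0 T ⊆ Finset.Icc (-(d : ℤ)) 0 := by
  refine Finset.insert_subset (by simp) fun j hj => ?_
  have := hT hj
  simp only [lags, Finset.mem_Icc] at this ⊢
  omega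

lemma IsMTDChain.real_probHat₀_gt_le (h : IsMTDChain P X M) (hΔ : 0 < M.Delta) (hdm : d < m)
    {T : Finset ℤ} (hT : T ⊆ lags d) (w : T → A) (a : A) {u : ℝ} (hu : 0 ≤ u) :
    P.real {ω | u < |probHat₀ d m (fun t => X t ω) w a - jointProb P X w a|} ≤
      2 * Real.exp (-(2 * (((m : ℝ) - d) * u) ^ 2 * M.Delta ^ 2 /
        ((m : ℝ) * ((T.card : ℝ) + 1) ^ 2))) := by
  have h0 : (0 : ℤ) ∉ T := fun h0 => zero_notMem_lags (hT h0)
  have hmd : (0 : ℝ) < (m : ℝ) - d := by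
    have : (d : ℝ) < m := by exact_mod_cast hdm
    linarith
  obtain ⟨y, rfl⟩ : ∃ y : ℤ → A, w = fun j : T => y j := ⟨_, string_eq_restrict a w⟩
  have hj : jointProb P X (fun j : T => y j) a =
      patternProb P X (insert 0 T) (Function.update y 0 a) := by
    unfold jointProb patternProb
    congr 1
    ext ω
    simp only [Set.mem_ofPred_eq, Finset.forall_mem_insert, Function.update_self]
    rw [and_comm]
    refine and_congr Iff.rfl ⟨fun h j hj => ?_, fun h j => ?_⟩
    · rw [Function.update_of_ne (by rintro rfl; exact h0 hj)]
      exact h ⟨j, hj⟩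
    · have := h j j.2
      rwa [Function.update_of_ne (by intro h1; exact h0 (h1 ▸ j.2))] at this
  have hmain := h.real_abs_patternCount_gt_le (m := 0) (n := m) hΔ (lags_insert_subset hT)
    (Finset.insert_nonempty 0 T) (by omega) (by omega) (Function.update y 0 a)
    (mul_nonneg hmd.le hu)
  rw [Finset.card_insert_of_notMem h0] at hmain
  simp only [Nat.cast_zero, sub_zero, Nat.cast_add, Nat.cast_one] at hmain
  refine le_trans (le_of_eq ?_) hmain
  congr 1
  ext ω
  simp only [Set.mem_ofPred_eq]
  rw [probHat₀, hj, count_eq_patternCount h0]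
  simp only [Nat.cast_zero]
  rw [div_sub' hmd.ne', abs_div, abs_of_pos hmd, lt_div_iff₀ hmd, mul_comm u]

theorem IsMTDChain.real_not_empiricalClose_le (h : IsMTDChain P X M) (hΔ : 0 < M.Delta)
    (hdm : d < m) [Nonempty A] {ℓ : ℕ} (hℓ : 2 * ℓ ≤ d) {ξ : ℝ} (hξ : 0 ≤ ξ) :
    P.real {ω | ¬ EmpiricalClose P X d m ℓ (ξ / (6 * (A.card : ℝ) ^ (ℓ + 2))) fun t => X t ω} ≤
      2 * A.card * ((ℓ : ℝ) + 1) * d.choose ℓ * ((A.card : ℝ) ^ ℓ *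
        Real.exp (-((ξ * M.Delta) ^ 2 * ((m : ℝ) - d) ^ 2 /
          (18 * m * (A.card : ℝ) ^ (2 * (ℓ + 2)) * ((ℓ : ℝ) + 2) ^ 2)))) := by
  classical
  have hA : (1 : ℝ) ≤ A.card := by
    have := Fintype.card_pos (α := A)
    rw [Fintype.card_coe] at this
    exact_mod_cast this
  have hm : (0 : ℝ) < m := by exact_mod_cast (Nat.zero_le d).trans_lt hdm
  set u : ℝ := ξ / (6 * (A.card : ℝ) ^ (ℓ + 2)) with hu
  have hu0 : 0 ≤ u := by positivity
  set B := (lags d).powerset.filter fun T => T.card ≤ ℓ with hB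
  set E : ℝ := Real.exp (-((ξ * M.Delta) ^ 2 * ((m : ℝ) - d) ^ 2 /
          (18 * m * (A.card : ℝ) ^ (2 * (ℓ + 2)) * ((ℓ : ℝ) + 2) ^ 2))) with hE
  have hsub : {ω | ¬ EmpiricalClose P X d m ℓ u fun t => X t ω} ⊆
      ⋃ T ∈ B, ⋃ w : T → A, ⋃ a : A,
        {ω | u < |probHat₀ d m (fun t => X t ω) w a - jointProb P X w a|} := by
    intro ω hω
    simp only [EmpiricalClose, Set.mem_ofPred_eq, not_forall, not_le] at hω
    obtain ⟨T, hT, hc, w, a, hlt⟩ := hω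
    simp only [Set.mem_iUnion]
    exact ⟨T, Finset.mem_filter.2 ⟨Finset.mem_powerset.2 hT, hc⟩, w, a, hlt⟩
  have hsingle : ∀ T ∈ B, ∀ (w : T → A) (a : A),
      P.real {ω | u < |probHat₀ d m (fun t => X t ω) w a - jointProb P X w a|} ≤ 2 * E := by
    intro T hT w a
    obtain ⟨hT1, hT2⟩ := Finset.mem_filter.1 hT
    refine (h.real_probHat₀_gt_le hΔ hdm (Finset.mem_powerset.1 hT1) w a hu0).trans ?_
    refine mul_le_mul_of_nonneg_left (Real.exp_le_exp.2 (neg_le_neg ?_)) (by norm_num)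
    have hTr : (T.card : ℝ) ≤ ℓ := by exact_mod_cast hT2
    calc (ξ * M.Delta) ^ 2 * ((m : ℝ) - d) ^ 2 /
          (18 * m * (A.card : ℝ) ^ (2 * (ℓ + 2)) * ((ℓ : ℝ) + 2) ^ 2)
        = 2 * (((m : ℝ) - d) * u) ^ 2 * M.Delta ^ 2 / ((m : ℝ) * ((ℓ : ℝ) + 2) ^ 2) := by
          rw [hu, pow_mul']
          field_simp
          ring
      _ ≤ _ := by
          refine div_le_div_of_nonneg_left (by positivity) (by positivity) ?_
          gcongr
          linarith
  have hBcard : (B.card : ℝ) ≤ ((ℓ : ℝ) + 1) * d.choose ℓ := by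
    exact_mod_cast card_small_lagSets_le hℓ
  calc _ ≤ P.real (⋃ T ∈ B, ⋃ w : T → A, ⋃ a : A,
        {ω | u < |probHat₀ d m (fun t => X t ω) w a - jointProb P X w a|}) :=
        measureReal_mono hsub (measure_ne_top _ _)
    _ ≤ ∑ T ∈ B, ∑ _w : T → A, ∑ _a : A, 2 * E := by
        refine (measureReal_biUnion_finset_le _ _).trans (Finset.sum_le_sum fun T hT => ?_)
        refine (measureReal_iUnion_fintype_le _).trans (Finset.sum_le_sum fun w _ => ?_)
        exact (measureReal_iUnion_fintype_le _).trans
          (Finset.sum_le_sum fun a _ => hsingle T hT w a)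
    _ ≤ ∑ T ∈ B, (A.card : ℝ) ^ ℓ * (A.card * (2 * E)) := by
        refine Finset.sum_le_sum fun T hT => ?_
        simp only [Finset.sum_const, Finset.card_univ, Fintype.card_coe, nsmul_eq_mul,
          Fintype.card_fun]
        push_cast
        have hE0 : 0 ≤ E := (Real.exp_pos _).le
        refine mul_le_mul_of_nonneg_right (pow_le_pow_right₀ hA ?_) (by positivity)
        exact (Finset.mem_filter.1 hT).2
    _ = B.card * ((A.card : ℝ) ^ ℓ * (A.card * (2 * E))) := by rw [Finset.sum_const, nsmul_eq_mul]
    _ ≤ ((ℓ : ℝ) + 1) * d.choose ℓ * ((A.card : ℝ) ^ ℓ * (A.card * (2 * E))) := by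
        have hE0 : 0 ≤ E := (Real.exp_pos _).le
        exact mul_le_mul_of_nonneg_right hBcard (by positivity)
    _ = _ := by ring

end ForwardProbability

section Bernstein

lemma psi_le_sq_div {l : ℝ} (hl : 0 ≤ l) (hl3 : l < 3) :
    psi l ≤ l ^ 2 / (2 * (1 - l / 3)) := by
  have h1 : HasSum (fun k : ℕ => l ^ k / (k.factorial : ℝ)) (Real.exp l) := by
    rw [Real.exp_eq_exp_ℝ]
    exact NormedSpace.expSeries_div_hasSum_exp l
  have h2 : HasSum (fun k : ℕ => l ^ (k + 2) / ((k + 2).factorial : ℝ)) (psi l) := by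
    have := (hasSum_nat_add_iff' 2).2 h1
    have e : psi l = Real.exp l - ∑ i ∈ Finset.range 2, l ^ i / (i.factorial : ℝ) := by
      rw [Finset.sum_range_succ, Finset.sum_range_one]
      simp [psi]; ring
    rw [e]
    exact this
  have h3 : HasSum (fun k : ℕ => l ^ 2 / 2 * (l / 3) ^ k) (l ^ 2 / 2 * (1 - l / 3)⁻¹) :=
    (hasSum_geometric_of_lt_one (by positivity) (by linarith)).mul_left _
  have h4 : psi l ≤ l ^ 2 / 2 * (1 - l / 3)⁻¹ := by
    refine hasSum_le (fun k => ?_) h2 h3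
    have hf : (2 : ℝ) * 3 ^ k ≤ ((k + 2).factorial : ℝ) := by
      have := Nat.factorial_mul_pow_le_factorial (m := 2) (n := k)
      rw [add_comm 2 k] at this
      exact_mod_cast this
    calc l ^ (k + 2) / ((k + 2).factorial : ℝ) ≤ l ^ (k + 2) / (2 * 3 ^ k) :=
          div_le_div_of_nonneg_left (by positivity) (by positivity) hf
      _ = _ := by rw [div_pow, pow_add]; field_simp
  refine h4.trans_eq ?_
  rw [← div_eq_mul_inv, div_div]

lemma psi_nonneg (l : ℝ) : 0 ≤ psi l := by
  have := Real.add_one_le_exp l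
  unfold psi; linarith

lemma psi_neg_le {l : ℝ} (hl : 0 ≤ l) : psi (-l) ≤ psi l := by
  have := Real.self_le_sinh_iff.2 hl
  rw [Real.sinh_eq] at this
  unfold psi; linarith

/-- The optimal tilt in Bernstein's inequality. -/
lemma exists_bernstein_tilt {α v : ℝ} (hα : 0 < α) (hv : 0 < v) :
    ∃ l : ℝ, 0 < l ∧ α ≤ l * (Real.sqrt (2 * α * v) + α / 3) - psi l * v := by
  set s := Real.sqrt (2 * α / v) with hs
  have hs0 : 0 < s := Real.sqrt_pos.2 (by positivity)
  have hsv : s ^ 2 * v = 2 * α := by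
    rw [hs, Real.sq_sqrt (by positivity)]; field_simp
  have hsq : Real.sqrt (2 * α * v) = s * v := by
    rw [show 2 * α * v = (s * v) ^ 2 by rw [mul_pow, sq v, ← mul_assoc, hsv],
      Real.sqrt_sq (by positivity)]
  set l := s / (1 + s / 3) with hl
  have hl0 : 0 < l := by positivity
  have hl3 : 1 - l / 3 = 1 / (1 + s / 3) := by rw [hl]; field_simp; ring
  have hl3' : l < 3 := by
    have : 0 < 1 / (1 + s / 3) := by positivity
    linarith
  refine ⟨l, hl0, ?_⟩
  have h1 := mul_le_mul_of_nonneg_right (psi_le_sq_div hl0.le hl3') hv.le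
  have h2 : l ^ 2 / (2 * (1 - l / 3)) * v = α / (1 + s / 3) := by
    rw [hl3, hl]
    field_simp
    linarith
  have h3 : l * (s * v + α / 3) = (2 * α + s * α / 3) / (1 + s / 3) := by
    rw [hl, ← hsv]
    field_simp
  have h4 : (2 * α + s * α / 3) / (1 + s / 3) - α / (1 + s / 3) = α := by
    field_simp
    ring
  rw [hsq, h3]
  linarith

end Bernstein

section Tilted

variable {A : Finset ℝ} {d : ℕ}

lemma MTD.trans_congr_relevant (M : MTD A d) {x y : ℤ → A} (h : ∀ j ∈ M.relevant, x j = y j) :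
    M.trans x = M.trans y := by
  funext a
  unfold MTD.trans
  congr 1
  refine Finset.sum_congr rfl fun j hj => ?_
  by_cases hr : j ∈ M.relevant
  · rw [h j hr]
  · have h0 : M.osc j ≤ 0 := by
      by_contra hlt
      exact hr (Finset.mem_filter.2 ⟨hj, not_le.1 hlt⟩)
    have h1 := (M.lam_mul_dTV_le hj (x j) (y j)).trans h0
    have h2 : M.lam j * |M.p j (x j) a - M.p j (y j) a| ≤ 0 := by
      have h3 : |M.p j (x j) a - M.p j (y j) a| ≤ 2 * dTV (M.p j (x j)) (M.p j (y j)) := by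
        unfold dTV
        rw [← mul_assoc, mul_one_div_cancel two_ne_zero, one_mul]
        exact Finset.single_le_sum (f := fun a => |M.p j (x j) a - M.p j (y j) a|)
          (fun _ _ => abs_nonneg _) (Finset.mem_univ a)
      nlinarith [M.lam_nonneg j hj, mul_le_mul_of_nonneg_left h3 (M.lam_nonneg j hj)]
    have h4 : |M.lam j * (M.p j (x j) a - M.p j (y j) a)| ≤ 0 := by
      rwa [abs_mul, abs_of_nonneg (M.lam_nonneg j hj)]
    have h5 := abs_nonpos_iff.1 h4
    linarith

lemma patternCount_Icc_succ (J : Finset ℤ) (y z : ℤ → A) {s t : ℤ} (hst : s ≤ t)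
    [Decidable (∀ j ∈ J, z (t + j) = y j)] :
    patternCount J (Finset.Icc s t) y z =
      patternCount J (Finset.Icc s (t - 1)) y z + if ∀ j ∈ J, z (t + j) = y j then 1 else 0 := by
  classical
  have e : Finset.Icc s t = insert t (Finset.Icc s (t - 1)) := by
    ext i; simp only [Finset.mem_Icc, Finset.mem_insert]; omega
  unfold patternCount
  rw [e, Finset.filter_insert]
  split_ifs with h
  · rw [Finset.card_insert_of_notMem]
    simp
  · rfl

lemma patternCount_update_of_lt {J : Finset ℤ} (hJ : J ⊆ Finset.Icc (-(d : ℤ)) 0) (y z : ℤ → A)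
    {s e r : ℤ} (hr : e < r) (b : A) :
    patternCount J (Finset.Icc s e) y (Function.update z r b) =
      patternCount J (Finset.Icc s e) y z := by
  classical
  unfold patternCount
  congr 1
  refine Finset.filter_congr fun t ht => forall₂_congr fun j hj => ?_
  have h1 := Finset.mem_Icc.1 (hJ hj)
  have h2 := Finset.mem_Icc.1 ht
  rw [Function.update_of_ne (by omega)]

lemma patternCount_insert_le (S I : Finset ℤ) (hS : (0 : ℤ) ∉ S) (y z : ℤ → A) (a : A) :
    patternCount (insert 0 S) I (Function.update y 0 a) z ≤ patternCount S I y z := by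
  classical
  unfold patternCount
  refine Finset.card_le_card fun t ht => ?_
  simp only [Finset.mem_filter, Finset.forall_mem_insert] at ht ⊢
  refine ⟨ht.1, fun j hj => ?_⟩
  rw [ht.2.2 j hj, Function.update_of_ne (by rintro rfl; exact hS hj)]

/-- The exponential weight of the number of transitions to `a`, compensated by the number of
occurrences of the pattern `y`. -/
def tiltedWeight (S : Finset ℤ) (y : ℤ → A) (a : A) (l p : ℝ) (I : Finset ℤ) (z : ℤ → A) : ℝ :=
  Real.exp (l * patternCount (insert 0 S) I (Function.update y 0 a) z -
    p * (Real.exp l - 1) * patternCount S I y z)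

variable {S : Finset ℤ} {m n : ℕ}

lemma lags_subset_Icc (hS : S ⊆ lags d) : S ⊆ Finset.Icc (-(d : ℤ)) 0 :=
  (Finset.subset_insert 0 S).trans (lags_insert_subset hS)

lemma dependsOn_tiltedWeight (hS : S ⊆ lags d) (y : ℤ → A) (a : A) (l p : ℝ) (e : ℤ) :
    DependsOn (tiltedWeight S y a l p (Finset.Icc ((m : ℤ) + d + 1) e))
      (Finset.Icc (1 : ℤ) e : Set ℤ) := by
  intro z z' h
  have h' : ∀ i ∈ (Finset.Icc ((m : ℤ) + 1) e : Set ℤ), z i = z' i := fun i hi => by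
    apply h
    simp only [Finset.coe_Icc, Set.mem_Icc] at hi ⊢
    omega
  have h1 := dependsOn_patternCount (lags_subset_Icc hS) ((m : ℤ) + 1) e y h'
  have h2 := dependsOn_patternCount (lags_insert_subset hS) ((m : ℤ) + 1) e
    (Function.update y 0 a) h'
  rw [show (m : ℤ) + 1 + d = m + d + 1 by ring] at h1 h2
  simp only at h1 h2
  unfold tiltedWeight
  rw [h1, h2]

lemma tiltedWeight_update (hS : S ⊆ lags d) (y z : ℤ → A) (a b : A) (l p : ℝ) {t : ℤ}
    (ht : (m : ℤ) + d + 1 ≤ t) [Decidable (∀ j ∈ S, z (t + j) = y j)] :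
    tiltedWeight S y a l p (Finset.Icc ((m : ℤ) + d + 1) t) (Function.update z t b) =
      tiltedWeight S y a l p (Finset.Icc ((m : ℤ) + d + 1) (t - 1)) z *
        if ∀ j ∈ S, z (t + j) = y j then
          (if b = a then Real.exp l else 1) * Real.exp (-(p * (Real.exp l - 1))) else 1 := by
  classical
  have h0 : (0 : ℤ) ∉ S := fun h => zero_notMem_lags (hS h)
  have e1 : (∀ j ∈ S, Function.update z t b (t + j) = y j) ↔ ∀ j ∈ S, z (t + j) = y j := by
    refine forall₂_congr fun j hj => ?_
    have : j ≠ 0 := by rintro rfl; exact h0 hj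
    rw [Function.update_of_ne (by omega)]
  have e2 : (∀ j ∈ insert 0 S, Function.update z t b (t + j) = Function.update y 0 a j) ↔
      b = a ∧ ∀ j ∈ S, z (t + j) = y j := by
    rw [Finset.forall_mem_insert, add_zero, Function.update_self, Function.update_self]
    refine and_congr Iff.rfl (forall₂_congr fun j hj => ?_)
    have : j ≠ 0 := by rintro rfl; exact h0 hj
    rw [Function.update_of_ne (by omega), Function.update_of_ne this]
  unfold tiltedWeight
  rw [patternCount_Icc_succ _ _ _ ht, patternCount_Icc_succ _ _ _ ht,
    patternCount_update_of_lt (lags_subset_Icc hS) _ _ (by omega),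
    patternCount_update_of_lt (lags_insert_subset hS) _ _ (by omega)]
  simp only [e1, e2]
  by_cases hχ : ∀ j ∈ S, z (t + j) = y j
  · by_cases hb : b = a
    · rw [if_pos ⟨hb, hχ⟩, if_pos hχ, if_pos hχ, if_pos hb, ← Real.exp_add, ← Real.exp_add]
      congr 1
      push_cast
      ring
    · rw [if_neg (fun h => hb h.1), if_pos hχ, if_pos hχ, if_neg hb, one_mul, ← Real.exp_add]
      congr 1
      push_cast
      ring
  · rw [if_neg (fun h => hχ h.2), if_neg hχ, if_neg hχ, mul_one]
    simp

variable {Ω : Type*} [MeasurableSpace Ω] {P : Measure Ω} {X : ℤ → Ω → A} {M : MTD A d}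

lemma MTD.step_mul_tiltedWeight_le (M : MTD A d) (hS : S ⊆ lags d) (hrel : M.relevant ⊆ S)
    (y : ℤ → A) (a : A) (l : ℝ) {t : ℤ} (ht : (m : ℤ) + d + 1 ≤ t) {g : (ℤ → A) → ℝ}
    (hg0 : ∀ z, 0 ≤ g z) (hg : DependsOn g (Finset.Icc (1 : ℤ) m : Set ℤ)) (z : ℤ → A) :
    M.step t (fun z => g z *
        tiltedWeight S y a l (M.trans y a) (Finset.Icc ((m : ℤ) + d + 1) t) z) z ≤
      g z * tiltedWeight S y a l (M.trans y a) (Finset.Icc ((m : ℤ) + d + 1) (t - 1)) z := by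
  classical
  set p := M.trans y a with hp
  set U := tiltedWeight S y a l p (Finset.Icc ((m : ℤ) + d + 1) (t - 1)) z with hU
  have hU0 : 0 ≤ U := (Real.exp_pos _).le
  have hgu : ∀ b, g (Function.update z t b) = g z := fun b => by
    apply hg
    intro i hi
    simp only [Finset.coe_Icc, Set.mem_Icc] at hi
    rw [Function.update_of_ne (by omega)]
  unfold MTD.step
  simp_rw [hgu, tiltedWeight_update hS y z a _ l p ht, ← hU]
  by_cases hχ : ∀ j ∈ S, z (t + j) = y j
  · simp_rw [if_pos hχ]
    have htr : M.trans (fun j => z (t + j)) = M.trans y :=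
      M.trans_congr_relevant fun j hj => hχ j (hrel hj)
    rw [htr]
    have e1 : ∑ b, M.trans y b * (g z * (U * ((if b = a then Real.exp l else 1) *
        Real.exp (-(p * (Real.exp l - 1)))))) =
        g z * U * (Real.exp (-(p * (Real.exp l - 1))) * ∑ b, M.trans y b *
          (1 + if b = a then Real.exp l - 1 else 0)) := by
      rw [Finset.mul_sum, Finset.mul_sum]
      refine Finset.sum_congr rfl fun b _ => ?_
      split_ifs <;> ring
    have e2 : ∑ b, M.trans y b * (1 + if b = a then Real.exp l - 1 else 0) =
        1 + p * (Real.exp l - 1) := by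
      simp_rw [mul_add, mul_one, Finset.sum_add_distrib, M.trans_sum]
      simp [hp]
    rw [e1, e2]
    refine mul_le_of_le_one_right (mul_nonneg (hg0 z) hU0) ?_
    have h1 := Real.add_one_le_exp (p * (Real.exp l - 1))
    rw [Real.exp_neg, inv_mul_le_one₀ (Real.exp_pos _)]
    linarith
  · simp_rw [if_neg hχ, mul_one, ← Finset.sum_mul, M.trans_sum, one_mul]
    exact le_rfl

lemma IsMTDChain.integral_mul_tiltedWeight_le [IsProbabilityMeasure P] (h : IsMTDChain P X M)
    (hS : S ⊆ lags d) (hrel : M.relevant ⊆ S) (y : ℤ → A) (a : A) (l : ℝ)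
    {g : (ℤ → A) → ℝ} (hg0 : ∀ z, 0 ≤ g z) (hg : DependsOn g (Finset.Icc (1 : ℤ) m : Set ℤ))
    (hmn : m + d ≤ n) :
    ∫ ω, g (fun i => X i ω) *
        tiltedWeight S y a l (M.trans y a) (Finset.Icc ((m : ℤ) + d + 1) n) (fun i => X i ω) ∂P ≤
      ∫ ω, g (fun i => X i ω) ∂P := by
  have : Nonempty A := ⟨a⟩
  induction n, hmn using Nat.le_induction with
  | base =>
    have e : Finset.Icc ((m : ℤ) + d + 1) ((m + d : ℕ) : ℤ) = ∅ := by
      rw [Finset.Icc_eq_empty_iff]; push_cast; omega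
    rw [e]
    simp [tiltedWeight, patternCount]
  | succ n hn ih =>
    refine le_trans ?_ ih
    have hdep : ∀ e : ℤ, (m : ℤ) ≤ e → DependsOn (fun z => g z *
        tiltedWeight S y a l (M.trans y a) (Finset.Icc ((m : ℤ) + d + 1) e) z)
        (Finset.Icc (1 : ℤ) e : Set ℤ) := by
      intro e he z z' hz
      have h1 := dependsOn_tiltedWeight (m := m) hS y a l (M.trans y a) e hz
      have h2 := hg fun i hi => hz i (by
        simp only [Finset.coe_Icc, Set.mem_Icc] at hi ⊢
        omega)
      simp only
      rw [h1, h2]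
    have hd1 := hdep ((n + 1 : ℕ) : ℤ) (by push_cast; omega)
    rw [h.integral_step (s := 1) (t := ((n + 1 : ℕ) : ℤ)) (by push_cast; omega) hd1]
    have e : ((n + 1 : ℕ) : ℤ) - 1 = n := by push_cast; ring
    refine integral_mono ?_ ?_ fun ω => ?_
    · have hd2 := M.dependsOn_step (s := 1) (t := ((n + 1 : ℕ) : ℤ)) (by push_cast; omega) hd1
      exact integrable_path h.measurable (W := Finset.Icc 1 (((n + 1 : ℕ) : ℤ) - 1)) hd2
    · exact integrable_path h.measurable (W := Finset.Icc 1 (n : ℤ)) (hdep n (by omega))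
    · have := M.step_mul_tiltedWeight_le hS hrel y a l (m := m) (t := ((n + 1 : ℕ) : ℤ))
        (by push_cast; omega) hg0 hg fun i => X i ω
      rw [e] at this
      exact this

/-- Chernoff bound for the tilted weights, on an event determined by the first `m` symbols and
restricted to the paths on which the pattern occurs. -/
lemma IsMTDChain.real_tilted_ge_le [IsProbabilityMeasure P] (h : IsMTDChain P X M)
    (hS : S ⊆ lags d) (hrel : M.relevant ⊆ S) (y : ℤ → A) (a : A) (l α : ℝ)
    {G : (ℤ → A) → Prop} (hG : DependsOn G (Finset.Icc (1 : ℤ) m : Set ℤ)) (hmn : m + d ≤ n) :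
    P.real {ω | G (fun i => X i ω) ∧
        0 < patternCount S (Finset.Icc ((m : ℤ) + d + 1) n) y (fun i => X i ω) ∧
        α ≤ l * patternCount (insert 0 S) (Finset.Icc ((m : ℤ) + d + 1) n) (Function.update y 0 a)
            (fun i => X i ω) - M.trans y a * (Real.exp l - 1) *
          patternCount S (Finset.Icc ((m : ℤ) + d + 1) n) y (fun i => X i ω)} ≤
      Real.exp (-α) * P.real {ω | G (fun i => X i ω) ∧
        0 < patternCount S (Finset.Icc ((m : ℤ) + d + 1) n) y (fun i => X i ω)} := by
  classical
  set I := Finset.Icc ((m : ℤ) + d + 1) (n : ℤ) with hI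
  set p := M.trans y a with hp
  set N : (ℤ → A) → ℕ := patternCount S I y with hN
  set N' : (ℤ → A) → ℕ := patternCount (insert 0 S) I (Function.update y 0 a) with hN'
  set g : (ℤ → A) → ℝ := fun z => if G z then 1 else 0 with hgdef
  set U : (ℤ → A) → ℝ := tiltedWeight S y a l p I with hU
  set k : (ℤ → A) → ℝ := fun z => if G z ∧ 0 < N z then 1 else 0 with hk
  set k0 : (ℤ → A) → ℝ := fun z => if G z ∧ N z = 0 then 1 else 0 with hk0
  set B : (ℤ → A) → ℝ := fun z => if G z ∧ 0 < N z ∧ α ≤ l * N' z - p * (Real.exp l - 1) * N z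
    then 1 else 0 with hB
  have h0 : (0 : ℤ) ∉ S := fun h => zero_notMem_lags (hS h)
  have hgd : DependsOn g (Finset.Icc (1 : ℤ) m : Set ℤ) := fun z z' hz => by
    simp only [hgdef, hG hz]
  have hsub : ∀ z z' : ℤ → A, (∀ i ∈ (Finset.Icc (1 : ℤ) n : Set ℤ), z i = z' i) →
      G z = G z' ∧ N z = N z' ∧ N' z = N' z' := by
    intro z z' hz
    have h' : ∀ i ∈ (Finset.Icc ((m : ℤ) + 1) n : Set ℤ), z i = z' i := fun i hi => hz i (by
      simp only [Finset.coe_Icc, Set.mem_Icc] at hi ⊢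
      omega)
    have h1 := dependsOn_patternCount (lags_subset_Icc hS) ((m : ℤ) + 1) n y h'
    have h2 := dependsOn_patternCount (lags_insert_subset hS) ((m : ℤ) + 1) n
      (Function.update y 0 a) h'
    rw [show (m : ℤ) + 1 + d = m + d + 1 by ring] at h1 h2
    refine ⟨hG fun i hi => hz i ?_, Nat.cast_injective h1, Nat.cast_injective h2⟩
    simp only [Finset.coe_Icc, Set.mem_Icc] at hi ⊢
    omega
  have hint : ∀ f : (ℤ → A) → ℝ, DependsOn f (Finset.Icc (1 : ℤ) n : Set ℤ) →
      Integrable (fun ω => f fun i => X i ω) P := fun f hf =>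
    integrable_path h.measurable (W := Finset.Icc 1 (n : ℤ)) hf
  have hgU : DependsOn (fun z => g z * U z) (Finset.Icc (1 : ℤ) n : Set ℤ) := fun z z' hz => by
    obtain ⟨e1, e2, e3⟩ := hsub z z' hz
    simp only [hgdef, hU, tiltedWeight, ← hN, ← hN', e1]
    rw [e2, e3]
  have hkd : DependsOn k (Finset.Icc (1 : ℤ) n : Set ℤ) := fun z z' hz => by
    obtain ⟨e1, e2, e3⟩ := hsub z z' hz
    simp only [hk, e1, e2]
  have hk0d : DependsOn k0 (Finset.Icc (1 : ℤ) n : Set ℤ) := fun z z' hz => by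
    obtain ⟨e1, e2, e3⟩ := hsub z z' hz
    simp only [hk0, e1, e2]
  have hBd : DependsOn B (Finset.Icc (1 : ℤ) n : Set ℤ) := fun z z' hz => by
    obtain ⟨e1, e2, e3⟩ := hsub z z' hz
    simp only [hB, e1, e2, e3]
  have hind : ∀ (Q : (ℤ → A) → Prop) (f : (ℤ → A) → ℝ),
      DependsOn f (Finset.Icc (1 : ℤ) n : Set ℤ) → (∀ z, Q z → f z = 1) → (∀ z, ¬ Q z → f z = 0) →
      P.real {ω | Q fun i => X i ω} = ∫ ω, f (fun i => X i ω) ∂P := by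
    intro Q f hf h1 h0
    have hm : MeasurableSet {ω | Q fun i => X i ω} := by
      have h2 : {ω | Q fun i => X i ω} = (fun ω => f fun i => X i ω) ⁻¹' {1} := by
        ext ω
        by_cases hQ : Q fun i => X i ω
        · simp [hQ, h1 _ hQ]
        · simp [hQ, h0 _ hQ]
      rw [h2]
      exact (measurable_of_dependsOn (W := Finset.Icc 1 (n : ℤ)) hf).comp
        (measurable_path h.measurable) (measurableSet_singleton _)
    rw [← integral_indicator_one hm]
    congr 1
    ext ω
    by_cases hQ : Q fun i => X i ω
    · simp [hQ, h1 _ hQ]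
    · simp [hQ, h0 _ hQ]
  have hpt : ∀ z, Real.exp α * B z ≤ g z * U z - k0 z := by
    intro z
    have hUpos : 0 < U z := Real.exp_pos _
    have hUe : U z = Real.exp (l * N' z - p * (Real.exp l - 1) * N z) := rfl
    simp only [hB, hgdef, hk0]
    by_cases hGz : G z
    · rcases Nat.eq_zero_or_pos (N z) with hz | hz
      · have hz' : N' z = 0 := Nat.le_zero.1 ((patternCount_insert_le S I h0 y z a).trans hz.le)
        have : U z = 1 := by rw [hUe, hz, hz']; simp
        simp [hGz, hz, this]
      · by_cases hα : α ≤ l * N' z - p * (Real.exp l - 1) * N z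
        · simp only [hGz, hz, hα, and_self, if_true, hz.ne', and_false, if_false]
          rw [hUe, mul_one, one_mul, sub_zero]
          exact Real.exp_le_exp.2 hα
        · simp [hGz, hz.ne', hα, hUpos.le]
    · simp [hGz]
  have hle : Real.exp α * ∫ ω, B (fun i => X i ω) ∂P ≤ ∫ ω, k (fun i => X i ω) ∂P := by
    rw [← integral_const_mul]
    calc _ ≤ ∫ ω, (g (fun i => X i ω) * U (fun i => X i ω) - k0 fun i => X i ω) ∂P :=
          integral_mono ((hint B hBd).const_mul _) ((hint _ hgU).sub (hint _ hk0d))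
            fun ω => hpt _
      _ = ∫ ω, g (fun i => X i ω) * U (fun i => X i ω) ∂P - ∫ ω, k0 (fun i => X i ω) ∂P :=
          integral_sub (hint _ hgU) (hint _ hk0d)
      _ ≤ ∫ ω, g (fun i => X i ω) ∂P - ∫ ω, k0 (fun i => X i ω) ∂P :=
          sub_le_sub_right (h.integral_mul_tiltedWeight_le hS hrel y a l
            (fun z => by simp only [hgdef]; split_ifs <;> norm_num) hgd hmn) _
      _ = ∫ ω, k (fun i => X i ω) ∂P := by
          rw [← integral_sub (integrable_path h.measurable (W := Finset.Icc 1 (m : ℤ)) hgd)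
            (hint _ hk0d)]
          congr 1
          ext ω
          simp only [hgdef, hk0, hk]
          by_cases hGz : G fun i => X i ω
          · rcases Nat.eq_zero_or_pos (N fun i => X i ω) with hz | hz
            · simp [hGz, hz]
            · simp [hGz, hz, hz.ne']
          · simp [hGz]
  rw [hind (fun z => G z ∧ 0 < N z ∧ α ≤ l * N' z - p * (Real.exp l - 1) * N z) B hBd
      (fun z hz => if_pos hz) (fun z hz => if_neg hz),
    hind (fun z => G z ∧ 0 < N z) k hkd (fun z hz => if_pos hz) (fun z hz => if_neg hz),
    Real.exp_neg, ← div_eq_inv_mul, le_div_iff₀ (Real.exp_pos _), mul_comm]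
  exact hle

end Tilted

section Peeling

lemma le_tilt_neg {mu α N N' p : ℝ} (hmu : 0 < mu) (hN : 0 ≤ N) (hp : 0 ≤ p)
    (h : mu * N' + α ≤ (mu - psi mu) * (p * N)) :
    α ≤ -mu * N' - p * (Real.exp (-mu) - 1) * N := by
  have h1 := psi_neg_le hmu.le
  have h2 : 0 ≤ p * N := mul_nonneg hp hN
  have h3 : psi (-mu) = Real.exp (-mu) + mu - 1 := by unfold psi; ring
  nlinarith [mul_le_mul_of_nonneg_right h1 h2]

/-- The variance proxy takes values in one of finitely many slices; in each of them a deviation of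
the empirical transition probability makes a tilted weight large. -/
lemma exists_tilt_of_deviation {ε α mu n' N N' p : ℝ} {K : ℕ} (hε : 0 < ε) (hα : 0 < α)
    (hmu : 0 < mu) (hpsi : psi mu < mu) (hN : 0 < N) (hN'0 : 0 ≤ N') (hN' : N' ≤ n') (hp : 0 ≤ p)
    (hK : mu * n' / α + 2 ≤ (1 + ε) ^ K) {l : ℕ → ℝ} (hl0 : ∀ i, 0 < l i)
    (hl : ∀ i, α ≤ l i * (Real.sqrt (2 * α * (α / (mu - psi mu) * (1 + ε) ^ (i + 1))) + α / 3) -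
      psi (l i) * (α / (mu - psi mu) * (1 + ε) ^ (i + 1)))
    (hdev : 2 * Real.sqrt (α * (1 + ε) / (2 * N)) *
        Real.sqrt (mu / (mu - psi mu) * (N' / N) + α / ((mu - psi mu) * N)) + α / (3 * N) ≤
      |N' / N - p|) :
    α ≤ -mu * N' - p * (Real.exp (-mu) - 1) * N ∨
      ∃ i ∈ Finset.range K, α ≤ l i * N' - p * (Real.exp (l i) - 1) * N ∨
        α ≤ -l i * N' - p * (Real.exp (-l i) - 1) * N := by
  have hgap : 0 < mu - psi mu := sub_pos.2 hpsi
  set g := mu - psi mu with hg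
  set W := (mu * N' + α) / g with hW
  have hW0 : 0 < W := by positivity
  rcases le_or_gt W (p * N) with hcase | hcase
  · left
    refine le_tilt_neg hmu hN.le hp ?_
    rw [hW, div_le_iff₀ hgap] at hcase
    linarith
  right
  set w := α / g with hw
  have hw0 : 0 < w := by positivity
  have hratio : W / w = mu * N' / α + 1 := by
    rw [hW, hw]; field_simp
  obtain ⟨i, hi1, hi2⟩ := exists_nat_pow_near (x := W / w) (y := 1 + ε)
    (by rw [hratio]; have : 0 ≤ mu * N' / α := by positivity
        linarith) (by linarith)
  have hiK : i < K := by
    have h1 : mu * N' / α ≤ mu * n' / α := by gcongr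
    have h2 : (1 + ε) ^ i < (1 + ε) ^ K := by linarith
    exact (pow_lt_pow_iff_right₀ (by linarith)).1 h2
  set v := w * (1 + ε) ^ (i + 1) with hv
  have hv0 : 0 < v := by positivity
  have hvW : v ≤ (1 + ε) * W := by
    rw [le_div_iff₀ hw0] at hi1
    rw [hv, pow_succ]
    nlinarith
  have hWv : W ≤ v := by
    rw [div_lt_iff₀ hw0] at hi2
    rw [hv, mul_comm]
    exact hi2.le
  have hpNv : p * N ≤ v := hcase.le.trans hWv
  have hdev' : Real.sqrt (2 * α * v) + α / 3 ≤ |N' - p * N| := by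
    have e1 : |N' - p * N| = N * |N' / N - p| := by
      rw [← abs_of_pos hN, ← abs_mul, abs_of_pos hN]
      congr 1
      field_simp
    have e2 : N * (2 * Real.sqrt (α * (1 + ε) / (2 * N)) *
        Real.sqrt (mu / g * (N' / N) + α / (g * N)) + α / (3 * N)) =
        Real.sqrt (2 * α * ((1 + ε) * W)) + α / 3 := by
      have e3 : 2 * α * ((1 + ε) * W) = (2 * N) ^ 2 * (α * (1 + ε) / (2 * N) *
          (mu / g * (N' / N) + α / (g * N))) := by
        rw [hW]; field_simp
      rw [e3, Real.sqrt_mul (by positivity), Real.sqrt_sq (by positivity),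
        Real.sqrt_mul (by positivity), mul_add]
      field_simp
    rw [e1]
    refine le_trans ?_ (mul_le_mul_of_nonneg_left hdev hN.le)
    rw [e2]
    gcongr
  refine ⟨i, Finset.mem_range.2 hiK, ?_⟩
  have hli := hl i
  have hl0i := hl0 i
  rw [← hv] at hli
  have hmul := mul_le_mul_of_nonneg_left hpNv (psi_nonneg (l i))
  rcases le_abs.1 hdev' with h1 | h1
  · left
    have h2 := mul_le_mul_of_nonneg_left h1 hl0i.le
    have h3 : l i * N' - p * (Real.exp (l i) - 1) * N =
        l i * (N' - p * N) - psi (l i) * (p * N) := by unfold psi; ring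
    linarith
  · right
    have h2 := mul_le_mul_of_nonneg_left h1 hl0i.le
    have h3 : -l i * N' - p * (Real.exp (-l i) - 1) * N =
        l i * -(N' - p * N) - psi (-l i) * (p * N) := by unfold psi; ring
    have h4 := mul_le_mul_of_nonneg_right (psi_neg_le hl0i.le)
      (mul_nonneg hp hN.le)
    linarith

/-- The number of slices of ratio `1 + ε` which cover the interval from `1` to `y + 2`. -/
lemma exists_slices {ε y : ℝ} (hε : 0 < ε) (hy : 0 ≤ y) :
    ∃ K : ℕ, 1 ≤ K ∧ (K : ℝ) = ⌈Real.log (y + 2) / Real.log (1 + ε)⌉ ∧ y + 2 ≤ (1 + ε) ^ K := by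
  have hlog : 0 < Real.log (1 + ε) := Real.log_pos (by linarith)
  have hlog2 : 0 < Real.log (y + 2) := Real.log_pos (by linarith)
  have hpos : 0 < ⌈Real.log (y + 2) / Real.log (1 + ε)⌉ := Int.ceil_pos.2 (by positivity)
  refine ⟨⌈Real.log (y + 2) / Real.log (1 + ε)⌉.toNat, by omega, ?_, ?_⟩
  · have : ((⌈Real.log (y + 2) / Real.log (1 + ε)⌉.toNat : ℕ) : ℤ) =
        ⌈Real.log (y + 2) / Real.log (1 + ε)⌉ := Int.toNat_of_nonneg hpos.le
    exact_mod_cast this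
  · have h1 := Int.le_ceil (Real.log (y + 2) / Real.log (1 + ε))
    have h2 : (⌈Real.log (y + 2) / Real.log (1 + ε)⌉ : ℝ) =
        (⌈Real.log (y + 2) / Real.log (1 + ε)⌉.toNat : ℕ) := by
      have : ((⌈Real.log (y + 2) / Real.log (1 + ε)⌉.toNat : ℕ) : ℤ) =
        ⌈Real.log (y + 2) / Real.log (1 + ε)⌉ := Int.toNat_of_nonneg hpos.le
      exact_mod_cast this.symm
    rw [h2, div_le_iff₀ hlog, ← Real.log_pow] at h1
    exact (Real.log_le_log_iff (by linarith) (by positivity)).1 h1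

end Peeling

section Deviation

variable {A : Finset ℝ} {d m n : ℕ} {S : Finset ℤ}

/-- The deviation radius of the empirical transition probability to `a`. -/
def devRadius (d m n : ℕ) (ε α mu : ℝ) (z : ℤ → A) {S : Finset ℤ} (x : S → A) (a : A) : ℝ :=
  2 * Real.sqrt (α * (1 + ε) / (2 * countBar d m n z x)) * Real.sqrt (VHat d m n α mu z x a) +
    α / (3 * countBar d m n z x)

lemma threshold_eq_sum_devRadius (ε α mu : ℝ) (z : ℤ → A) (x : S → A) :
    threshold d m n ε α mu z x = (1 / 2) * ∑ a, devRadius d m n ε α mu z x a := by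
  unfold threshold devRadius
  rw [Finset.sum_add_distrib, ← Finset.mul_sum, Finset.sum_const, Finset.card_univ,
    Fintype.card_coe, nsmul_eq_mul]
  have e : α * A.card / (6 * (countBar d m n z x : ℝ)) =
      1 / 2 * (A.card * (α / (3 * countBar d m n z x))) := by ring
  rw [e]
  ring

variable {Ω : Type*} [MeasurableSpace Ω] {P : Measure Ω} {X : ℤ → Ω → A} {M : MTD A d}

theorem IsMTDChain.real_deviation_le [IsProbabilityMeasure P] (h : IsMTDChain P X M)
    {ε α mu : ℝ} (hε : 0 < ε) (hα : 0 < α) (hmu : 0 < mu) (hpsi : psi mu < mu)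
    (hS : S ⊆ lags d) (hrel : M.relevant ⊆ S) (hmn : m + d ≤ n) (y : ℤ → A) (a : A)
    {G : (ℤ → A) → Prop} (hG : DependsOn G (Finset.Icc (1 : ℤ) m : Set ℤ)) :
    P.real {ω | G (fun i => X i ω) ∧ 0 < countBar d m n (fun i => X i ω) (fun j : S => y j) ∧
        devRadius d m n ε α mu (fun i => X i ω) (fun j : S => y j) a ≤
          |pHat d m n (fun i => X i ω) (fun j : S => y j) a - M.trans y a|} ≤
      4 * ⌈Real.log (mu * ((n : ℝ) - m - d) / α + 2) / Real.log (1 + ε)⌉ * Real.exp (-α) *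
        P.real {ω | G (fun i => X i ω) ∧
          0 < countBar d m n (fun i => X i ω) (fun j : S => y j)} := by
  classical
  have h0 : (0 : ℤ) ∉ S := fun h => zero_notMem_lags (hS h)
  have hn' : (0 : ℝ) ≤ (n : ℝ) - m - d := by
    have : ((m + d : ℕ) : ℝ) ≤ n := by exact_mod_cast hmn
    push_cast at this
    linarith
  have hgap : 0 < mu - psi mu := sub_pos.2 hpsi
  obtain ⟨K, hK1, hKeq, hK⟩ := exists_slices hε
    (y := mu * ((n : ℝ) - m - d) / α) (by positivity)
  rw [← hKeq]
  choose l hl0 hl using fun i : ℕ => exists_bernstein_tilt (α := α)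
    (v := α / (mu - psi mu) * (1 + ε) ^ (i + 1)) hα (by positivity)
  set I := Finset.Icc ((m : ℤ) + d + 1) (n : ℤ) with hI
  set N : (ℤ → A) → ℕ := patternCount S I y with hN
  set N' : (ℤ → A) → ℕ := patternCount (insert 0 S) I (Function.update y 0 a) with hN'
  set p := M.trans y a with hp
  set E : ℝ → Set Ω := fun t => {ω | G (fun i => X i ω) ∧ 0 < N (fun i => X i ω) ∧
    α ≤ t * N' (fun i => X i ω) - p * (Real.exp t - 1) * N (fun i => X i ω)} with hE
  set Q := P.real {ω | G (fun i => X i ω) ∧ 0 < N (fun i => X i ω)} with hQ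
  have hQ0 : 0 ≤ Q := measureReal_nonneg
  have hEle : ∀ t, P.real (E t) ≤ Real.exp (-α) * Q := fun t =>
    h.real_tilted_ge_le hS hrel y a t α hG hmn
  simp_rw [countBar_eq_patternCount]
  have hsub : {ω | G (fun i => X i ω) ∧ 0 < N (fun i => X i ω) ∧
        devRadius d m n ε α mu (fun i => X i ω) (fun j : S => y j) a ≤
          |pHat d m n (fun i => X i ω) (fun j : S => y j) a - p|} ⊆
      E (-mu) ∪ ⋃ i ∈ Finset.range K, (E (l i) ∪ E (-l i)) := by
    rintro ω ⟨hGω, hNω, hdev⟩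
    have hNr : (0 : ℝ) < N (fun i => X i ω) := by exact_mod_cast hNω
    have hN'le : (N' (fun i => X i ω) : ℝ) ≤ (n : ℝ) - m - d := by
      rw [← card_Icc_times hmn]
      exact_mod_cast patternCount_le _ _ _ _
    have hpH : pHat d m n (fun i => X i ω) (fun j : S => y j) a =
        (N' (fun i => X i ω) : ℝ) / N (fun i => X i ω) := by
      unfold pHat
      rw [countBar_eq_patternCount, count_eq_patternCount h0, if_pos hNω]
    unfold devRadius VHat at hdev
    rw [hpH, countBar_eq_patternCount] at hdev
    rcases exists_tilt_of_deviation hε hα hmu hpsi hNr (Nat.cast_nonneg _) hN'le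
      (M.trans_nonneg y a) hK hl0 hl hdev with h1 | ⟨i, hi, h1 | h1⟩
    · exact Or.inl ⟨hGω, hNω, h1⟩
    · exact Or.inr (Set.mem_biUnion (Finset.mem_coe.2 hi) (Or.inl ⟨hGω, hNω, h1⟩))
    · exact Or.inr (Set.mem_biUnion (Finset.mem_coe.2 hi) (Or.inr ⟨hGω, hNω, h1⟩))
  have hexp : 0 ≤ Real.exp (-α) * Q := mul_nonneg (Real.exp_pos _).le hQ0
  calc _ ≤ P.real (E (-mu) ∪ ⋃ i ∈ Finset.range K, (E (l i) ∪ E (-l i))) :=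
        measureReal_mono hsub (measure_ne_top _ _)
    _ ≤ P.real (E (-mu)) + ∑ i ∈ Finset.range K, (P.real (E (l i)) + P.real (E (-l i))) := by
        refine (measureReal_union_le _ _).trans (add_le_add le_rfl ?_)
        refine (measureReal_biUnion_finset_le _ _).trans (Finset.sum_le_sum fun i _ => ?_)
        exact measureReal_union_le _ _
    _ ≤ Real.exp (-α) * Q + ∑ _i ∈ Finset.range K, (Real.exp (-α) * Q + Real.exp (-α) * Q) :=
        add_le_add (hEle _) (Finset.sum_le_sum fun i _ => add_le_add (hEle _) (hEle _))
    _ = (1 + 2 * K) * (Real.exp (-α) * Q) := by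
        rw [Finset.sum_const, Finset.card_range, nsmul_eq_mul]; ring
    _ ≤ (4 * K) * (Real.exp (-α) * Q) := by
        refine mul_le_mul_of_nonneg_right ?_ hexp
        have : (1 : ℝ) ≤ K := by exact_mod_cast hK1
        linarith
    _ = _ := by ring

end Deviation

section Deterministic

variable {A : Finset ℝ} {d m n : ℕ} {S : Finset ℤ}

lemma dTV_triangle (p q r : A → ℝ) : dTV p r ≤ dTV p q + dTV q r := by
  unfold dTV
  rw [← mul_add, ← Finset.sum_add_distrib]
  exact mul_le_mul_of_nonneg_left (Finset.sum_le_sum fun a _ => abs_sub_le _ _ _) (by norm_num)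

lemma dTV_comm (p q : A → ℝ) : dTV p q = dTV q p := by
  unfold dTV
  simp_rw [abs_sub_comm]

lemma dTV_lt_threshold [Nonempty A] {ε α mu : ℝ} {z : ℤ → A} {x : S → A} {q : A → ℝ}
    (h : ∀ a, ¬ devRadius d m n ε α mu z x a ≤ |pHat d m n z x a - q a|) :
    dTV (pHat d m n z x) q < threshold d m n ε α mu z x := by
  rw [threshold_eq_sum_devRadius, dTV]
  refine mul_lt_mul_of_pos_left ?_ (by norm_num)
  exact Finset.sum_lt_sum_of_nonempty Finset.univ_nonempty fun a _ => not_le.1 (h a)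

lemma sum_pHat {z : ℤ → A} {x : S → A} (h : 0 < countBar d m n z x) :
    ∑ a, pHat d m n z x a = 1 := by
  unfold pHat
  simp_rw [if_pos h]
  rw [← Finset.sum_div]
  have h' : (0 : ℝ) < countBar d m n z x := by exact_mod_cast h
  rw [div_eq_one_iff_eq h'.ne']
  unfold countBar
  push_cast
  rfl

lemma pHat_nonneg (z : ℤ → A) (x : S → A) (a : A) : 0 ≤ pHat d m n z x a := by
  unfold pHat
  split_ifs <;> positivity

/-- The constant of the sample size condition. -/
def sampleConst (ε mu : ℝ) : ℝ :=
  64 * (1 + ε) * (mu / (mu - psi mu) + 2 / (mu - psi mu)) + 3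

lemma three_le_sampleConst {ε mu : ℝ} (hε : 0 < ε) (hmu : 0 < mu) (hpsi : psi mu < mu) :
    3 ≤ sampleConst ε mu := by
  have hgap : 0 < mu - psi mu := sub_pos.2 hpsi
  have : 0 ≤ 64 * (1 + ε) * (mu / (mu - psi mu) + 2 / (mu - psi mu)) := by positivity
  unfold sampleConst
  linarith

lemma threshold_le {ε α mu δ : ℝ} (hε : 0 < ε) (hα : 0 < α) (hmu : 0 < mu) (hpsi : psi mu < mu)
    (hδ : 0 < δ) (hδ1 : δ ≤ 1) {z : ℤ → A} {x : S → A} (hN : 0 < countBar d m n z x)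
    (hr : A.card * α / countBar d m n z x ≤ 2 * δ ^ 2 / sampleConst ε mu) :
    threshold d m n ε α mu z x ≤ δ / 4 := by
  have hgap : 0 < mu - psi mu := sub_pos.2 hpsi
  have hC := three_le_sampleConst hε hmu hpsi
  have hNr : (0 : ℝ) < countBar d m n z x := by exact_mod_cast hN
  set N : ℝ := (countBar d m n z x : ℝ) with hNdef
  set C := sampleConst ε mu with hCdef
  set g := mu - psi mu with hg
  set r := A.card * α / N with hrdef
  have hr0 : 0 ≤ r := by positivity
  have hV0 : ∀ a, 0 ≤ VHat d m n α mu z x a := fun a => by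
    have := pHat_nonneg (d := d) (m := m) (n := n) z x a
    unfold VHat
    rw [← hNdef, ← hg]
    positivity
  have hVsum : ∑ a, VHat d m n α mu z x a = mu / g + r / g := by
    unfold VHat
    rw [Finset.sum_add_distrib, ← Finset.mul_sum, sum_pHat hN, Finset.sum_const,
      Finset.card_univ, Fintype.card_coe, nsmul_eq_mul, mul_one, ← hNdef, ← hg, hrdef]
    field_simp
  have hcs : (∑ a, Real.sqrt (VHat d m n α mu z x a)) ^ 2 ≤ A.card * (mu / g + r / g) := by
    rw [← hVsum]
    refine sq_sum_le_card_mul_sum_sq.trans_eq ?_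
    rw [Finset.card_univ, Fintype.card_coe]
    congr 1
    exact Finset.sum_congr rfl fun a _ => Real.sq_sqrt (hV0 a)
  have hδ2 : δ ^ 2 ≤ δ := by nlinarith
  have hr2 : r ≤ 2 := hr.trans (by
    rw [div_le_iff₀ (by linarith)]
    nlinarith)
  have hsq : (Real.sqrt (α * (1 + ε) / (2 * N)) *
      ∑ a, Real.sqrt (VHat d m n α mu z x a)) ^ 2 ≤ (δ / 8) ^ 2 := by
    rw [mul_pow, Real.sq_sqrt (by positivity)]
    calc _ ≤ α * (1 + ε) / (2 * N) * (A.card * (mu / g + r / g)) :=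
          mul_le_mul_of_nonneg_left hcs (by positivity)
      _ = (1 + ε) / 2 * r * (mu / g + r / g) := by rw [hrdef]; ring
      _ ≤ (1 + ε) / 2 * (2 * δ ^ 2 / C) * (mu / g + 2 / g) := by gcongr
      _ = δ ^ 2 * ((1 + ε) * (mu / g + 2 / g) / C) := by ring
      _ ≤ δ ^ 2 * (1 / 64) := by
          refine mul_le_mul_of_nonneg_left ?_ (by positivity)
          rw [div_le_div_iff₀ (by linarith) (by norm_num)]
          have : C = 64 * (1 + ε) * (mu / g + 2 / g) + 3 := rfl
          linarith
      _ = (δ / 8) ^ 2 := by ring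
  have h1 := (abs_le_of_sq_le_sq' hsq (by positivity)).2
  have h2 : α * A.card / (6 * N) ≤ δ / 8 := by
    have e : α * A.card / (6 * N) = r / 6 := by rw [hrdef]; ring
    rw [e]
    have h3 : 2 * δ ^ 2 / C ≤ 2 * δ / 3 := by
      rw [div_le_div_iff₀ (by linarith) (by norm_num)]
      nlinarith
    linarith
  unfold threshold
  rw [← hNdef]
  linarith

lemma stringEvent_restrict {Ω : Type*} {X : ℤ → Ω → A} (y : ℤ → A) :
    stringEvent X (fun j : S => y j) = {ω | ∀ j ∈ S, X j ω = y j} := by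
  ext ω
  simp [stringEvent]

end Deterministic

section Pairs

variable {Ω : Type*} [MeasurableSpace Ω] {A : Finset ℝ} {d : ℕ} {P : Measure Ω}
variable {X : ℤ → Ω → A} {M : MTD A d} {S : Finset ℤ} {ℓ : ℕ}

lemma MTD.oscMin_le (M : MTD A d) {j : ℤ} (hj : j ∈ M.relevant) : M.oscMin ≤ M.osc j :=
  ciInf_le (Set.finite_range _).bddBelow (⟨j, hj⟩ : M.relevant)

lemma MTD.osc_pos (M : MTD A d) {j : ℤ} (hj : j ∈ M.relevant) : 0 < M.osc j :=
  (Finset.mem_filter.1 hj).2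

lemma MTD.oscMin_pos (M : MTD A d) (h : M.relevant.Nonempty) : 0 < M.oscMin := by
  have : Nonempty M.relevant := h.to_subtype
  obtain ⟨j, hj⟩ := exists_eq_ciInf_of_finite (f := fun j : M.relevant => M.osc j)
  unfold MTD.oscMin
  rw [← hj]
  exact M.osc_pos j.2

lemma MTD.oscMin_le_one (M : MTD A d) (hΔ : 0 < M.Delta) (h : M.relevant.Nonempty) :
    M.oscMin ≤ 1 := by
  obtain ⟨j, hj⟩ := h
  have h1 : M.osc j ≤ ∑ j ∈ M.relevant, M.osc j :=
    Finset.single_le_sum (f := M.osc) (fun i hi => (M.osc_pos hi).le) hj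
  have h2 := M.oscMin_le hj
  unfold MTD.Delta at hΔ
  linarith

instance finite_lagSets : Finite {S : Finset ℤ // M.relevant ⊆ S ∧ S ⊆ lags d ∧ S.card ≤ ℓ} :=
  Finite.of_injective
    (fun S => (⟨S.1, Finset.mem_powerset.2 S.2.2.1⟩ : (lags d).powerset))
    fun S T h => by simpa [Subtype.ext_iff] using h

lemma exists_osc_pair (M : MTD A d) [Nonempty A] {j : ℤ} (hj : j ∈ M.relevant) :
    ∃ b c : A, b ≠ c ∧ M.osc j = M.lam j * dTV (M.p j b) (M.p j c) := by
  obtain ⟨bc, hbc⟩ := exists_eq_ciSup_of_finite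
    (f := fun bc : A × A => dTV (M.p j bc.1) (M.p j bc.2))
  have h1 : M.osc j = M.lam j * dTV (M.p j bc.1) (M.p j bc.2) := by
    unfold MTD.osc
    rw [← hbc]
  refine ⟨bc.1, bc.2, fun h => ?_, h1⟩
  have := M.osc_pos hj
  rw [h1, h] at this
  simp [dTV] at this

lemma compatiblePairs_nonempty (S : Finset ℤ) (j : ℤ) (b c : A) :
    (compatiblePairs S j b c).Nonempty := by
  classical
  refine ⟨(fun _ => b, fun i => if (i : ℤ) = j then c else b), fun i => ⟨fun h => ?_, fun h => ?_⟩⟩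
  · simp [h]
  · simp [h]

/-- For every relevant lag there are two strings, differing at this lag only, which are likely and
have distant transition probabilities. -/
lemma exists_separated_pair (P : Measure Ω) (X : ℤ → Ω → A) (M : MTD A d) [Nonempty A]
    (hrel : M.relevant ⊆ S) (hS : S ⊆ lags d) (hcard : S.card ≤ ℓ) {j : ℤ} (hj : j ∈ M.relevant) :
    ∃ y y' : ℤ → A, (∀ i, i ≠ j → y i = y' i) ∧ M.osc j = dTV (M.trans y) (M.trans y') ∧
      minMaxProbSize P X M ℓ ≤ patternProb P X S y ∧
      minMaxProbSize P X M ℓ ≤ patternProb P X S y' := by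
  obtain ⟨b, c, hbc, hosc⟩ := exists_osc_pair M hj
  have hjl := relevant_subset_lags M hj
  have h1 : minMaxProbSize P X M ℓ ≤ minMaxProb P X M S :=
    ciInf_le (Set.finite_range _).bddBelow
      (⟨S, hrel, hS, hcard⟩ : {S : Finset ℤ // M.relevant ⊆ S ∧ S ⊆ lags d ∧ S.card ≤ ℓ})
  have h2 : minMaxProb P X M S ≤ ⨆ xy : compatiblePairs S j b c,
      min (P.real (stringEvent X xy.1.1)) (P.real (stringEvent X xy.1.2)) :=
    (ciInf_le (Set.finite_range _).bddBelow (⟨j, hj⟩ : M.relevant)).trans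
      (ciInf_le (Set.finite_range _).bddBelow
        (⟨(b, c), hbc⟩ : {bc : A × A // bc.1 ≠ bc.2}))
  have : Nonempty (compatiblePairs S j b c) := (compatiblePairs_nonempty S j b c).to_subtype
  obtain ⟨⟨⟨x, x'⟩, hxx⟩, hmax⟩ := exists_eq_ciSup_of_finite
    (f := fun xy : compatiblePairs S j b c =>
      min (P.real (stringEvent X xy.1.1)) (P.real (stringEvent X xy.1.2)))
  rw [← hmax] at h2
  simp only at h2
  have h3 := h1.trans h2
  have hjS := hrel hj
  have hx : x = fun i : S => extendBy b x i := string_eq_restrict b x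
  have hx' : x' = fun i : S => extendBy b x' i := string_eq_restrict b x'
  have hagree : ∀ i, i ≠ j → extendBy b x i = extendBy b x' i := by
    intro i hi
    by_cases hiS : i ∈ S
    · rw [extendBy_of_mem _ _ hiS, extendBy_of_mem _ _ hiS]
      exact (hxx ⟨i, hiS⟩).2 hi
    · simp [extendBy, hiS]
  have hb : extendBy b x j = b := by
    rw [extendBy_of_mem _ _ hjS]; exact ((hxx ⟨j, hjS⟩).1 rfl).1
  have hc : extendBy b x' j = c := by
    rw [extendBy_of_mem _ _ hjS]; exact ((hxx ⟨j, hjS⟩).1 rfl).2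
  refine ⟨extendBy b x, extendBy b x', hagree, ?_, ?_, ?_⟩
  · have hup : extendBy b x = Function.update (extendBy b x') j b := by
      funext i
      rcases eq_or_ne i j with rfl | hi
      · rw [Function.update_self, hb]
      · rw [Function.update_of_ne hi, hagree i hi]
    rw [hosc, hup]
    unfold dTV
    simp_rw [M.trans_update_sub _ hjl, hc, abs_mul, abs_of_nonneg (M.lam_nonneg j hjl),
      ← Finset.mul_sum]
    ring
  · refine h3.trans ((min_le_left _ _).trans_eq ?_)
    rw [patternProb, ← stringEvent_restrict, ← hx]
  · refine h3.trans ((min_le_right _ _).trans_eq ?_)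
    rw [patternProb, ← stringEvent_restrict, ← hx']

lemma minMaxProbSize_pos [IsProbabilityMeasure P] (hfull : FullSupport P X) [Nonempty A]
    (hne : M.relevant.Nonempty) (hcard : M.relevant.card ≤ ℓ) :
    0 < minMaxProbSize P X M ℓ := by
  have hpos : ∀ (S : Finset ℤ) (x : S → A), 0 < P.real (stringEvent X x) := fun S x =>
    ENNReal.toReal_pos (hfull S x).ne' (measure_ne_top _ _)
  have : Nonempty M.relevant := hne.to_subtype
  have : Nonempty {S : Finset ℤ // M.relevant ⊆ S ∧ S ⊆ lags d ∧ S.card ≤ ℓ} :=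
    ⟨⟨M.relevant, subset_rfl, relevant_subset_lags M, hcard⟩⟩
  obtain ⟨j₀, hj₀⟩ := hne
  obtain ⟨b₀, c₀, hbc₀, _⟩ := exists_osc_pair M hj₀
  have : Nonempty {bc : A × A // bc.1 ≠ bc.2} := ⟨⟨(b₀, c₀), hbc₀⟩⟩
  obtain ⟨S, hS⟩ := exists_eq_ciInf_of_finite
    (f := fun S : {S : Finset ℤ // M.relevant ⊆ S ∧ S ⊆ lags d ∧ S.card ≤ ℓ} =>
      minMaxProb P X M S.1)
  unfold minMaxProbSize
  rw [← hS]
  obtain ⟨j, hj⟩ := exists_eq_ciInf_of_finite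
    (f := fun j : M.relevant => ⨅ bc : {bc : A × A // bc.1 ≠ bc.2},
      ⨆ xy : compatiblePairs S.1 (j : ℤ) bc.1.1 bc.1.2,
        min (P.real (stringEvent X xy.1.1)) (P.real (stringEvent X xy.1.2)))
  unfold minMaxProb
  rw [← hj]
  obtain ⟨bc, hbc⟩ := exists_eq_ciInf_of_finite
    (f := fun bc : {bc : A × A // bc.1 ≠ bc.2} =>
      ⨆ xy : compatiblePairs S.1 (j : ℤ) bc.1.1 bc.1.2,
        min (P.real (stringEvent X xy.1.1)) (P.real (stringEvent X xy.1.2)))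
  rw [← hbc]
  obtain ⟨xy, hxy⟩ := compatiblePairs_nonempty S.1 (j : ℤ) bc.1.1 bc.1.2
  refine (lt_min (hpos _ xy.1) (hpos _ xy.2)).trans_le ?_
  exact le_ciSup (f := fun xy : compatiblePairs S.1 (j : ℤ) bc.1.1 bc.1.2 =>
    min (P.real (stringEvent X xy.1.1)) (P.real (stringEvent X xy.1.2)))
    (Set.finite_range _).bddAbove ⟨xy, hxy⟩

end Pairs

section Events

variable {Ω : Type*} [MeasurableSpace Ω] {A : Finset ℝ} {d m n : ℕ} {P : Measure Ω}
variable {X : ℤ → Ω → A} {M : MTD A d}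

lemma measurableSet_path (hX : ∀ t, Measurable (X t)) {W : Finset ℤ} {Q : (ℤ → A) → Prop}
    (hQ : DependsOn Q (W : Set ℤ)) : MeasurableSet {ω | Q fun i => X i ω} := by
  classical
  have hf : DependsOn (fun z => if Q z then (1 : ℝ) else 0) (W : Set ℤ) := fun z z' hz => by
    simp only [hQ hz]
  have h2 : {ω | Q fun i => X i ω} =
      (fun ω => (fun z => if Q z then (1 : ℝ) else 0) fun i => X i ω) ⁻¹' {1} := by
    ext ω; simp
  rw [h2]
  exact (measurable_of_dependsOn hf).comp (measurable_path hX) (measurableSet_singleton _)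

lemma dependsOn_candidate (Shat : (Finset.Icc (1 : ℤ) m → A) → Finset ℤ) (S : Finset ℤ) :
    DependsOn (fun z : ℤ → A => (Shat fun t => z t) = S) (Finset.Icc (1 : ℤ) m : Set ℤ) := by
  intro z z' h
  have : (fun t : Finset.Icc (1 : ℤ) m => z t) = fun t : Finset.Icc (1 : ℤ) m => z' t := by
    funext t
    exact h t (Finset.mem_coe.2 t.2)
  simp only [this]

lemma sum_real_candidate_le_one [IsProbabilityMeasure P] (hX : ∀ t, Measurable (X t))
    (Shat : (Finset.Icc (1 : ℤ) m → A) → Finset ℤ) (B : Finset (Finset ℤ)) :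
    ∑ S ∈ B, P.real {ω | (Shat fun t => X t ω) = S} ≤ 1 := by
  rw [← measureReal_biUnion_finset]
  · exact measureReal_le_one
  · intro S _ T _ hST
    refine Set.disjoint_left.2 fun ω h1 h2 => hST ?_
    exact h1.symm.trans h2
  · exact fun S _ => measurableSet_path hX (W := Finset.Icc 1 (m : ℤ)) (dependsOn_candidate Shat S)

lemma sum_countBar (hmn : m + d ≤ n) (z : ℤ → A) (S : Finset ℤ) :
    ((∑ x : S → A, countBar d m n z x : ℕ) : ℝ) = (n : ℝ) - m - d := by
  classical
  rw [← card_Icc_times hmn]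
  congr 1
  have a₀ : A := z 0
  rw [Finset.card_eq_sum_card_fiberwise (f := fun t => fun j : S => z (t + j)) (t := Finset.univ)
    (fun _ _ => by simp)]
  refine Finset.sum_congr rfl fun x _ => ?_
  rw [string_eq_restrict a₀ x, countBar_eq_patternCount]
  unfold patternCount
  congr 1
  refine Finset.filter_congr fun t _ => ?_
  rw [funext_iff]
  simp

lemma dependsOn_countBar_pos {S : Finset ℤ} (hS : S ⊆ lags d) (x : S → A) :
    DependsOn (fun z : ℤ → A => 0 < countBar d m n z x) (Finset.Icc ((m : ℤ) + 1) n : Set ℤ) := by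
  intro z z' h
  have h1 := dependsOn_patternCount (lags_subset_Icc hS) ((m : ℤ) + 1) n
    (extendBy (z 0) x) h
  rw [show (m : ℤ) + 1 + d = m + d + 1 by ring] at h1
  have h4 : countBar d m n z x = countBar d m n z' x := by
    have h5 : ∀ w, countBar d m n w x =
        patternCount S (Finset.Icc ((m : ℤ) + d + 1) n) (extendBy (z 0) x) w := by
      intro w
      conv_lhs => rw [string_eq_restrict (z 0) x]
      exact countBar_eq_patternCount _ _
    rw [h5, h5]
    exact Nat.cast_injective h1
  simp only [h4]

lemma sum_real_visited_le [IsProbabilityMeasure P] (hX : ∀ t, Measurable (X t))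
    (hmn : m + d ≤ n) {S : Finset ℤ} (hS : S ⊆ lags d) (E : Set Ω) :
    ∑ x : S → A, P.real (E ∩ {ω | 0 < countBar d m n (fun i => X i ω) x}) ≤
      ((n : ℝ) - m - d) * P.real E := by
  have hm : ∀ x : S → A, MeasurableSet {ω | 0 < countBar d m n (fun i => X i ω) x} := fun x =>
    measurableSet_path hX (W := Finset.Icc ((m : ℤ) + 1) n) (dependsOn_countBar_pos hS x)
  have h1 : ∀ x : S → A, P.real (E ∩ {ω | 0 < countBar d m n (fun i => X i ω) x}) =
      ∫ ω in E, {ω | 0 < countBar d m n (fun i => X i ω) x}.indicator 1 ω ∂P := by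
    intro x
    rw [integral_indicator_one (hm x), measureReal_restrict_apply (hm x), Set.inter_comm]
  have hint : ∀ x : S → A, Integrable
      ({ω | 0 < countBar d m n (fun i => X i ω) x}.indicator (1 : Ω → ℝ)) (P.restrict E) :=
    fun x => (integrable_const (1 : ℝ)).indicator (hm x)
  simp_rw [h1]
  rw [← integral_finsetSum _ fun x _ => hint x]
  calc _ ≤ ∫ _ω in E, ((n : ℝ) - m - d) ∂P := by
        refine integral_mono (integrable_finsetSum _ fun x _ => hint x)
          (integrable_const _) fun ω => ?_
        simp only
        rw [← sum_countBar hmn (fun i => X i ω) S, Nat.cast_sum]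
        refine Finset.sum_le_sum fun x _ => ?_
        by_cases h : 0 < countBar d m n (fun i => X i ω) x
        · simp only [Set.indicator_apply, Set.mem_ofPred_eq, h, if_true, Pi.one_apply]
          exact_mod_cast h
        · simp only [Set.indicator_apply, Set.mem_ofPred_eq, h, if_false]
          positivity
    _ = _ := by
        rw [integral_const, smul_eq_mul, mul_comm]
        simp

end Events

section BadEvents

variable {Ω : Type*} [MeasurableSpace Ω] {A : Finset ℝ} {d m n : ℕ} {P : Measure Ω}
variable {X : ℤ → Ω → A} {M : MTD A d}

/-- The pattern `y` occurs on `S` and the empirical transition probability to `a` after it is far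
from the true one. -/
def Deviates (M : MTD A d) (m n : ℕ) (ε α mu : ℝ) (z : ℤ → A) (S : Finset ℤ) (y : ℤ → A) (a : A) :
    Prop :=
  0 < countBar d m n z (fun j : S => y j) ∧
    devRadius d m n ε α mu z (fun j : S => y j) a ≤
      |pHat d m n z (fun j : S => y j) a - M.trans y a|

open Classical in
/-- The sets of `ℓ` lags which contain all relevant lags. -/
def supersets (M : MTD A d) (ℓ : ℕ) : Finset (Finset ℤ) :=
  ((lags d).powersetCard ℓ).filter fun S => M.relevant ⊆ S

lemma mem_supersets {ℓ : ℕ} {S : Finset ℤ} :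
    S ∈ supersets M ℓ ↔ (S ⊆ lags d ∧ S.card = ℓ) ∧ M.relevant ⊆ S := by
  simp [supersets, Finset.mem_powersetCard]

lemma card_supersets_le (M : MTD A d) (ℓ : ℕ) : (supersets M ℓ).card ≤ d.choose ℓ := by
  refine (Finset.card_filter_le _ _).trans_eq ?_
  rw [Finset.card_powersetCard, card_lags]

/-- The number of slices in the deviation bound. -/
def sliceCount (ε α mu t : ℝ) : ℝ := ⌈Real.log (mu * t / α + 2) / Real.log (1 + ε)⌉

lemma sliceCount_nonneg {ε α mu t : ℝ} (hε : 0 < ε) (hα : 0 < α) (hmu : 0 < mu) (ht : 0 ≤ t) :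
    0 ≤ sliceCount ε α mu t := by
  obtain ⟨K, -, hK, -⟩ := exists_slices hε (y := mu * t / α) (by positivity)
  rw [sliceCount, ← hK]
  positivity

variable [IsProbabilityMeasure P] {ε α mu : ℝ}

lemma cast_times_nonneg (hmn : m + d ≤ n) : (0 : ℝ) ≤ (n : ℝ) - m - d := by
  have : ((m + d : ℕ) : ℝ) ≤ n := by exact_mod_cast hmn
  push_cast at this
  linarith

lemma IsMTDChain.real_candidate_deviates_le (h : IsMTDChain P X M) (hε : 0 < ε) (hα : 0 < α)
    (hmu : 0 < mu) (hpsi : psi mu < mu) (hmn : m + d ≤ n) {ℓ : ℕ}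
    (Shat : (Finset.Icc (1 : ℤ) m → A) → Finset ℤ) {S : Finset ℤ} (hS : S ∈ supersets M ℓ)
    (y : ℤ → A) (a : A) :
    P.real {ω | (Shat fun t => X t ω) = S ∧ Deviates M m n ε α mu (fun t => X t ω) S y a} ≤
      4 * sliceCount ε α mu ((n : ℝ) - m - d) * Real.exp (-α) *
        P.real ({ω | (Shat fun t => X t ω) = S} ∩
          {ω | 0 < countBar d m n (fun t => X t ω) (fun j : S => y j)}) :=
  h.real_deviation_le hε hα hmu hpsi (mem_supersets.1 hS).1.1 (mem_supersets.1 hS).2 hmn y a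
    (dependsOn_candidate Shat S)

/-- Deviations after strings attached to the lags in `J`. -/
lemma IsMTDChain.real_exists_deviates_le (h : IsMTDChain P X M) (hε : 0 < ε) (hα : 0 < α)
    (hmu : 0 < mu) (hpsi : psi mu < mu) (hmn : m + d ≤ n) (ℓ : ℕ)
    (Shat : (Finset.Icc (1 : ℤ) m → A) → Finset ℤ) (Y : Finset ℤ → ℤ → ℤ → A) (J : Finset ℤ) :
    P.real {ω | ∃ S ∈ supersets M ℓ, (Shat fun t => X t ω) = S ∧ ∃ j ∈ J, ∃ a,
        Deviates M m n ε α mu (fun t => X t ω) S (Y S j) a} ≤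
      J.card * A.card * (4 * sliceCount ε α mu ((n : ℝ) - m - d) * Real.exp (-α)) := by
  set B := 4 * sliceCount ε α mu ((n : ℝ) - m - d) * Real.exp (-α) with hB
  have hB0 : 0 ≤ B := mul_nonneg (mul_nonneg (by norm_num)
    (sliceCount_nonneg hε hα hmu (cast_times_nonneg hmn))) (Real.exp_pos _).le
  have hsub : {ω | ∃ S ∈ supersets M ℓ, (Shat fun t => X t ω) = S ∧ ∃ j ∈ J, ∃ a,
        Deviates M m n ε α mu (fun t => X t ω) S (Y S j) a} ⊆
      ⋃ S ∈ supersets M ℓ, ⋃ j ∈ J, ⋃ a : A,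
        {ω | (Shat fun t => X t ω) = S ∧ Deviates M m n ε α mu (fun t => X t ω) S (Y S j) a} := by
    rintro ω ⟨S, hS, hSe, j, hj, a, hd⟩
    simp only [Set.mem_iUnion]
    exact ⟨S, hS, j, hj, a, hSe, hd⟩
  calc _ ≤ ∑ S ∈ supersets M ℓ, ∑ _j ∈ J, ∑ _a : A,
        B * P.real {ω | (Shat fun t => X t ω) = S} := by
        refine (measureReal_mono hsub (measure_ne_top _ _)).trans ?_
        refine (measureReal_biUnion_finset_le _ _).trans (Finset.sum_le_sum fun S hS => ?_)
        refine (measureReal_biUnion_finset_le _ _).trans (Finset.sum_le_sum fun j _ => ?_)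
        refine (measureReal_iUnion_fintype_le _).trans (Finset.sum_le_sum fun a _ => ?_)
        refine (h.real_candidate_deviates_le hε hα hmu hpsi hmn Shat hS (Y S j) a).trans ?_
        exact mul_le_mul_of_nonneg_left
          (measureReal_mono Set.inter_subset_left (measure_ne_top _ _)) hB0
    _ = J.card * A.card * B *
        ∑ S ∈ supersets M ℓ, P.real {ω | (Shat fun t => X t ω) = S} := by
        rw [Finset.mul_sum]
        refine Finset.sum_congr rfl fun S _ => ?_
        simp only [Finset.sum_const, Finset.card_univ, Fintype.card_coe, nsmul_eq_mul]
        ring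
    _ ≤ J.card * A.card * B * 1 :=
        mul_le_mul_of_nonneg_left (sum_real_candidate_le_one h.measurable Shat _) (by positivity)
    _ = _ := mul_one _

/-- Deviations after any string on the candidate set. -/
lemma IsMTDChain.real_exists_string_deviates_le (h : IsMTDChain P X M) (hε : 0 < ε) (hα : 0 < α)
    (hmu : 0 < mu) (hpsi : psi mu < mu) (hmn : m + d ≤ n) (ℓ : ℕ)
    (Shat : (Finset.Icc (1 : ℤ) m → A) → Finset ℤ) (a₀ : A) :
    P.real {ω | ∃ S ∈ supersets M ℓ, (Shat fun t => X t ω) = S ∧ ∃ x : S → A, ∃ a,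
        Deviates M m n ε α mu (fun t => X t ω) S (extendBy a₀ x) a} ≤
      ((n : ℝ) - m - d) * A.card *
        (4 * sliceCount ε α mu ((n : ℝ) - m - d) * Real.exp (-α)) := by
  have hn' := cast_times_nonneg (m := m) (n := n) (d := d) hmn
  set B := 4 * sliceCount ε α mu ((n : ℝ) - m - d) * Real.exp (-α) with hB
  have hB0 : 0 ≤ B := mul_nonneg (mul_nonneg (by norm_num)
    (sliceCount_nonneg hε hα hmu hn')) (Real.exp_pos _).le
  have hsub : {ω | ∃ S ∈ supersets M ℓ, (Shat fun t => X t ω) = S ∧ ∃ x : S → A, ∃ a,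
        Deviates M m n ε α mu (fun t => X t ω) S (extendBy a₀ x) a} ⊆
      ⋃ S ∈ supersets M ℓ, ⋃ x : S → A, ⋃ a : A,
        {ω | (Shat fun t => X t ω) = S ∧
          Deviates M m n ε α mu (fun t => X t ω) S (extendBy a₀ x) a} := by
    rintro ω ⟨S, hS, hSe, x, a, hd⟩
    simp only [Set.mem_iUnion]
    exact ⟨S, hS, x, a, hSe, hd⟩
  calc _ ≤ ∑ S ∈ supersets M ℓ, ∑ x : S → A, ∑ _a : A,
        B * P.real ({ω | (Shat fun t => X t ω) = S} ∩
          {ω | 0 < countBar d m n (fun t => X t ω) x}) := by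
        refine (measureReal_mono hsub (measure_ne_top _ _)).trans ?_
        refine (measureReal_biUnion_finset_le _ _).trans (Finset.sum_le_sum fun S hS => ?_)
        refine (measureReal_iUnion_fintype_le _).trans (Finset.sum_le_sum fun x _ => ?_)
        refine (measureReal_iUnion_fintype_le _).trans (Finset.sum_le_sum fun a _ => ?_)
        have := h.real_candidate_deviates_le hε hα hmu hpsi hmn Shat hS (extendBy a₀ x) a
        rwa [← string_eq_restrict a₀ x] at this
    _ ≤ ∑ S ∈ supersets M ℓ, A.card * B * (((n : ℝ) - m - d) *
          P.real {ω | (Shat fun t => X t ω) = S}) := by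
        refine Finset.sum_le_sum fun S hS => ?_
        refine le_trans (le_of_eq ?_) (mul_le_mul_of_nonneg_left
          (sum_real_visited_le h.measurable hmn (mem_supersets.1 hS).1.1 _)
          (mul_nonneg (Nat.cast_nonneg A.card) hB0))
        rw [Finset.mul_sum]
        refine Finset.sum_congr rfl fun x _ => ?_
        rw [Finset.sum_const, Finset.card_univ, Fintype.card_coe, nsmul_eq_mul]
        ring
    _ = A.card * B * ((n : ℝ) - m - d) *
        ∑ S ∈ supersets M ℓ, P.real {ω | (Shat fun t => X t ω) = S} := by
        rw [Finset.mul_sum]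
        exact Finset.sum_congr rfl fun S _ => by ring
    _ ≤ A.card * B * ((n : ℝ) - m - d) * 1 :=
        mul_le_mul_of_nonneg_left (sum_real_candidate_le_one h.measurable Shat _)
          (mul_nonneg (mul_nonneg (Nat.cast_nonneg _) hB0) hn')
    _ = _ := by ring

/-- Likely strings occur about as often as expected. -/
lemma IsMTDChain.real_exists_rare_le (h : IsMTDChain P X M) (hΔ : 0 < M.Delta)
    (hmn : m + d < n) (hne : M.relevant.Nonempty) (ℓ : ℕ) (Y : Finset ℤ → ℤ → ℤ → A) {q : ℝ}
    (hq : 0 ≤ q)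
    (hY : ∀ S ∈ supersets M ℓ, ∀ j ∈ M.relevant, q ≤ patternProb P X S (Y S j)) :
    P.real {ω | ∃ S ∈ supersets M ℓ, ∃ j ∈ M.relevant,
        (countBar d m n (fun t => X t ω) (fun i : S => Y S j i) : ℝ) ≤
          ((n : ℝ) - m - d) * q / 2} ≤
      d.choose ℓ * M.relevant.card * Real.exp (-(M.Delta ^ 2 * ((n : ℝ) - m - d) ^ 2 * q ^ 2 /
        (8 * ((n : ℝ) - m) * ((ℓ : ℝ) + 1) ^ 2))) := by
  have hn' := cast_times_nonneg (m := m) (n := n) (d := d) hmn.le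
  have hnm : (0 : ℝ) < (n : ℝ) - m := by
    have : ((m : ℕ) : ℝ) < n := by exact_mod_cast (by omega : m < n)
    linarith
  set E := Real.exp (-(M.Delta ^ 2 * ((n : ℝ) - m - d) ^ 2 * q ^ 2 /
        (8 * ((n : ℝ) - m) * ((ℓ : ℝ) + 1) ^ 2))) with hE
  have hE0 : 0 ≤ E := (Real.exp_pos _).le
  have hsub : {ω | ∃ S ∈ supersets M ℓ, ∃ j ∈ M.relevant,
        (countBar d m n (fun t => X t ω) (fun i : S => Y S j i) : ℝ) ≤
          ((n : ℝ) - m - d) * q / 2} ⊆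
      ⋃ S ∈ supersets M ℓ, ⋃ j ∈ M.relevant,
        {ω | (countBar d m n (fun t => X t ω) (fun i : S => Y S j i) : ℝ) ≤
          ((n : ℝ) - m - d) * q / 2} := by
    rintro ω ⟨S, hS, j, hj, hd⟩
    simp only [Set.mem_iUnion]
    exact ⟨S, hS, j, hj, hd⟩
  have hsingle : ∀ S ∈ supersets M ℓ, ∀ j ∈ M.relevant,
      P.real {ω | (countBar d m n (fun t => X t ω) (fun i : S => Y S j i) : ℝ) ≤
          ((n : ℝ) - m - d) * q / 2} ≤ E := by
    intro S hS j hj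
    obtain ⟨⟨hSl, hSc⟩, hSr⟩ := mem_supersets.1 hS
    have h1 := h.real_patternCount_le_le (m := m) (n := n) hΔ (lags_subset_Icc hSl)
      (hne.mono hSr) hmn.le (by omega) (Y S j) (u := ((n : ℝ) - m - d) * q / 2) (by positivity)
    have hcard : (1 : ℝ) ≤ S.card := by
      exact_mod_cast Finset.card_pos.2 (hne.mono hSr)
    refine le_trans (measureReal_mono ?_ (measure_ne_top _ _)) (h1.trans ?_)
    · intro ω hω
      simp only [Set.mem_ofPred_eq] at hω ⊢
      rw [countBar_eq_patternCount] at hω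
      have := mul_le_mul_of_nonneg_left (hY S hS j hj) hn'
      linarith
    · refine Real.exp_le_exp.2 (neg_le_neg ?_)
      rw [hSc] at hcard ⊢
      calc _ ≤ M.Delta ^ 2 * ((n : ℝ) - m - d) ^ 2 * q ^ 2 / (2 * ((n : ℝ) - m) * (ℓ : ℝ) ^ 2) := by
            refine div_le_div_of_nonneg_left (by positivity) (by positivity) ?_
            gcongr
            · norm_num
            · linarith
        _ = _ := by field_simp
  calc _ ≤ ∑ S ∈ supersets M ℓ, ∑ _j ∈ M.relevant, E := by
        refine (measureReal_mono hsub (measure_ne_top _ _)).trans ?_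
        refine (measureReal_biUnion_finset_le _ _).trans (Finset.sum_le_sum fun S hS => ?_)
        exact (measureReal_biUnion_finset_le _ _).trans
          (Finset.sum_le_sum fun j hj => hsingle S hS j hj)
    _ = (supersets M ℓ).card * (M.relevant.card * E) := by
        simp only [Finset.sum_const, nsmul_eq_mul]
    _ ≤ d.choose ℓ * (M.relevant.card * E) := by
        refine mul_le_mul_of_nonneg_right ?_ (by positivity)
        exact_mod_cast card_supersets_le M ℓ
    _ = _ := by ring

end BadEvents

section Cut

variable {A : Finset ℝ} {d m n : ℕ} {M : MTD A d} {ε α mu : ℝ} {S : Finset ℤ} {z : ℤ → A}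

lemma dTV_lt_threshold_of_not_deviates [Nonempty A] {y : ℤ → A}
    (hN : 0 < countBar d m n z (fun j : S => y j))
    (h : ∀ a, ¬ Deviates M m n ε α mu z S y a) :
    dTV (pHat d m n z (fun j : S => y j)) (M.trans y) <
      threshold d m n ε α mu z (fun j : S => y j) :=
  dTV_lt_threshold fun a hd => h a ⟨hN, hd⟩

lemma mem_cut_of_not_deviates [Nonempty A] {j : ℤ} (hj : j ∈ S) {y y' : ℤ → A}
    (hagree : ∀ i, i ≠ j → y i = y' i)
    (hN : 0 < countBar d m n z (fun j : S => y j)) (hN' : 0 < countBar d m n z (fun j : S => y' j))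
    (h : ∀ a, ¬ Deviates M m n ε α mu z S y a) (h' : ∀ a, ¬ Deviates M m n ε α mu z S y' a)
    {δ : ℝ} (hδ : δ ≤ dTV (M.trans y) (M.trans y'))
    (ht : threshold d m n ε α mu z (fun j : S => y j) ≤ δ / 4)
    (ht' : threshold d m n ε α mu z (fun j : S => y' j) ≤ δ / 4) :
    j ∈ cut d m n ε α mu z S := by
  classical
  refine Finset.mem_filter.2 ⟨hj, fun i => y i, fun i => y' i, fun i hi => hagree i hi, hN, hN', ?_⟩
  have h1 := dTV_lt_threshold_of_not_deviates hN h
  have h2 := dTV_lt_threshold_of_not_deviates hN' h'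
  have h3 := dTV_triangle (M.trans y) (pHat d m n z (fun j : S => y j)) (M.trans y')
  have h4 := dTV_triangle (pHat d m n z (fun j : S => y j)) (pHat d m n z (fun j : S => y' j))
    (M.trans y')
  rw [dTV_comm (M.trans y) (pHat d m n z fun j : S => y j)] at h3
  linarith

lemma cut_subset_relevant [Nonempty A] (hrel : M.relevant ⊆ S) (a₀ : A)
    (h : ∀ (x : S → A) (a : A), ¬ Deviates M m n ε α mu z S (extendBy a₀ x) a) :
    cut d m n ε α mu z S ⊆ M.relevant := by
  classical
  intro j hj
  obtain ⟨hjS, x, x', hagree, hN, hN', hle⟩ := Finset.mem_filter.1 hj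
  by_contra hjr
  have hx := string_eq_restrict a₀ x
  have hx' := string_eq_restrict a₀ x'
  have htr : M.trans (extendBy a₀ x) = M.trans (extendBy a₀ x') := by
    refine M.trans_congr_relevant fun i hi => ?_
    rw [extendBy_of_mem _ _ (hrel hi), extendBy_of_mem _ _ (hrel hi)]
    exact hagree ⟨i, hrel hi⟩ (by rintro rfl; exact hjr hi)
  have h1 := dTV_lt_threshold_of_not_deviates (M := M) (ε := ε) (α := α) (mu := mu)
    (y := extendBy a₀ x) (S := S) (z := z) (m := m) (n := n) (by rwa [← hx]) (h x)
  have h2 := dTV_lt_threshold_of_not_deviates (M := M) (ε := ε) (α := α) (mu := mu)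
    (y := extendBy a₀ x') (S := S) (z := z) (m := m) (n := n) (by rwa [← hx']) (h x')
  rw [← hx] at h1
  rw [← hx', ← htr, dTV_comm] at h2
  have h3 := dTV_triangle (pHat d m n z x) (M.trans (extendBy a₀ x)) (pHat d m n z x')
  linarith

end Cut

section Assembly

variable {Ω : Type*} [MeasurableSpace Ω] {A : Finset ℝ} {d m n : ℕ} {P : Measure Ω}
variable {X : ℤ → Ω → A} {M : MTD A d} {κ ε α mu : ℝ}

lemma minMaxProbSize_nonneg (P : Measure Ω) (X : ℤ → Ω → A) (M : MTD A d) (ℓ : ℕ) :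
    0 ≤ minMaxProbSize P X M ℓ :=
  Real.iInf_nonneg fun _ => Real.iInf_nonneg fun _ => Real.iInf_nonneg fun _ =>
    Real.iSup_nonneg fun _ => le_min measureReal_nonneg measureReal_nonneg

lemma cut_subset_of_mem_supersets [Nonempty A] {ℓ : ℕ} {S : Finset ℤ} (hS : S ∈ supersets M ℓ)
    {z : ℤ → A} (a₀ : A) (h : M.relevant.card < ℓ →
      ∀ (x : S → A) (a : A), ¬ Deviates M m n ε α mu z S (extendBy a₀ x) a) :
    cut d m n ε α mu z S ⊆ M.relevant := by
  obtain ⟨⟨hSl, hSc⟩, hSr⟩ := mem_supersets.1 hS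
  by_cases hlt : M.relevant.card < ℓ
  · exact cut_subset_relevant hSr a₀ (h hlt)
  · rw [Finset.eq_of_subset_of_card_le hSr (by omega)]
    exact Finset.filter_subset _ _

variable [IsProbabilityMeasure P]

/-- The forward step misses a relevant lag with small probability. -/
lemma IsMTDChain.real_not_relevant_subset_le (h : IsMTDChain P X M) (hfull : FullSupport P X)
    (hΔ : 0 < M.Delta) (hκ : 0 < κ) (hcov : IsCovLowerBound P X M κ) (hdm : d < m)
    (hℓ : 2 * ellStar A κ ≤ d) [Nonempty A] {Shat : (Finset.Icc (1 : ℤ) m → A) → Finset ℤ}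
    (hFS : IsFSCandidate d m (ellStar A κ) Shat) :
    P.real {ω | ¬ M.relevant ⊆ Shat fun t => X t ω} ≤
      2 * A.card * ((ellStar A κ : ℝ) + 1) * (d.choose (ellStar A κ)) *
        (d * (A.card : ℝ) ^ (ellStar A κ + 1) *
          Real.exp (-((xiStar A κ * M.Delta) ^ 2 * ((m : ℝ) - d) ^ 2 /
            (18 * m * (A.card : ℝ) ^ (2 * (ellStar A κ + 2)) * ((ellStar A κ : ℝ) + 2) ^ 2)))) := by
  have hcardle := card_relevant_le_ellStar h.measurable hfull hκ hcov
  have hA : (1 : ℝ) ≤ A.card := by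
    have := Fintype.card_pos (α := A)
    rw [Fintype.card_coe] at this
    exact_mod_cast this
  rcases Nat.eq_zero_or_pos (ellStar A κ) with h0 | hpos
  · have hempty : M.relevant = ∅ := Finset.card_eq_zero.1 (by omega)
    simp only [hempty, Finset.empty_subset, not_true_eq_false, Set.ofPred_false, measureReal_empty]
    positivity
  · have h1 := h.real_not_empiricalClose_le hΔ hdm hℓ (xiStar_nonneg (A := A) hκ)
    refine le_trans (measureReal_mono ?_ (measure_ne_top _ _)) (h1.trans ?_)
    · intro ω hω hclose
      exact hω (FSOutput.relevant_subset h.measurable hfull hκ hcov hdm hclose (hFS _))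
    · refine mul_le_mul_of_nonneg_left ?_ (by positivity)
      refine mul_le_mul_of_nonneg_right ?_ (Real.exp_pos _).le
      have hd : (1 : ℝ) ≤ d := by exact_mod_cast (by omega : 1 ≤ d)
      have h2 : (A.card : ℝ) ^ ellStar A κ ≤ (A.card : ℝ) ^ (ellStar A κ + 1) :=
        pow_le_pow_right₀ hA (by omega)
      calc (A.card : ℝ) ^ ellStar A κ ≤ 1 * (A.card : ℝ) ^ (ellStar A κ + 1) := by linarith
        _ ≤ _ := by gcongr

/-- The cut step keeps an irrelevant lag with small probability. -/
lemma IsMTDChain.real_false_positive_le (h : IsMTDChain P X M) (hε : 0 < ε) (hα : 0 < α)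
    (hmu : 0 < mu) (hpsi : psi mu < mu) (hmn : m + d ≤ n) {ℓ : ℕ} (hℓ : M.relevant.card ≤ ℓ)
    (Shat : (Finset.Icc (1 : ℤ) m → A) → Finset ℤ) (a₀ : A) :
    P.real {ω | M.relevant.card < ℓ ∧ ∃ S ∈ supersets M ℓ, (Shat fun t => X t ω) = S ∧
        ∃ x : S → A, ∃ a, Deviates M m n ε α mu (fun t => X t ω) S (extendBy a₀ x) a} ≤
      8 * A.card * (((ℓ : ℝ) - M.relevant.card) * ((n : ℝ) - m - d)) *
        sliceCount ε α mu ((n : ℝ) - m - d) * Real.exp (-α) := by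
  have hn' := cast_times_nonneg (m := m) (n := n) (d := d) hmn
  have hK := sliceCount_nonneg hε hα hmu hn'
  have hE := (Real.exp_pos (-α)).le
  rcases hℓ.lt_or_eq with hlt | heq
  · have hdiff : (1 : ℝ) ≤ (ℓ : ℝ) - M.relevant.card := by
      have : ((M.relevant.card + 1 : ℕ) : ℝ) ≤ ℓ := by exact_mod_cast hlt
      push_cast at this
      linarith
    simp only [hlt, true_and]
    refine (h.real_exists_string_deviates_le hε hα hmu hpsi hmn ℓ Shat a₀).trans ?_
    have h1 : 0 ≤ (A.card : ℝ) * ((n : ℝ) - m - d) * sliceCount ε α mu ((n : ℝ) - m - d) *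
        Real.exp (-α) := by positivity
    nlinarith
  · have : {ω | M.relevant.card < ℓ ∧ ∃ S ∈ supersets M ℓ, (Shat fun t => X t ω) = S ∧
        ∃ x : S → A, ∃ a, Deviates M m n ε α mu (fun t => X t ω) S (extendBy a₀ x) a} = ∅ := by
      ext ω
      simp only [Set.mem_ofPred_eq, Set.mem_empty_iff_false, iff_false, not_and]
      omega
    rw [this, measureReal_empty, heq]
    simp

end Assembly

section MainBound

variable {Ω : Type*} [MeasurableSpace Ω] {A : Finset ℝ} {d m n : ℕ} {P : Measure Ω}
variable {X : ℤ → Ω → A} {M : MTD A d} {κ ε α mu : ℝ} [IsProbabilityMeasure P]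

/-- The cut step drops a relevant lag with small probability. -/
lemma IsMTDChain.real_false_negative_le (h : IsMTDChain P X M) (hfull : FullSupport P X)
    (hΔ : 0 < M.Delta) (hε : 0 < ε) (hα : 0 < α) (hmu : 0 < mu) (hpsi : psi mu < mu)
    [Nonempty A] (hmn : m + d ≤ n) {ℓ : ℕ} (hℓ : M.relevant.card ≤ ℓ)
    (Shat : (Finset.Icc (1 : ℤ) m → A) → Finset ℤ)
    (hn : (m : ℝ) + d + sampleConst ε mu * A.card * α / (M.oscMin ^ 2 * minMaxProbSize P X M ℓ) ≤
      n) :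
    P.real {ω | ∃ S ∈ supersets M ℓ, (Shat fun t => X t ω) = S ∧
        ¬ M.relevant ⊆ cut d m n ε α mu (fun t => X t ω) S} ≤
      2 * A.card * ((ℓ : ℝ) + 1) * d.choose ℓ * (3 * ((A.card : ℝ) - 1) * M.relevant.card *
        Real.exp (-(M.Delta ^ 2 * ((n : ℝ) - m - d) ^ 2 * minMaxProbSize P X M ℓ ^ 2 /
          (8 * ((n : ℝ) - m) * ((ℓ : ℝ) + 1) ^ 2)))) +
      8 * A.card * M.relevant.card * sliceCount ε α mu ((n : ℝ) - m - d) * Real.exp (-α) := by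
  rcases M.relevant.eq_empty_or_nonempty with hempty | hne
  · simp [hempty]
  set q := minMaxProbSize P X M ℓ with hqdef
  have hq : 0 < q := minMaxProbSize_pos hfull hne hℓ
  have hδ := M.oscMin_pos hne
  have hδ1 := M.oscMin_le_one hΔ hne
  have hC := three_le_sampleConst hε hmu hpsi
  obtain ⟨j₀, hj₀⟩ := hne
  obtain ⟨b₀, c₀, hbc₀, -⟩ := exists_osc_pair M hj₀
  have hA : (2 : ℝ) ≤ A.card := by
    have : 1 < A.card := by
      rw [← Fintype.card_coe]
      exact Fintype.one_lt_card_iff.2 ⟨b₀, c₀, hbc₀⟩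
    exact_mod_cast this
  have hsize : sampleConst ε mu * A.card * α / (M.oscMin ^ 2 * q) ≤ (n : ℝ) - m - d := by linarith
  have hn'pos : 0 < (n : ℝ) - m - d := lt_of_lt_of_le (by positivity) hsize
  have hmn' : m + d < n := by
    have : ((m + d : ℕ) : ℝ) < n := by push_cast; linarith
    exact_mod_cast this
  have hpair : ∀ S ∈ supersets M ℓ, ∀ j ∈ M.relevant, ∃ y y' : ℤ → A, (∀ i, i ≠ j → y i = y' i) ∧
      M.osc j = dTV (M.trans y) (M.trans y') ∧ q ≤ patternProb P X S y ∧
      q ≤ patternProb P X S y' := fun S hS j hj =>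
    exists_separated_pair P X M (mem_supersets.1 hS).2 (mem_supersets.1 hS).1.1
      (mem_supersets.1 hS).1.2.le hj
  choose! Y Y' hagree hosc hY hY' using hpair
  have hrare := h.real_exists_rare_le (m := m) hΔ hmn' ⟨j₀, hj₀⟩ ℓ Y hq.le hY
  have hrare' := h.real_exists_rare_le (m := m) hΔ hmn' ⟨j₀, hj₀⟩ ℓ Y' hq.le hY'
  have hdev := h.real_exists_deviates_le hε hα hmu hpsi hmn ℓ Shat Y M.relevant
  have hdev' := h.real_exists_deviates_le hε hα hmu hpsi hmn ℓ Shat Y' M.relevant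
  set R : (Finset ℤ → ℤ → ℤ → A) → Set Ω := fun Y => {ω | ∃ S ∈ supersets M ℓ, ∃ j ∈ M.relevant,
        (countBar d m n (fun t => X t ω) (fun i : S => Y S j i) : ℝ) ≤
          ((n : ℝ) - m - d) * q / 2} with hR
  set V : (Finset ℤ → ℤ → ℤ → A) → Set Ω := fun Y => {ω | ∃ S ∈ supersets M ℓ,
    (Shat fun t => X t ω) = S ∧ ∃ j ∈ M.relevant, ∃ a,
        Deviates M m n ε α mu (fun t => X t ω) S (Y S j) a} with hV
  have hsub : {ω | ∃ S ∈ supersets M ℓ, (Shat fun t => X t ω) = S ∧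
        ¬ M.relevant ⊆ cut d m n ε α mu (fun t => X t ω) S} ⊆ (R Y ∪ R Y') ∪ (V Y ∪ V Y') := by
    rintro ω ⟨S, hS, hSe, hcut⟩
    by_contra hgood
    simp only [Set.mem_union, not_or] at hgood
    obtain ⟨⟨hr, hr'⟩, hv, hv'⟩ := hgood
    simp only [hR, hV, Set.mem_ofPred_eq, not_exists, not_and, not_le] at hr hr' hv hv'
    refine hcut fun j hj => ?_
    have hlow : ∀ y : ℤ → A, ((n : ℝ) - m - d) * q / 2 <
        countBar d m n (fun t => X t ω) (fun i : S => y i) →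
        0 < countBar d m n (fun t => X t ω) (fun i : S => y i) ∧
        threshold d m n ε α mu (fun t => X t ω) (fun i : S => y i) ≤ M.oscMin / 4 := by
      intro y hy
      have hpos : (0 : ℝ) < countBar d m n (fun t => X t ω) (fun i : S => y i) :=
        lt_trans (by positivity) hy
      refine ⟨by exact_mod_cast hpos, ?_⟩
      refine threshold_le hε hα hmu hpsi hδ hδ1 (by exact_mod_cast hpos) ?_
      rw [div_le_div_iff₀ hpos (by linarith)]
      rw [div_le_iff₀ (by positivity)] at hsize
      nlinarith [sq_nonneg M.oscMin, mul_le_mul_of_nonneg_left hy.le (sq_nonneg M.oscMin)]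
    obtain ⟨hN, ht⟩ := hlow _ (hr S hS j hj)
    obtain ⟨hN', ht'⟩ := hlow _ (hr' S hS j hj)
    exact mem_cut_of_not_deviates ((mem_supersets.1 hS).2 hj) (hagree S hS j hj) hN hN'
      (hv S hS hSe j hj) (hv' S hS hSe j hj)
      ((M.oscMin_le hj).trans_eq (hosc S hS j hj)) ht ht'
  have hunion : P.real ((R Y ∪ R Y') ∪ (V Y ∪ V Y')) ≤
      (P.real (R Y) + P.real (R Y')) + (P.real (V Y) + P.real (V Y')) :=
    (measureReal_union_le _ _).trans
      (add_le_add (measureReal_union_le _ _) (measureReal_union_le _ _))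
  refine (measureReal_mono hsub (measure_ne_top _ _)).trans (hunion.trans ?_)
  refine add_le_add ?_ ?_
  · refine (add_le_add hrare hrare').trans ?_
    set E := Real.exp (-(M.Delta ^ 2 * ((n : ℝ) - m - d) ^ 2 * q ^ 2 /
          (8 * ((n : ℝ) - m) * ((ℓ : ℝ) + 1) ^ 2)))
    have h0 : 0 ≤ (d.choose ℓ : ℝ) * M.relevant.card * E :=
      mul_nonneg (by positivity) (Real.exp_pos _).le
    have hcoef : (2 : ℝ) ≤ 2 * A.card * ((ℓ : ℝ) + 1) * (3 * ((A.card : ℝ) - 1)) := by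
      have h1 : (1 : ℝ) ≤ (ℓ : ℝ) + 1 := by
        have : (0 : ℝ) ≤ ℓ := Nat.cast_nonneg _
        linarith
      have h2 : (1 : ℝ) ≤ 3 * ((A.card : ℝ) - 1) := by linarith
      have h3 : (2 : ℝ) ≤ 2 * A.card * ((ℓ : ℝ) + 1) := by nlinarith
      nlinarith
    have := mul_le_mul_of_nonneg_right hcoef h0
    linarith
  · refine (add_le_add hdev hdev').trans_eq ?_
    ring

end MainBound

end LagSelection

end

open LagSelection
theorem theorem2 (ε mu : ℝ) (hε : 0 < ε) (hmu : 0 < mu) (hmu3 : mu < 3) (hpsi : psi mu < mu) :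
    ∃ C : ℝ, 0 < C ∧
      ∀ (A : Finset ℝ) (d m n : ℕ) (α κ : ℝ) (M : MTD A d)
        (Ω : Type*) [MeasurableSpace Ω] (P : Measure Ω) [IsProbabilityMeasure P]
        (X : ℤ → Ω → A) (Shat : (Finset.Icc (1 : ℤ) m → A) → Finset ℤ),
        IsMTDChain P X M →
        FullSupport P X →
        0 < M.Delta →
        M.NondegenerateAverages →
        0 < κ → IsCovLowerBound P X M κ →
        0 < α →
        d < m → 2 * ellStar A κ ≤ d →
        IsFSCandidate d m (ellStar A κ) Shat →
        (m : ℝ) + d + C * A.card * α / (M.oscMin ^ 2 * minMaxProbSize P X M (ellStar A κ)) ≤ n →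
        P.real {ω | fsc d m n ε α mu Shat (fun t => X t ω) ≠ M.relevant} ≤
          2 * A.card * ((ellStar A κ : ℝ) + 1) * (d.choose (ellStar A κ)) *
              (d * (A.card : ℝ) ^ (ellStar A κ + 1) *
                  Real.exp (-((xiStar A κ * M.Delta) ^ 2 * ((m : ℝ) - d) ^ 2 /
                    (18 * m * (A.card : ℝ) ^ (2 * (ellStar A κ + 2)) *
                      ((ellStar A κ : ℝ) + 2) ^ 2)))
                + 3 * ((A.card : ℝ) - 1) * M.relevant.card *
                  Real.exp (-(M.Delta ^ 2 * ((n : ℝ) - m - d) ^ 2 *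
                    minMaxProbSize P X M (ellStar A κ) ^ 2 /
                    (8 * ((n : ℝ) - m) * ((ellStar A κ : ℝ) + 1) ^ 2))))
            + 8 * A.card *
              (((ellStar A κ : ℝ) - M.relevant.card) * ((n : ℝ) - m - d) + M.relevant.card) *
              ⌈Real.log (mu * ((n : ℝ) - m - d) / α + 2) / Real.log (1 + ε)⌉ *
              Real.exp (-α) := by
  refine ⟨sampleConst ε mu, by linarith [three_le_sampleConst hε hmu hpsi], ?_⟩
  intro A d m n α κ M Ω _ P _ X Shat hchain hfull hΔ _ hκ hcov hα hdm hℓ hFS hn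
  have hne : Nonempty A := by
    have hΩ : Nonempty Ω := MeasureTheory.nonempty_of_isProbabilityMeasure P
    exact hΩ.map fun ω => X 0 ω
  have a₀ : A := Classical.arbitrary _
  have hC := three_le_sampleConst hε hmu hpsi
  have hmn : m + d ≤ n := by
    have h1 : 0 ≤ sampleConst ε mu * A.card * α /
        (M.oscMin ^ 2 * minMaxProbSize P X M (ellStar A κ)) :=
      div_nonneg (mul_nonneg (mul_nonneg (by linarith) (Nat.cast_nonneg _)) hα.le)
        (mul_nonneg (sq_nonneg _) (minMaxProbSize_nonneg P X M _))
    have h2 : ((m + d : ℕ) : ℝ) ≤ n := by push_cast; linarith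
    exact_mod_cast h2
  have hcard := card_relevant_le_ellStar hchain.measurable hfull hκ hcov
  have hmiss := hchain.real_not_relevant_subset_le hfull hΔ hκ hcov hdm hℓ hFS
  have hpos := hchain.real_false_positive_le hε hα hmu hpsi hmn hcard Shat a₀
  have hneg := hchain.real_false_negative_le hfull hΔ hε hα hmu hpsi hmn hcard Shat hn
  have hsub : {ω | fsc d m n ε α mu Shat (fun t => X t ω) ≠ M.relevant} ⊆
      {ω | ¬ M.relevant ⊆ Shat fun t => X t ω} ∪
      ({ω | ∃ S ∈ supersets M (ellStar A κ), (Shat fun t => X t ω) = S ∧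
        ¬ M.relevant ⊆ cut d m n ε α mu (fun t => X t ω) S} ∪
      {ω | M.relevant.card < ellStar A κ ∧ ∃ S ∈ supersets M (ellStar A κ),
        (Shat fun t => X t ω) = S ∧ ∃ x : S → A, ∃ a,
          Deviates M m n ε α mu (fun t => X t ω) S (extendBy a₀ x) a}) := by
    intro ω hω
    by_contra hgood
    simp only [Set.mem_union, not_or] at hgood
    obtain ⟨h1, h2, h3⟩ := hgood
    have h1' : M.relevant ⊆ Shat fun t => X t ω := not_not.1 h1
    have hout := hFS fun t => X t ω
    have hS : (Shat fun t => X t ω) ∈ supersets M (ellStar A κ) :=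
      mem_supersets.2 ⟨⟨hout.1.subset_lags, hout.2⟩, h1'⟩
    refine hω (Finset.Subset.antisymm ?_ ?_)
    · exact cut_subset_of_mem_supersets hS a₀ fun hlt x a hd => h3 ⟨hlt, _, hS, rfl, x, a, hd⟩
    · by_contra hcut
      exact h2 ⟨_, hS, rfl, hcut⟩
  refine (measureReal_mono hsub (measure_ne_top _ _)).trans ?_
  refine (measureReal_union_le _ _).trans ?_
  refine (add_le_add hmiss ((measureReal_union_le _ _).trans (add_le_add hneg hpos))).trans_eq ?_
  unfold sliceCount
  ring
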